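/- **Setting.** Let $M$ be a (Hausdorff, paracompact) manifold of dimension $n$ in the $C^\infty$, real analytic or complex analytic category, $\mathscr O$ its sheaf of complex valued functions of that class and $\mathscr T$ its (complexified) tangent sheaf, i.e. the sheaf of $\mathbb C$-derivations of $\mathscr O$. An *F-manifold* structure is an associative $\mathscr O$-bilinear multiplication on $\mathscr T$ with a global unit field $e$ such that $P_X(Z,W)=[X,ZW]-[X,Z]W-Z[X,W]$ satisfies $P_{XY}(Z,W)=X P_Y(Z,W)+Y P_X(Z,W)$. An open set $U$ is *semisimple* if $\mathscr T_U\cong\mathscr O_U^n$ as sheaves of algebras, i.e. $\mathscr T_U$ has a frame $e_1,\dots,e_n$ of orthogonal idempotents; $M$ is semisimple if it is covered by semisimple open sets. Let $M$ be a semisimple F-manifold with a nondegenerate symmetric metric $g$ on $\mathscr T$ such that $g(XY,Z)=g(X,YZ)$, and put $\theta(X)=g(e,X)$. A *Cardy category over an open set $U$* is a category enriched in locally free $\mathscr O_U$-modules of finite rank, with Hom-sheaves $\Gamma_{ab}$, together with, for each object $a$, $\mathscr O_U$-linear maps $\theta_a:\Gamma_{aa}\to\mathscr O_U$, $\iota_a:\mathscr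 T_U\to\Gamma_{aa}$, $\iota^a:\Gamma_{aa}\to\mathscr T_U$ such that: $\theta_a(\tau\sigma)=\theta_b(\sigma\tau)$, and $\Gamma_{ab}\otimes\Gamma_{ba}\to\mathscr O_U$, $\sigma\otimes\tau\mapsto\theta_a(\tau\sigma)$, is a perfect pairing of sheaves; $\iota_a$ is a unital algebra morphism with $\sigma\iota_a(X)=\iota_b(X)\sigma$ for $\sigma\in\Gamma_{ab}$; $\theta(\iota^a(\sigma)X)=\theta_a(\sigma\iota_a(X))$; and the Cardy condition $\sum_i\sigma_i\,\sigma\,\sigma^i=\iota_b\iota^a(\sigma)$ holds for $\sigma\in\Gamma_{aa}$ and every local frame $(\sigma_i)$ of $\Gamma_{ab}$ with dual frame $(\sigma^i)$ of $\Gamma_{ba}$. It is *maximal* if every fully faithful, structure preserving embedding of it into a Cardy category over $U$ is essentially surjective (no label can be added). A *Cardy fibration* $\mathscr B$ over $M$ is a stack of $\mathscr O$-linear categories on the open sets of $M$ with maps $\theta_a,\iota_a,\iota^a$ compatible with restriction which make $\mathscr B(U)$, with the sheaves $\Gamma_{ab}(V)=\mathrm{Hom}_{\mathscr B(V)}(a|_V,b|_V)$,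 a Cardy category over $U$ for every open $U$. It is *maximal* if $\mathscr B(U)$ is maximal for every semisimple open $U$. The label $\mathscr L\otimes a$, for an $\mathscr O_U$-module $\mathscr L$, is characterized by $\Gamma_{b(\mathscr L\otimes a)}\cong\mathscr L\otimes\Gamma_{ba}$ for all labels $b$ over open subsets of $U$, the isomorphism being given by composition with a morphism $\mathscr L\to\Gamma_{a(\mathscr L\otimes a)}$. An *ordered open cover* is an open cover $(U_\alpha)$ indexed by a poset in which $\alpha,\beta$ are comparable whenever $U_{\alpha}\cap U_\beta\ne\emptyset$. A *Baas–Dundas–Rognes (BDR) 2-vector bundle of rank $n$* on it consists of $n\times n$ matrices $E^{\alpha\beta}$ ($\alpha<\beta$) of vector bundles of constant rank on $U_{\alpha\beta}=U_\alpha\cap U_\beta$ with $\det(\mathrm{rk}\,E^{\alpha\beta}_{ij})=\pm1$, and isomorphisms $\phi^{\alpha\beta\gamma}_{ik}:\bigoplus_jE^{\alpha\beta}_{ij}\otimes E^{\beta\gamma}_{jk}\cong E^{\alpha\gamma}_{ik}$ ($\alpha<\beta<\gamma$), associative over $U_{\alpha\beta\gamma\delta}$. Two of them, $E$ on $(U_\alpha)$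 and $E'$ on $(V_\beta)$, are *equivalent* if there are $n\times n$ matrices $T^{\alpha\beta}$ of vector bundles on $U_\alpha\cap V_\beta$, with locally constant rank matrices of determinant $\pm1$, and isomorphisms $E^{\alpha\alpha'}T^{\alpha'\beta}\cong T^{\alpha\beta}$, $T^{\alpha\beta}E'^{\beta\beta'}\cong T^{\alpha\beta'}$ that are compatible with the $\phi$, the $\phi'$ and each other. A *system of simple labels* in $\mathscr B$ is an ordered open cover $(U_\alpha)$ of $M$ by semisimple open sets, with frames of orthogonal idempotents $e^\alpha_i$ of $\mathscr T_{U_\alpha}$ and permutations $u_{\alpha\beta}$ of $\{1,\dots,n\}$ such that $e^\alpha_i=e^\beta_{u_{\alpha\beta}(i)}$ on $U_{\alpha\beta}$, and with labels $\xi^\alpha_i\in\mathscr B(U_\alpha)$ such that $\iota_{\xi^\alpha_i}(e^\alpha_i)=1$ and $\Gamma_{\xi_i^\alpha\xi_i^\alpha}\cong\mathscr O_{U_\alpha}$. **Theorem.** Let $M$ be a semisimple F-manifold of dimension $n$ with an invariant metric and let $\mathscr B$ be a maximal Cardy fibration over $M$. Then: 1. $\mathscr B$ has a system of simple labels. 2.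 For every system of simple labels, the matrices $E^{\alpha\beta}_{ij}=\Gamma_{\xi^\beta_j\xi^\alpha_i}$ on $U_{\alpha\beta}$ with the composition maps form a BDR 2-vector bundle of rank $n$. They are permutation matrices of invertible sheaves: for $\alpha<\beta$ and each $i$, $\mathscr L=E^{\alpha\beta}_{i\,u_{\alpha\beta}(i)}$ is invertible and $\xi^\alpha_i\cong\mathscr L\otimes\xi^\beta_{u_{\alpha\beta}(i)}$ over $U_{\alpha\beta}$, while $E^{\alpha\beta}_{ij}=0$ for $j\ne u_{\alpha\beta}(i)$. 3. The BDR 2-vector bundle is canonical: those of any two systems of simple labels are equivalent. -/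

import Mathlib

open CategoryTheory TopologicalSpace Opposite
open scoped Manifold ContDiff TensorProduct

set_option linter.unusedVariables false

universe u w

/-! ### Function algebras, modules over them, vector fields -/

/-- A presheaf of algebras of complex valued functions on a topological space. -/
structure FunAlg (X : Type u) [TopologicalSpace X] where
  alg : ∀ U : Opens X, Subalgebra ℂ (U → ℂ)
  res_mem : ∀ {U V : Opens X} (h : V ≤ U) {f : U → ℂ}, f ∈ alg U →
    (fun x : V => f ⟨x.1, h x.2⟩) ∈ alg V

/-- The structure sheaf `𝒪_M` of a manifold `M` modelled on `𝕜ⁿ`: the complex valued functions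
of class `C^k` over `𝕜`.  For `𝕜 = ℝ`, `k = ∞` these are the smooth functions, for `𝕜 = ℝ`, `k = ω`
the real analytic ones, and for `𝕜 = ℂ` the holomorphic ones. -/
def manifoldFunctions (𝕜 : Type*) [RCLike 𝕜] [NormedAlgebra 𝕜 ℂ] (n : ℕ) (k : WithTop ℕ∞)
    (M : Type u) [TopologicalSpace M] [ChartedSpace (EuclideanSpace 𝕜 (Fin n)) M] :
    FunAlg M where
  alg U :=
    { carrier := {f | ContMDiff 𝓘(𝕜, EuclideanSpace 𝕜 (Fin n)) 𝓘(𝕜, ℂ) k f}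
      mul_mem' := fun {f g} hf hg =>
        (contDiff_mul (𝕜 := 𝕜) (𝔸 := ℂ) (n := k)).comp_contMDiff (hf.prodMk_space hg)
      add_mem' := fun {f g} hf hg =>
        (contDiff_add (𝕜 := 𝕜) (F := ℂ) (n := k)).comp_contMDiff (hf.prodMk_space hg)
      algebraMap_mem' := fun c => contMDiff_const }
  res_mem {U V} h f hf := ContMDiff.comp (g := f) hf (contMDiff_inclusion h)

namespace FunAlg

variable {X : Type u} [TopologicalSpace X] (A : FunAlg X)

/-- The algebra of sections over `U`. -/
def Fn (U : Opens X) : Type u := A.alg U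

instance (U : Opens X) : CommRing (A.Fn U) := inferInstanceAs (CommRing (A.alg U))

instance (U : Opens X) : Algebra ℂ (A.Fn U) := inferInstanceAs (Algebra ℂ (A.alg U))

/-- Restriction of functions. -/
def res {U V : Opens X} (h : V ≤ U) : A.Fn U →ₐ[ℂ] A.Fn V where
  toFun f := ⟨fun x => f.1 ⟨x.1, h x.2⟩, A.res_mem h f.2⟩
  map_one' := rfl
  map_mul' _ _ := rfl
  map_zero' := rfl
  map_add' _ _ := rfl
  commutes' _ := rfl

/-- Presheaves of `𝒪_W`-modules on an open set `W`. -/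
structure Mod (W : Opens X) where
  sec : ∀ V : Opens X, V ≤ W → Type u
  [acg : ∀ V h, AddCommGroup (sec V h)]
  [mod : ∀ V h, Module (A.Fn V) (sec V h)]
  res : ∀ {V V' : Opens X} (hV : V ≤ W) (h : V' ≤ V), sec V hV →+ sec V' (h.trans hV)
  res_smul : ∀ {V V' : Opens X} (hV : V ≤ W) (h : V' ≤ V) (f : A.Fn V) (s : sec V hV),
    res hV h (f • s) = A.res h f • res hV h s
  res_id : ∀ {V : Opens X} (hV : V ≤ W) (s : sec V hV), res hV le_rfl s = s
  res_res : ∀ {V V' V'' : Opens X} (hV : V ≤ W) (h : V' ≤ V) (h' : V'' ≤ V') (s : sec V hV),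
    res (h.trans hV) h' (res hV h s) = res hV (h'.trans h) s

attribute [instance] Mod.acg Mod.mod

namespace Mod

variable {A}

/-- The sheaf property. -/
def IsSheaf {W : Opens X} (E : A.Mod W) : Prop :=
  ∀ (V : Opens X) (hV : V ≤ W) (I : Type u) (N : I → Opens X) (hN : ∀ i, N i ≤ V),
    V ≤ ⨆ i, N i →
    ∀ s : ∀ i, E.sec (N i) ((hN i).trans hV),
      (∀ i j, E.res ((hN i).trans hV) (inf_le_left : N i ⊓ N j ≤ N i) (s i) =
        E.res ((hN j).trans hV) (inf_le_right : N i ⊓ N j ≤ N j) (s j)) →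
      ∃! t : E.sec V hV, ∀ i, E.res hV (hN i) t = s i

/-- `s` is a frame of `E` over `V`: it induces an isomorphism of presheaves `𝒪_V^r ≅ E|_V`. -/
def IsFrame {W : Opens X} (E : A.Mod W) {V : Opens X} (hV : V ≤ W) {r : ℕ}
    (s : Fin r → E.sec V hV) : Prop :=
  ∀ (V' : Opens X) (h : V' ≤ V),
    Function.Bijective (fun c : Fin r → A.Fn V' => ∑ i, c i • E.res hV h (s i))

/-- Locally free of finite rank (the rank may vary). -/
def IsLocallyFree {W : Opens X} (E : A.Mod W) : Prop :=
  ∀ x ∈ W, ∃ (V : Opens X) (hV : V ≤ W), x ∈ V ∧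
    ∃ (r : ℕ) (s : Fin r → E.sec V hV), E.IsFrame hV s

/-- Locally free of constant rank `r`. -/
def HasRank {W : Opens X} (E : A.Mod W) (r : ℕ) : Prop :=
  ∀ x ∈ W, ∃ (V : Opens X) (hV : V ≤ W), x ∈ V ∧
    ∃ s : Fin r → E.sec V hV, E.IsFrame hV s

/-- Restriction to a smaller open set. -/
def restrict {W W' : Opens X} (E : A.Mod W) (hW : W' ≤ W) : A.Mod W' where
  sec V h := E.sec V (h.trans hW)
  res hV h := E.res (hV.trans hW) h
  res_smul hV h := E.res_smul (hV.trans hW) h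
  res_id hV := E.res_id (hV.trans hW)
  res_res hV h h' := E.res_res (hV.trans hW) h h'

/-- Morphisms of presheaves of modules. -/
structure Hom {W : Opens X} (E F : A.Mod W) where
  app : ∀ (V : Opens X) (h : V ≤ W), E.sec V h →ₗ[A.Fn V] F.sec V h
  nat : ∀ {V V' : Opens X} (hV : V ≤ W) (h : V' ≤ V) (s : E.sec V hV),
    F.res hV h (app V hV s) = app V' (h.trans hV) (E.res hV h s)

/-- Bilinear maps `E × F → G` over an open set `W` on which `E`, `F`, `G` are all defined, that is,
morphisms `E ⊗ F → G` over `W`. -/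
structure Pairing {W₁ W₂ W₃ : Opens X} (E : A.Mod W₁) (F : A.Mod W₂) (G : A.Mod W₃)
    (W : Opens X) (h₁ : W ≤ W₁) (h₂ : W ≤ W₂) (h₃ : W ≤ W₃) where
  app : ∀ (V : Opens X) (h : V ≤ W),
    E.sec V (h.trans h₁) →ₗ[A.Fn V] F.sec V (h.trans h₂) →ₗ[A.Fn V] G.sec V (h.trans h₃)
  nat : ∀ {V V' : Opens X} (hV : V ≤ W) (h : V' ≤ V) (s : E.sec V (hV.trans h₁))
    (t : F.sec V (hV.trans h₂)),
    G.res (hV.trans h₃) h (app V hV s t) =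
      app V' (h.trans hV) (E.res (hV.trans h₁) h s) (F.res (hV.trans h₂) h t)

/-- Precomposition of a pairing with a morphism in the first variable. -/
def Pairing.precomp {W₁ W₂ W₃ : Opens X} {E E' : A.Mod W₁} {F : A.Mod W₂} {G : A.Mod W₃}
    {W : Opens X} {h₁ : W ≤ W₁} {h₂ : W ≤ W₂} {h₃ : W ≤ W₃} (p : Pairing E F G W h₁ h₂ h₃)
    (m : E'.Hom E) : Pairing E' F G W h₁ h₂ h₃ where
  app V h := (p.app V h).comp (m.app V (h.trans h₁))
  nat hV h s t := by
    simp only [LinearMap.comp_apply, p.nat, m.nat]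

/-- The morphism of sheaves `⨁ j, E j ⊗ F j → G` over `W` induced by a family of pairings is an
isomorphism.  (For locally free sheaves the presheaf tensor product is already the tensor product
of sheaves on every sufficiently small open set.) -/
def IsTensorIso {J : Type} [Fintype J] {W W₃ : Opens X} {W₁ W₂ : J → Opens X}
    {E : ∀ j, A.Mod (W₁ j)} {F : ∀ j, A.Mod (W₂ j)} {G : A.Mod W₃}
    {h₁ : ∀ j, W ≤ W₁ j} {h₂ : ∀ j, W ≤ W₂ j} {h₃ : W ≤ W₃}
    (p : ∀ j, Pairing (E j) (F j) G W (h₁ j) (h₂ j) h₃) : Prop :=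
  ∀ x ∈ W, ∃ (V : Opens X) (hV : V ≤ W), x ∈ V ∧ ∀ (V' : Opens X) (h : V' ≤ V),
    Function.Bijective
      (fun t : ∀ j, (E j).sec V' ((h.trans hV).trans (h₁ j)) ⊗[A.Fn V']
          (F j).sec V' ((h.trans hV).trans (h₂ j)) =>
        ∑ j, TensorProduct.lift ((p j).app V' (h.trans hV)) (t j))

end Mod

/-- `𝒪_W` as a module over itself. -/
def str (W : Opens X) : A.Mod W where
  sec V _ := A.Fn V
  res _ h := (A.res h : A.Fn _ →+ A.Fn _)
  res_smul _ h f s := map_mul (A.res h) f s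
  res_id _ _ := rfl
  res_res _ _ _ _ := rfl

/-- Sections over `U` of the (complexified) tangent sheaf: the `ℂ`-linear derivations of the
sheaf `𝒪_U`. -/
def derivations (U : Opens X) :
    AddSubgroup ((V : {V : Opens X // V ≤ U}) → Derivation ℂ (A.Fn V) (A.Fn V)) where
  carrier := {D | ∀ (V V' : Opens X) (hV : V ≤ U) (h : V' ≤ V) (f : A.Fn V),
    A.res h (D ⟨V, hV⟩ f) = D ⟨V', h.trans hV⟩ (A.res h f)}
  zero_mem' := fun _ _ _ _ _ => rfl
  add_mem' := fun {D D'} hD hD' V V' hV h f => by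
    change A.res h (D ⟨V, hV⟩ f + D' ⟨V, hV⟩ f) = _
    rw [map_add, hD V V' hV h f, hD' V V' hV h f]
    rfl
  neg_mem' := fun {D} hD V V' hV h f => by
    change A.res h (-D ⟨V, hV⟩ f) = _
    rw [map_neg, hD V V' hV h f]
    rfl

/-- The vector fields over `U`. -/
def VField (U : Opens X) : Type u := A.derivations U

namespace VField

variable {A}

instance {U : Opens X} : AddCommGroup (A.VField U) :=
  inferInstanceAs (AddCommGroup (A.derivations U))

instance {U : Opens X} : SMul (A.Fn U) (A.VField U) where
  smul f D := ⟨fun V => A.res V.2 f • D.1 V, fun V V' hV h g => by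
    change A.res h (A.res hV f * D.1 ⟨V, hV⟩ g) =
      A.res (h.trans hV) f * D.1 ⟨V', h.trans hV⟩ (A.res h g)
    rw [map_mul, D.2 V V' hV h g]
    rfl⟩

instance {U : Opens X} : Module (A.Fn U) (A.VField U) where
  one_smul D := Subtype.ext <| funext fun V => by
    change A.res V.2 1 • D.1 V = _
    rw [map_one, one_smul]
  mul_smul f g D := Subtype.ext <| funext fun V => by
    change A.res V.2 (f * g) • D.1 V = A.res V.2 f • A.res V.2 g • D.1 V
    rw [map_mul, mul_smul]
  smul_zero f := Subtype.ext <| funext fun V => smul_zero (A.res V.2 f)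
  smul_add f D D' := Subtype.ext <| funext fun V => smul_add (A.res V.2 f) (D.1 V) (D'.1 V)
  add_smul f g D := Subtype.ext <| funext fun V => by
    change A.res V.2 (f + g) • D.1 V = A.res V.2 f • D.1 V + A.res V.2 g • D.1 V
    rw [map_add, add_smul]
  zero_smul D := Subtype.ext <| funext fun V => by
    change A.res V.2 0 • D.1 V = 0
    rw [map_zero, zero_smul]

/-- Restriction of vector fields. -/
def res {U V : Opens X} (h : V ≤ U) : A.VField U →+ A.VField V where
  toFun D := ⟨fun V' => D.1 ⟨V'.1, V'.2.trans h⟩, fun V' V'' hV' h' f => D.2 V' V'' _ h' f⟩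
  map_zero' := rfl
  map_add' _ _ := rfl

/-- The Lie bracket of vector fields. -/
def bracket {U : Opens X} (D D' : A.VField U) : A.VField U :=
  ⟨fun V => ⁅D.1 V, D'.1 V⁆, fun V V' hV h f => by
    rw [Derivation.commutator_apply, Derivation.commutator_apply, map_sub,
      D.2 V V' hV h, D'.2 V V' hV h, D'.2 V V' hV h, D.2 V V' hV h]⟩

end VField

/-- The tangent sheaf over an open set `W`. -/
def tangent (W : Opens X) : A.Mod W where
  sec V _ := A.VField V
  res _ h := VField.res h
  res_smul _ _ _ _ := rfl
  res_id _ _ := rfl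
  res_res _ _ _ _ := rfl

/-! ### F-manifolds -/

/-- An F-manifold structure: an associative multiplication with unit on the tangent sheaf which
satisfies the Hertling--Manin identity. -/
structure FMan where
  mul : ∀ U : Opens X, A.VField U →ₗ[A.Fn U] A.VField U →ₗ[A.Fn U] A.VField U
  mul_res : ∀ {U V : Opens X} (h : V ≤ U) (Y Z : A.VField U),
    VField.res h (mul U Y Z) = mul V (VField.res h Y) (VField.res h Z)
  mul_assoc : ∀ (U : Opens X) (Y Z T : A.VField U),
    mul U (mul U Y Z) T = mul U Y (mul U Z T)
  e : A.VField ⊤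
  e_mul : ∀ (U : Opens X) (Y : A.VField U), mul U (VField.res le_top e) Y = Y
  mul_e : ∀ (U : Opens X) (Y : A.VField U), mul U Y (VField.res le_top e) = Y
  hertling_manin : ∀ (U : Opens X) (Y Z T T' : A.VField U),
    let P := fun R S S' : A.VField U =>
      VField.bracket R (mul U S S') - mul U (VField.bracket R S) S' - mul U S (VField.bracket R S')
    P (mul U Y Z) T T' = mul U Y (P Z T T') + mul U Z (P Y T T')

namespace FMan

variable {A} (S : A.FMan)

/-- A frame of orthogonal idempotents over `U`; it amounts to an isomorphism of sheaves of
algebras `𝒪_U^n ≅ 𝒯_U`. -/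
structure IsIdempotentFrame {n : ℕ} {U : Opens X} (ε : Fin n → A.VField U) : Prop where
  frame : (A.tangent U).IsFrame le_rfl ε
  mul_self : ∀ i, S.mul U (ε i) (ε i) = ε i
  mul_ne : ∀ i j, i ≠ j → S.mul U (ε i) (ε j) = 0

/-- The open set `U` is semisimple: `𝒯_U ≅ 𝒪_U^n` as sheaves of algebras. -/
def IsSemisimpleOn (n : ℕ) (U : Opens X) : Prop :=
  ∃ ε : Fin n → A.VField U, S.IsIdempotentFrame ε

/-- Semisimple F-manifolds: there are local isomorphisms `𝒯 ≅ 𝒪^n` of sheaves of algebras. -/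
def IsSemisimple (n : ℕ) : Prop :=
  ∀ x : X, ∃ U : Opens X, x ∈ U ∧ S.IsSemisimpleOn n U

/-- An invariant metric on the tangent sheaf. -/
structure Metric where
  g : ∀ U : Opens X, A.VField U →ₗ[A.Fn U] A.VField U →ₗ[A.Fn U] A.Fn U
  g_res : ∀ {U V : Opens X} (h : V ≤ U) (Y Z : A.VField U),
    A.res h (g U Y Z) = g V (VField.res h Y) (VField.res h Z)
  symm : ∀ (U : Opens X) (Y Z : A.VField U), g U Y Z = g U Z Y
  invariant : ∀ (U : Opens X) (Y Z T : A.VField U), g U (S.mul U Y Z) T = g U Y (S.mul U Z T)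
  nondegenerate : ∀ (U : Opens X) (φ : (A.tangent U).Hom (A.str U)),
    ∃! Y : A.VField U, ∀ (V : Opens X) (h : V ≤ U) (Z : A.VField V),
      φ.app V h Z = g V (VField.res h Y) Z

/-- The trace form `θ(Y) = g(e, Y)`. -/
def Metric.θ {S : A.FMan} (g : S.Metric) (U : Opens X) (Y : A.VField U) : A.Fn U :=
  g.g U (VField.res le_top S.e) Y

end FMan

/-! ### Cardy categories over an open set -/

/-- Categories enriched in presheaves of `𝒪_U`-modules.  `comp` is written in the order of
composition of maps. -/
structure EnrCat (U : Opens X) where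
  Obj : Type w
  Γ : Obj → Obj → A.Mod U
  comp : ∀ a b c : Obj, Mod.Pairing (Γ b c) (Γ a b) (Γ a c) U le_rfl le_rfl le_rfl
  one : ∀ (a : Obj) (V : Opens X) (h : V ≤ U), (Γ a a).sec V h
  one_res : ∀ (a : Obj) {V V' : Opens X} (hV : V ≤ U) (h : V' ≤ V),
    (Γ a a).res hV h (one a V hV) = one a V' (h.trans hV)
  one_comp : ∀ (a b : Obj) (V : Opens X) (h : V ≤ U) (σ : (Γ a b).sec V h),
    (comp a b b).app V h (one b V h) σ = σ
  comp_one : ∀ (a b : Obj) (V : Opens X) (h : V ≤ U) (σ : (Γ a b).sec V h),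
    (comp a a b).app V h σ (one a V h) = σ
  assoc : ∀ (a b c d : Obj) (V : Opens X) (h : V ≤ U) (ρ : (Γ c d).sec V h)
    (τ : (Γ b c).sec V h) (σ : (Γ a b).sec V h),
    (comp a b d).app V h ((comp b c d).app V h ρ τ) σ =
      (comp a c d).app V h ρ ((comp a b c).app V h τ σ)

namespace EnrCat

variable {A} {U : Opens X} (C : A.EnrCat U)

/-- Two objects are isomorphic. -/
def IsoObj (a b : C.Obj) : Prop :=
  ∃ (σ : (C.Γ a b).sec U le_rfl) (τ : (C.Γ b a).sec U le_rfl),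
    (C.comp a b a).app U le_rfl τ σ = C.one a U le_rfl ∧
    (C.comp b a b).app U le_rfl σ τ = C.one b U le_rfl

/-- The structure of a Calabi--Yau category over `U` with transition morphisms from and to the
tangent sheaf which satisfies the Cardy condition. -/
structure CardyStr {S : A.FMan} (g : S.Metric) where
  isSheaf : ∀ a b, (C.Γ a b).IsSheaf
  locallyFree : ∀ a b, (C.Γ a b).IsLocallyFree
  tr : ∀ a, (C.Γ a a).Hom (A.str U)
  tr_comm : ∀ (a b : C.Obj) (V : Opens X) (h : V ≤ U) (σ : (C.Γ a b).sec V h)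
    (τ : (C.Γ b a).sec V h),
    (tr a).app V h ((C.comp a b a).app V h τ σ) = (tr b).app V h ((C.comp b a b).app V h σ τ)
  perfect : ∀ (a b : C.Obj) (V : Opens X) (hV : V ≤ U)
    (φ : ((C.Γ b a).restrict hV).Hom (A.str V)),
    ∃! σ : (C.Γ a b).sec V hV, ∀ (V' : Opens X) (h : V' ≤ V) (τ : (C.Γ b a).sec V' (h.trans hV)),
      φ.app V' h τ =
        (tr a).app V' (h.trans hV)
          ((C.comp a b a).app V' (h.trans hV) τ ((C.Γ a b).res hV h σ))
  iota : ∀ a, (A.tangent U).Hom (C.Γ a a)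
  iota_one : ∀ (a : C.Obj) (V : Opens X) (h : V ≤ U),
    (iota a).app V h (VField.res le_top S.e) = C.one a V h
  iota_mul : ∀ (a : C.Obj) (V : Opens X) (h : V ≤ U) (Y Z : A.VField V),
    (iota a).app V h (S.mul V Y Z) =
      (C.comp a a a).app V h ((iota a).app V h Y) ((iota a).app V h Z)
  iotaUp : ∀ a, (C.Γ a a).Hom (A.tangent U)
  central : ∀ (a b : C.Obj) (V : Opens X) (h : V ≤ U) (Y : A.VField V) (σ : (C.Γ a b).sec V h),
    (C.comp a a b).app V h σ ((iota a).app V h Y) = (C.comp a b b).app V h ((iota b).app V h Y) σ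
  adjoint : ∀ (a : C.Obj) (V : Opens X) (h : V ≤ U) (Y : A.VField V) (σ : (C.Γ a a).sec V h),
    g.θ V (S.mul V ((iotaUp a).app V h σ) Y) =
      (tr a).app V h ((C.comp a a a).app V h σ ((iota a).app V h Y))
  /-- The Cardy condition `π_b^a = ι_b ι^a`, where `π_b^a σ = ∑ i, s i ∘ σ ∘ t i` for any local
  frame `s` of `Γ a b` with dual frame `t` in `Γ b a`. -/
  cardy : ∀ (a b : C.Obj) (V : Opens X) (h : V ≤ U) (r : ℕ)
    (s : Fin r → (C.Γ a b).sec V h) (t : Fin r → (C.Γ b a).sec V h),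
    (C.Γ a b).IsFrame h s → (C.Γ b a).IsFrame h t →
    (∀ i j, (tr a).app V h ((C.comp a b a).app V h (t j) (s i)) =
      (if i = j then 1 else 0 : A.Fn V)) →
    ∀ σ : (C.Γ a a).sec V h,
      ∑ i, (C.comp b a b).app V h ((C.comp a a b).app V h (s i) σ) (t i) =
        (iota b).app V h ((iotaUp a).app V h σ)

/-- An embedding of Cardy categories over `U`: a fully faithful enriched functor which preserves
the whole structure. -/
structure Embedding {C D : A.EnrCat U} {S : A.FMan} {g : S.Metric}
    (c : C.CardyStr g) (d : D.CardyStr g) where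
  obj : C.Obj → D.Obj
  map : ∀ a b, (C.Γ a b).Hom (D.Γ (obj a) (obj b))
  bij : ∀ a b V h, Function.Bijective ((map a b).app V h)
  map_one : ∀ a V h, (map a a).app V h (C.one a V h) = D.one (obj a) V h
  map_comp : ∀ a b b' V h (τ : (C.Γ b b').sec V h) (σ : (C.Γ a b).sec V h),
    (map a b').app V h ((C.comp a b b').app V h τ σ) =
      (D.comp _ _ _).app V h ((map b b').app V h τ) ((map a b).app V h σ)
  map_tr : ∀ a V h (σ : (C.Γ a a).sec V h),
    (d.tr (obj a)).app V h ((map a a).app V h σ) = (c.tr a).app V h σ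
  map_iota : ∀ a V h (Y : A.VField V),
    (map a a).app V h ((c.iota a).app V h Y) = (d.iota (obj a)).app V h Y
  map_iotaUp : ∀ a V h (σ : (C.Γ a a).sec V h),
    (d.iotaUp (obj a)).app V h ((map a a).app V h σ) = (c.iotaUp a).app V h σ

/-- A Cardy category over `U` is maximal if it cannot be properly enlarged: every embedding into
a Cardy category over `U` is essentially surjective. -/
def CardyStr.IsMaximal {C : A.EnrCat.{u, w} U} {S : A.FMan} {g : S.Metric}
    (c : C.CardyStr g) : Prop :=
  ∀ (D : A.EnrCat.{u, w} U) (d : D.CardyStr g) (J : Embedding c d) (y : D.Obj),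
    ∃ a : C.Obj, D.IsoObj y (J.obj a)

end EnrCat

/-! ### Cardy fibrations -/

/-- Stacks of `𝒪`-linear categories on the open sets of `X`. -/
structure LinStack where
  F : Pseudofunctor (LocallyDiscrete (Opens X)ᵒᵖ) Cat.{u, w}
  isStack : F.IsStack (Opens.grothendieckTopology X)
  [pre : ∀ U : Opens X, Preadditive (F.obj (.mk (op U)))]
  [lin : ∀ U : Opens X, Linear (A.Fn U) (F.obj (.mk (op U)))]
  map_add : ∀ {U V : Opens X} (h : V ≤ U) {a b : F.obj (.mk (op U))} (σ τ : a ⟶ b),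
    (F.map (homOfLE h).op.toLoc).toFunctor.map (σ + τ) =
      (F.map (homOfLE h).op.toLoc).toFunctor.map σ + (F.map (homOfLE h).op.toLoc).toFunctor.map τ
  map_smul : ∀ {U V : Opens X} (h : V ≤ U) {a b : F.obj (.mk (op U))} (f : A.Fn U) (σ : a ⟶ b),
    (F.map (homOfLE h).op.toLoc).toFunctor.map (f • σ) =
      A.res h f • (F.map (homOfLE h).op.toLoc).toFunctor.map σ

attribute [instance] LinStack.pre LinStack.lin

namespace LinStack

variable {A} (B : A.LinStack)

/-- The labels over `U`. -/
abbrev Lab (U : Opens X) := B.F.obj (.mk (op U))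

/-- Restriction of labels. -/
abbrev rs {U V : Opens X} (h : V ≤ U) (a : B.Lab U) : B.Lab V :=
  (B.F.map (homOfLE h).op.toLoc).toFunctor.obj a

open Pseudofunctor.LocallyDiscreteOpToCat

/-- The sheaf `Γ_ab` over `W` of morphisms between the restrictions of two labels `a` and `b`,
which are defined over open sets that contain `W`. -/
def Γ {U₁ U₂ : Opens X} (a : B.Lab U₁) (b : B.Lab U₂) (W : Opens X) (h₁ : W ≤ U₁)
    (h₂ : W ≤ U₂) : A.Mod W where
  sec V h := B.rs (h.trans h₁) a ⟶ B.rs (h.trans h₂) b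
  res {V V'} hV h :=
    AddMonoidHom.mk' (fun σ => pullHom (f₁ := homOfLE (hV.trans h₁)) (f₂ := homOfLE (hV.trans h₂)) σ
        (homOfLE h) (homOfLE ((h.trans hV).trans h₁)) (homOfLE ((h.trans hV).trans h₂)) rfl rfl)
      (fun σ τ => by
        simp only [pullHom, B.map_add, Preadditive.comp_add, Preadditive.add_comp])
  res_smul {V V'} hV h f σ := by
    simp only [pullHom, AddMonoidHom.mk'_apply, B.map_smul, Linear.comp_smul,
      Linear.smul_comp]
  res_id hV σ := pullHom_id σ
  res_res hV h h' σ := pullHom_pullHom σ _ _ _ _ _ _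

theorem pullHom_comp {U₁ U₂ U₃ V V' : Opens X} {a : B.Lab U₁} {b : B.Lab U₂} {c : B.Lab U₃}
    (h₁ : V ≤ U₁) (h₂ : V ≤ U₂) (h₃ : V ≤ U₃) (h : V' ≤ V)
    (σ : B.rs h₁ a ⟶ B.rs h₂ b) (τ : B.rs h₂ b ⟶ B.rs h₃ c) :
    pullHom (f₁ := homOfLE h₁) (f₂ := homOfLE h₃) (σ ≫ τ) (homOfLE h) (homOfLE (h.trans h₁))
        (homOfLE (h.trans h₃)) rfl rfl =
      pullHom (f₁ := homOfLE h₁) (f₂ := homOfLE h₂) σ (homOfLE h) (homOfLE (h.trans h₁))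
          (homOfLE (h.trans h₂)) rfl rfl ≫
        pullHom (f₁ := homOfLE h₂) (f₂ := homOfLE h₃) τ (homOfLE h) (homOfLE (h.trans h₂))
          (homOfLE (h.trans h₃)) rfl rfl := by
  simp [pullHom]

/-- Composition of local morphisms of labels. -/
def comp {U₁ U₂ U₃ : Opens X} (a : B.Lab U₁) (b : B.Lab U₂) (c : B.Lab U₃)
    (W₁ W₂ W₃ W : Opens X) (h₁₂ : W₁ ≤ U₂) (h₁₃ : W₁ ≤ U₃) (h₂₁ : W₂ ≤ U₁) (h₂₂ : W₂ ≤ U₂)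
    (h₃₁ : W₃ ≤ U₁) (h₃₃ : W₃ ≤ U₃) (h₁ : W ≤ W₁) (h₂ : W ≤ W₂) (h₃ : W ≤ W₃) :
    Mod.Pairing (B.Γ b c W₁ h₁₂ h₁₃) (B.Γ a b W₂ h₂₁ h₂₂) (B.Γ a c W₃ h₃₁ h₃₃) W h₁ h₂ h₃ where
  app V h := LinearMap.mk₂ (A.Fn V)
    (fun (τ : B.rs ((h.trans h₁).trans h₁₂) b ⟶ B.rs ((h.trans h₁).trans h₁₃) c)
      (σ : B.rs ((h.trans h₂).trans h₂₁) a ⟶ B.rs ((h.trans h₂).trans h₂₂) b) => σ ≫ τ)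
    (fun _ _ _ => Preadditive.comp_add _ _ _ _ _ _) (fun _ _ _ => Linear.comp_smul _ _ _ _ _ _)
    (fun _ _ _ => Preadditive.add_comp _ _ _ _ _ _) (fun _ _ _ => Linear.smul_comp _ _ _ _ _ _)
  nat {V V'} hV h τ σ := by
    exact B.pullHom_comp (hV.trans (h₂.trans h₂₁)) (hV.trans (h₂.trans h₂₂))
      (hV.trans (h₁.trans h₁₃)) h σ τ

/-- The identity of the restriction of a label. -/
def one {U : Opens X} (a : B.Lab U) (W : Opens X) (h₁ : W ≤ U) (V : Opens X) (h : V ≤ W) :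
    (B.Γ a a W h₁ h₁).sec V h :=
  𝟙 (B.rs (h.trans h₁) a)

/-- The category of labels over `U`, enriched through the sheaves `Γ_ab`. -/
def enr (U : Opens X) : A.EnrCat U where
  Obj := B.Lab U
  Γ a b := B.Γ a b U le_rfl le_rfl
  comp a b c := B.comp a b c U U U U _ _ _ _ _ _ _ _ _
  one a V h := B.one a U le_rfl V h
  one_res a V V' hV h := by
    change pullHom (𝟙 _) _ _ _ rfl rfl = 𝟙 _
    simp [pullHom]
  one_comp a b V h σ := Category.comp_id _
  comp_one a b V h σ := Category.id_comp _
  assoc a b c d V h ρ τ σ := Category.assoc _ _ _ |>.symm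

/-- For `W ≤ V ≤ U` and a label `a` over `U`, the identification of the endomorphisms of
`(a|_V)|_W` with those of `a|_W`. -/
def conj {U V W : Opens X} (hV : V ≤ U) (hW : W ≤ V) (a : B.Lab U)
    (σ : ((B.enr V).Γ (B.rs hV a) (B.rs hV a)).sec W hW) :
    ((B.enr U).Γ a a).sec W (hW.trans hV) :=
  let i := (B.F.mapComp' (homOfLE hV).op.toLoc (homOfLE hW).op.toLoc
    (homOfLE (hW.trans hV)).op.toLoc rfl)
  i.hom.toNatTrans.app a ≫ σ ≫ i.inv.toNatTrans.app a

/-- `c|_W ≅ L ⊗ a|_W`: there is a morphism `L → Γ_ac` over `W` which induces isomorphisms of sheaves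
`L ⊗ Γ_ba ≅ Γ_bc` for all labels `b` over open subsets of `W`. -/
def IsTensor {U₁ U₂ W : Opens X} (L : A.Mod W) (a : B.Lab U₁) (c : B.Lab U₂)
    (h₁ : W ≤ U₁) (h₂ : W ≤ U₂) : Prop :=
  ∃ m : L.Hom (B.Γ a c W h₁ h₂), ∀ (V : Opens X) (hV : V ≤ W) (b : B.Lab V),
    Mod.IsTensorIso (J := Unit) fun _ =>
      ((B.comp b a c W V V V h₁ h₂ le_rfl (hV.trans h₁) le_rfl (hV.trans h₂)
        hV le_rfl le_rfl).precomp m)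

end LinStack

/-- Cardy fibrations: stacks of `𝒪`-linear categories with linear forms `θ_a` and transition
morphisms `ι_a`, `ι^a`, compatible with restriction of labels, which make the labels over every
open set a Cardy category. -/
structure CardyFibration {A : FunAlg X} {S : A.FMan} (g : S.Metric) extends
    LinStack.{u, w} A where
  cardy : ∀ U : Opens X, (toLinStack.enr U).CardyStr g
  tr_res : ∀ {U V W : Opens X} (hV : V ≤ U) (hW : W ≤ V) (a : toLinStack.Lab U)
    (σ : ((toLinStack.enr V).Γ (toLinStack.rs hV a) (toLinStack.rs hV a)).sec W hW),
    ((cardy V).tr (toLinStack.rs hV a)).app W hW σ =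
      ((cardy U).tr a).app W (hW.trans hV) (toLinStack.conj hV hW a σ)
  iota_res : ∀ {U V W : Opens X} (hV : V ≤ U) (hW : W ≤ V) (a : toLinStack.Lab U)
    (Y : A.VField W),
    toLinStack.conj hV hW a (((cardy V).iota (toLinStack.rs hV a)).app W hW Y) =
      ((cardy U).iota a).app W (hW.trans hV) Y
  iotaUp_res : ∀ {U V W : Opens X} (hV : V ≤ U) (hW : W ≤ V) (a : toLinStack.Lab U)
    (σ : ((toLinStack.enr V).Γ (toLinStack.rs hV a) (toLinStack.rs hV a)).sec W hW),
    ((cardy V).iotaUp (toLinStack.rs hV a)).app W hW σ =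
      ((cardy U).iotaUp a).app W (hW.trans hV) (toLinStack.conj hV hW a σ)

/-- A Cardy fibration is maximal if over every semisimple open set its category of labels is a
maximal Cardy category. -/
def CardyFibration.IsMaximal {A : FunAlg X} {S : A.FMan} {g : S.Metric}
    (B : CardyFibration.{u, w} g) (n : ℕ) : Prop :=
  ∀ U : Opens X, S.IsSemisimpleOn n U → (B.cardy U).IsMaximal

/-! ### Baas--Dundas--Rognes 2-vector bundles -/

/-- Ordered open covers: open covers indexed by a poset such that any two indices whose open sets
meet are comparable (hence the indices of every finite family of members with nonempty intersection
are totally ordered). -/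
structure OrderedCover (X : Type u) [TopologicalSpace X] where
  ι : Type u
  [ord : PartialOrder ι]
  U : ι → Opens X
  covers : ∀ x : X, ∃ α, x ∈ U α
  total : ∀ (α β : ι) (x : X), x ∈ U α → x ∈ U β → α ≤ β ∨ β ≤ α

attribute [instance] OrderedCover.ord

/-- Square matrices of sheaves of modules on the overlaps of an ordered cover, with multiplication
morphisms `E^{αβ} ⊗ E^{βγ} → E^{αγ}`. -/
structure BDRData (𝔘 : OrderedCover X) (n : ℕ) where
  E : ∀ {α β : 𝔘.ι}, α < β → Fin n → Fin n → A.Mod (𝔘.U α ⊓ 𝔘.U β)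
  φ : ∀ {α β γ : 𝔘.ι} (h : α < β) (h' : β < γ) (i j k : Fin n),
    Mod.Pairing (E h i j) (E h' j k) (E (h.trans h') i k) (𝔘.U α ⊓ 𝔘.U β ⊓ 𝔘.U γ)
      inf_le_left (inf_le_inf_right _ inf_le_right) (inf_le_inf_right _ inf_le_left)

namespace BDRData

variable {A} {n : ℕ}

/-- Baas--Dundas--Rognes 2-vector bundles of rank `n`. -/
structure IsTwoVectorBundle {𝔘 : OrderedCover X} (𝓔 : A.BDRData 𝔘 n) : Prop where
  isSheaf : ∀ {α β : 𝔘.ι} (h : α < β) (i j : Fin n), (𝓔.E h i j).IsSheaf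
  /-- The entries are vector bundles of constant rank and the rank matrix has determinant `±1`. -/
  rank : ∀ {α β : 𝔘.ι} (h : α < β), ∃ r : Matrix (Fin n) (Fin n) ℕ,
    (∀ i j, (𝓔.E h i j).HasRank (r i j)) ∧
      ((r.map (Nat.cast : ℕ → ℤ)).det = 1 ∨ (r.map (Nat.cast : ℕ → ℤ)).det = -1)
  iso : ∀ {α β γ : 𝔘.ι} (h : α < β) (h' : β < γ) (i k : Fin n),
    Mod.IsTensorIso fun j => 𝓔.φ h h' i j k
  assoc : ∀ {α β γ δ : 𝔘.ι} (h : α < β) (h' : β < γ) (h'' : γ < δ) (i j k l : Fin n)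
    (V : Opens X) (hα : V ≤ 𝔘.U α) (hβ : V ≤ 𝔘.U β) (hγ : V ≤ 𝔘.U γ) (hδ : V ≤ 𝔘.U δ)
    (x : (𝓔.E h i j).sec V (le_inf hα hβ)) (y : (𝓔.E h' j k).sec V (le_inf hβ hγ))
    (z : (𝓔.E h'' k l).sec V (le_inf hγ hδ)),
    (𝓔.φ (h.trans h') h'' i k l).app V (le_inf (le_inf hα hγ) hδ)
        ((𝓔.φ h h' i j k).app V (le_inf (le_inf hα hβ) hγ) x y) z =
      (𝓔.φ h (h'.trans h'') i j l).app V (le_inf (le_inf hα hβ) hδ) x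
        ((𝓔.φ h' h'' j k l).app V (le_inf (le_inf hβ hγ) hδ) y z)

/-- Equivalence of 2-vector bundles given over two ordered covers: matrices `T^{αβ}` of vector
bundles over the sets `U_α ∩ V_β`, with rank matrices of determinant `±1`, together with
isomorphisms `E^{αα'} T^{α'β} ≅ T^{αβ}` and `T^{αβ} E'^{ββ'} ≅ T^{αβ'}` which are compatible with
the multiplications and with each other. -/
def Equivalent {𝔘 𝔙 : OrderedCover X} (𝓔 : A.BDRData 𝔘 n) (𝓔' : A.BDRData 𝔙 n) : Prop :=
  ∃ (T : ∀ (α : 𝔘.ι) (β : 𝔙.ι), Fin n → Fin n → A.Mod (𝔘.U α ⊓ 𝔙.U β))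
    (l : ∀ {α α' : 𝔘.ι} (h : α < α') (β : 𝔙.ι) (i j k : Fin n),
      Mod.Pairing (𝓔.E h i j) (T α' β j k) (T α β i k) (𝔘.U α ⊓ 𝔘.U α' ⊓ 𝔙.U β)
        inf_le_left (inf_le_inf_right _ inf_le_right) (inf_le_inf_right _ inf_le_left))
    (r : ∀ (α : 𝔘.ι) {β β' : 𝔙.ι} (h : β < β') (i j k : Fin n),
      Mod.Pairing (T α β i j) (𝓔'.E h j k) (T α β' i k) (𝔘.U α ⊓ 𝔙.U β ⊓ 𝔙.U β')
        inf_le_left (inf_le_inf_right _ inf_le_right) (inf_le_inf_right _ inf_le_left)),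
    (∀ α β i j, (T α β i j).IsSheaf) ∧
    (∀ α β, ∀ x ∈ 𝔘.U α ⊓ 𝔙.U β, ∃ (W : Opens X) (hW : W ≤ 𝔘.U α ⊓ 𝔙.U β), x ∈ W ∧
      ∃ ρ : Matrix (Fin n) (Fin n) ℕ, (∀ i j, ((T α β i j).restrict hW).HasRank (ρ i j)) ∧
        ((ρ.map (Nat.cast : ℕ → ℤ)).det = 1 ∨ (ρ.map (Nat.cast : ℕ → ℤ)).det = -1)) ∧
    (∀ {α α'} (h : α < α') β i k, Mod.IsTensorIso fun j => l h β i j k) ∧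
    (∀ α {β β'} (h : β < β') i k, Mod.IsTensorIso fun j => r α h i j k) ∧
    (∀ {α α' α''} (h : α < α') (h' : α' < α'') β (i j k m : Fin n) (V : Opens X)
      (h₁ : V ≤ 𝔘.U α) (h₂ : V ≤ 𝔘.U α') (h₃ : V ≤ 𝔘.U α'') (h₄ : V ≤ 𝔙.U β)
      (x : (𝓔.E h i j).sec V (le_inf h₁ h₂)) (y : (𝓔.E h' j k).sec V (le_inf h₂ h₃))
      (t : (T α'' β k m).sec V (le_inf h₃ h₄)),
      (l (h.trans h') β i k m).app V (le_inf (le_inf h₁ h₃) h₄)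
          ((𝓔.φ h h' i j k).app V (le_inf (le_inf h₁ h₂) h₃) x y) t =
        (l h β i j m).app V (le_inf (le_inf h₁ h₂) h₄) x
          ((l h' β j k m).app V (le_inf (le_inf h₂ h₃) h₄) y t)) ∧
    (∀ {α α'} (h : α < α') {β β'} (h' : β < β') (i j k m : Fin n) (V : Opens X)
      (h₁ : V ≤ 𝔘.U α) (h₂ : V ≤ 𝔘.U α') (h₃ : V ≤ 𝔙.U β) (h₄ : V ≤ 𝔙.U β')
      (x : (𝓔.E h i j).sec V (le_inf h₁ h₂)) (t : (T α' β j k).sec V (le_inf h₂ h₃))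
      (y : (𝓔'.E h' k m).sec V (le_inf h₃ h₄)),
      (r α h' i k m).app V (le_inf (le_inf h₁ h₃) h₄)
          ((l h β i j k).app V (le_inf (le_inf h₁ h₂) h₃) x t) y =
        (l h β' i j m).app V (le_inf (le_inf h₁ h₂) h₄) x
          ((r α' h' j k m).app V (le_inf (le_inf h₂ h₃) h₄) t y)) ∧
    (∀ α {β β' β''} (h : β < β') (h' : β' < β'') (i j k m : Fin n) (V : Opens X)
      (h₁ : V ≤ 𝔘.U α) (h₂ : V ≤ 𝔙.U β) (h₃ : V ≤ 𝔙.U β') (h₄ : V ≤ 𝔙.U β'')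
      (t : (T α β i j).sec V (le_inf h₁ h₂)) (x : (𝓔'.E h j k).sec V (le_inf h₂ h₃))
      (y : (𝓔'.E h' k m).sec V (le_inf h₃ h₄)),
      (r α h' i k m).app V (le_inf (le_inf h₁ h₃) h₄)
          ((r α h i j k).app V (le_inf (le_inf h₁ h₂) h₃) t x) y =
        (r α (h.trans h') i j m).app V (le_inf (le_inf h₁ h₂) h₄) t
          ((𝓔'.φ h h' j k m).app V (le_inf (le_inf h₂ h₃) h₄) x y))

end BDRData

/-! ### Simple labels and their transition matrices -/

/-- An ordered cover by semisimple open sets with frames of orthogonal idempotents which are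
permuted on the overlaps, and with labels `ξ α i` supported on the idempotents `ε α i` such that
`Γ_ξξ ≅ 𝒪`. -/
structure SimpleLabels {A : FunAlg X} {S : A.FMan} {g : S.Metric}
    (B : CardyFibration.{u, w} g) (n : ℕ) where
  cover : OrderedCover X
  ε : ∀ α, Fin n → A.VField (cover.U α)
  frame : ∀ α, S.IsIdempotentFrame (ε α)
  perm : cover.ι → cover.ι → Equiv.Perm (Fin n)
  perm_spec : ∀ α β i,
    VField.res (inf_le_left : cover.U α ⊓ cover.U β ≤ cover.U α) (ε α i) =
      VField.res (inf_le_right : cover.U α ⊓ cover.U β ≤ cover.U β) (ε β (perm α β i))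
  ξ : ∀ α, Fin n → B.Lab (cover.U α)
  supported : ∀ α i, ((B.cardy (cover.U α)).iota (ξ α i)).app (cover.U α) le_rfl (ε α i) =
    (B.enr (cover.U α)).one (ξ α i) (cover.U α) le_rfl
  simple : ∀ α i, ∃ m : (A.str (cover.U α)).Hom ((B.enr (cover.U α)).Γ (ξ α i) (ξ α i)),
    ∀ V h, Function.Bijective (m.app V h)

/-- The transition matrices of a system of simple labels: the `(i, j)` entry over `U_α ∩ U_β` is
the sheaf of morphisms from `ξ_j^β` to `ξ_i^α`, and the multiplication is composition. -/
def SimpleLabels.transition {A : FunAlg X} {S : A.FMan} {g : S.Metric}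
    {B : CardyFibration.{u, w} g} {n : ℕ} (D : SimpleLabels B n) : A.BDRData D.cover n where
  E {α β} _ i j := B.Γ (D.ξ β j) (D.ξ α i) (D.cover.U α ⊓ D.cover.U β) inf_le_right inf_le_left
  φ {α β γ} _ _ i j k := B.comp (D.ξ γ k) (D.ξ β j) (D.ξ α i) _ _ _ _ _ _ _ _ _ _ _ _ _

end FunAlg

/-!
The manifold enters the proof only through its functions, a sheaf of continuous functions which is
locally closed under composition with holomorphic functions (`FunAlg.IsLocal`), and through local
connectedness, paracompactness and the Hausdorff property.

Over a semisimple set, with idempotent fields `ε i`, every label `a` has the orthogonal central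
idempotents `ι_a(ε i)` in `Γ_aa`, of sum `1`. The Cardy condition expresses the Casimir map
`z ↦ ∑ σ_k z σ^k` of `Γ_aa` by `z ↦ ∑ θ_a(z ι_a(ε i)) / θ(ε i) • ι_a(ε i)`. The radical of a fibre
of `Γ_aa` is killed by it, so that the fibres are semisimple (`isSemisimpleRing_of_casimir`), and
an `ι_a(ε i)` which is not zero at a point dominates an idempotent of rank one in the fibre there.
By the implicit function theorem such an idempotent extends to an idempotent `p` with
`p Γ_aa p = 𝒪 p` near the point (`CardyStr.exists_rankOne_idempotent`).

Simple labels exist locally (`IsMaximal.exists_isSimple`) because of maximality and two extensions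
of Cardy categories. Over a connected set, `ι_a(ε i)` is zero or vanishes nowhere
(`ev_coord_ne_zero_of_isPreconnected`). If it vanishes nowhere for some label `a`, the image of the
idempotent `p` can be adjoined (`IdempotentFamily.adjoinEmbedding`); the Cardy condition for images
of idempotents follows from that for the given labels. If `ι_a(ε i) = 0` for all `a`, an object
without morphisms from or to the others, with endomorphisms `𝒪` and linear form `f ↦ √θ(ε i) f`,
can be adjoined (`isolatedEmbedding`). By maximality, the new object is isomorphic to a given one.
The simple labels over small sets form a system of simple labels over a barycentric refinement by
connected sets, since frames of orthogonal idempotents differ by a constant permutation on a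
connected set (`IsIdempotentFrame.exists_perm`).

A morphism between simple labels with orthogonal supports is zero (`IsSimple.eq_zero`). Simple
labels `a`, `b` with the same support are locally isomorphic (`IsSimple.exists_iso`): by the Cardy
condition for the identity of `a`, a sum of endomorphisms of `b` which factor through `a` is
invertible, and as `Γ_bb = 𝒪` one of them is. Therefore composition induces isomorphisms
`⨁ j, Γ(ξ_j, a) ⊗ Γ(b, ξ_j) ≅ Γ(b, a)` whenever the supports of the `ξ_j` contain, locally, that of
the simple label `a` exactly once (`isTensorIso_of_isSimple`). This yields the structure of a
2-vector bundle, the isomorphisms `ξ_i ≅ ℒ ⊗ ξ_{u(i)}`, and the equivalence `T_ij = Γ(ξ'_j, ξ_i)`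
between the bundles of two systems.
-/

/-! ### Local function algebras -/

namespace FunAlg

variable {X : Type u} [TopologicalSpace X] {A : FunAlg X}

/-- The properties of the structure sheaf of a manifold used below: it is a sheaf of continuous
functions which is, locally, closed under composition with holomorphic functions of several
variables. -/
structure IsLocal (A : FunAlg X) : Prop where
  glue : ∀ (U : Opens X) (f : U → ℂ),
    (∀ x : U, ∃ (V : Opens X) (h : V ≤ U), x.1 ∈ V ∧ (fun y : V => f ⟨y.1, h y.2⟩) ∈ A.alg V) →
      f ∈ A.alg U
  cont : ∀ (U : Opens X) (f : U → ℂ), f ∈ A.alg U → Continuous f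
  comp : ∀ (U : Opens X) {ι : Type} [Fintype ι] (f : ι → U → ℂ), (∀ i, f i ∈ A.alg U) →
    ∀ (G : (ι → ℂ) → ℂ) (x : U), ContDiffAt ℂ ω G (fun i => f i x) →
      ∃ (V : Opens X) (h : V ≤ U), x.1 ∈ V ∧
        (fun y : V => G fun i => f i ⟨y.1, h y.2⟩) ∈ A.alg V

/-- Composition with holomorphic functions preserves all the classes of functions considered, since
analytic functions over `ℂ` are `C^k` over `𝕜`. -/
theorem isLocal_manifoldFunctions (𝕜 : Type*) [RCLike 𝕜] [NormedAlgebra 𝕜 ℂ] (n : ℕ)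
    (k : WithTop ℕ∞) (M : Type u) [TopologicalSpace M]
    [ChartedSpace (EuclideanSpace 𝕜 (Fin n)) M]
    [IsManifold 𝓘(𝕜, EuclideanSpace 𝕜 (Fin n)) k M] : (manifoldFunctions 𝕜 n k M).IsLocal where
  glue U f h x := by
    obtain ⟨V, hV, hx, hf⟩ := h x
    have h1 := hf ⟨x.1, hx⟩
    exact ((contDiffWithinAt_localInvariantProp (I := 𝓘(𝕜, EuclideanSpace 𝕜 (Fin n)))
      (I' := 𝓘(𝕜, ℂ)) k).liftPropAt_iff_comp_inclusion hV f ⟨x.1, hx⟩).2 h1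
  cont U f hf := ContMDiff.continuous hf
  comp U ι _ f hf G x hG := by
    have hc : Continuous fun y : U => fun i => f i y :=
      continuous_pi fun i => ContMDiff.continuous (hf i)
    obtain ⟨W, hW, hWo, hxW⟩ := eventually_nhds_iff.1
      ((hc.tendsto x).eventually (hG.eventually (by simp)))
    refine ⟨⟨Subtype.val '' W, U.isOpenEmbedding'.isOpenMap _ hWo⟩, ?_, ⟨x, hxW, rfl⟩, ?_⟩
    · rintro _ ⟨y, -, rfl⟩
      exact y.2
    · set V : Opens M := ⟨Subtype.val '' W, U.isOpenEmbedding'.isOpenMap _ hWo⟩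
      have hVU : V ≤ U := by
        rintro _ ⟨y, -, rfl⟩
        exact y.2
      have h1 : ContMDiff 𝓘(𝕜, EuclideanSpace 𝕜 (Fin n)) 𝓘(𝕜, ι → ℂ) k
          (fun y : V => fun i => f i ⟨y.1, hVU y.2⟩) :=
        contMDiff_pi_space.2 fun i => (manifoldFunctions 𝕜 n k M).res_mem hVU (hf i)
      intro y
      obtain ⟨z, hz, hzy⟩ := y.2
      have hz' : z = ⟨y.1, hVU y.2⟩ := Subtype.ext hzy
      have h2 : ContDiffAt 𝕜 k G (fun i => f i ⟨y.1, hVU y.2⟩) := by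
        rw [← hz']
        exact ((hW z hz).restrict_scalars 𝕜).of_le le_top
      exact h2.contMDiffAt.comp y (h1 y)

/-- Evaluation of functions at a point. -/
def ev {U : Opens X} {x : X} (hx : x ∈ U) : A.Fn U →ₐ[ℂ] ℂ where
  toFun f := f.1 ⟨x, hx⟩
  map_one' := rfl
  map_mul' _ _ := rfl
  map_zero' := rfl
  map_add' _ _ := rfl
  commutes' _ := rfl

theorem ev_res {U V : Opens X} (h : V ≤ U) {x : X} (hx : x ∈ V) (f : A.Fn U) :
    ev hx (A.res h f) = ev (h hx) f := rfl

theorem Fn.ext_ev {U : Opens X} {f g : A.Fn U} (h : ∀ x (hx : x ∈ U), ev hx f = ev hx g) :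
    f = g :=
  Subtype.ext (funext fun x => h x.1 x.2)

theorem res_res {U V W : Opens X} (h : V ≤ U) (h' : W ≤ V) (f : A.Fn U) :
    A.res h' (A.res h f) = A.res (h'.trans h) f := rfl

theorem res_self {U : Opens X} (h : U ≤ U) (f : A.Fn U) : A.res h f = f := rfl

namespace IsLocal

/-- Finitely many local properties hold on a common neighbourhood. -/
theorem exists_forall_le {κ : Type*} [Finite κ] {U : Opens X} {x : X} (hx : x ∈ U)
    (P : κ → Opens X → Prop) (hP : ∀ j V V', V' ≤ V → P j V → P j V')
    (h : ∀ j, ∃ V ≤ U, x ∈ V ∧ P j V) : ∃ V ≤ U, x ∈ V ∧ ∀ j, P j V := by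
  cases nonempty_fintype κ
  choose V hVU hxV hV using h
  refine ⟨U ⊓ Finset.univ.inf V, inf_le_left, ⟨hx, ?_⟩, fun j => hP j _ _
    (inf_le_right.trans (Finset.inf_le (Finset.mem_univ j))) (hV j)⟩
  have : ((Finset.univ.inf V : Opens X) : Set X) = _ := Opens.coe_finset_inf _ _
  change x ∈ ((Finset.univ.inf V : Opens X) : Set X)
  rw [this]
  simpa using hxV

/-- An open condition on the values at `x` of a family of functions holds near `x`. -/
theorem exists_of_eventually (hA : A.IsLocal) {U : Opens X} {x : X} (hx : x ∈ U) {ι : Type*}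
    (f : ι → A.Fn U) {P : (ι → ℂ) → Prop}
    (hP : ∀ᶠ z in nhds (fun i => ev hx (f i)), P z) :
    ∃ (V : Opens X) (h : V ≤ U), x ∈ V ∧ ∀ y (hy : y ∈ V), P fun i => ev (h hy) (f i) := by
  have hc : Continuous fun y : U => fun i => (f i).1 y :=
    continuous_pi fun i => hA.cont U _ (f i).2
  obtain ⟨W, hW, hWo, hxW⟩ := eventually_nhds_iff.1 ((hc.tendsto ⟨x, hx⟩).eventually hP)
  have hV : ∀ y ∈ Subtype.val '' W, y ∈ U := by
    rintro _ ⟨y, -, rfl⟩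
    exact y.2
  refine ⟨⟨Subtype.val '' W, U.isOpenEmbedding'.isOpenMap _ hWo⟩, hV, ⟨⟨x, hx⟩, hxW, rfl⟩, ?_⟩
  rintro _ ⟨y, hy, rfl⟩
  exact hW y hy

theorem exists_comp (hA : A.IsLocal) {U : Opens X} {x : X} (hx : x ∈ U) {ι κ : Type} [Fintype ι]
    [Fintype κ] (f : ι → A.Fn U) (G : (ι → ℂ) → κ → ℂ)
    (hG : ContDiffAt ℂ ω G fun i => ev hx (f i)) :
    ∃ (V : Opens X) (h : V ≤ U), x ∈ V ∧ ∃ g : κ → A.Fn V, ∀ y (hy : y ∈ V) j,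
      ev hy (g j) = G (fun i => ev (h hy) (f i)) j := by
  obtain ⟨V, hV, hxV, H⟩ := exists_forall_le hx
    (fun (j : κ) V => ∃ (h : V ≤ U) (g : A.Fn V), ∀ y (hy : y ∈ V),
      ev hy g = G (fun i => ev (h hy) (f i)) j)
    (fun j V V' h ⟨hV, g, hg⟩ => ⟨h.trans hV, A.res h g, fun y hy => hg y (h hy)⟩)
    (fun j => by
      obtain ⟨V, h, hxV, hV⟩ := hA.comp U (fun i => (f i).1) (fun i => (f i).2)
        (fun z => G z j) ⟨x, hx⟩ (contDiffAt_pi.1 hG j)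
      exact ⟨V, h, hxV, h, ⟨_, hV⟩, fun y hy => rfl⟩)
  choose h g hg using H
  exact ⟨V, hV, hxV, g, fun y hy j => hg j y hy⟩

theorem isUnit_of_ev_ne_zero (hA : A.IsLocal) {U : Opens X} {f : A.Fn U}
    (hf : ∀ x (hx : x ∈ U), ev hx f ≠ 0) : IsUnit f := by
  have hg : (fun x : U => (f.1 x)⁻¹) ∈ A.alg U := by
    refine hA.glue U _ fun x => ?_
    have hG : ContDiffAt ℂ ω (fun (z : Unit → ℂ) (_ : Unit) => (z ())⁻¹)
        fun _ => ev x.2 f := by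
      refine contDiffAt_pi.2 fun _ => ContDiffAt.inv ?_ (hf x.1 x.2)
      exact (contDiff_apply ℂ ℂ ()).contDiffAt
    obtain ⟨V, h, hxV, g, hg⟩ := exists_comp hA x.2 (fun _ : Unit => f) _ hG
    refine ⟨V, h, hxV, ?_⟩
    convert (g ()).2 using 1
    exact funext fun y => (hg y.1 y.2 ()).symm
  refine IsUnit.of_mul_eq_one (⟨_, hg⟩ : A.Fn U) (Fn.ext_ev fun x hx => ?_)
  refine (map_mul (ev hx) f _).trans ?_
  rw [map_one]
  exact mul_inv_cancel₀ (hf x hx)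

theorem exists_isUnit_res (hA : A.IsLocal) {U : Opens X} {x : X} (hx : x ∈ U) {f : A.Fn U}
    (hf : ev hx f ≠ 0) : ∃ (V : Opens X) (h : V ≤ U), x ∈ V ∧ IsUnit (A.res h f) := by
  obtain ⟨V, h, hxV, hV⟩ := exists_of_eventually hA hx (fun _ : Unit => f)
    (P := fun z => z () ≠ 0) ((continuous_apply ()).continuousAt.eventually_ne hf)
  exact ⟨V, h, hxV, isUnit_of_ev_ne_zero hA fun y hy => hV y hy⟩

/-- A function `f` which does not vanish at `x` has a square root near `x`, namely
`c * exp (log (f / f x) / 2)` with `c ^ 2 = f x`. -/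
theorem exists_sqrt (hA : A.IsLocal) {U : Opens X} {x : X} (hx : x ∈ U) {f : A.Fn U}
    (hf : ev hx f ≠ 0) :
    ∃ (V : Opens X) (h : V ≤ U), x ∈ V ∧ ∃ g : A.Fn V, g * g = A.res h f := by
  obtain ⟨c, hc⟩ := IsAlgClosed.exists_pow_nat_eq (ev hx f) two_pos
  have hG : ContDiffAt ℂ ω (fun (z : Unit → ℂ) (_ : Unit) =>
      c * Complex.exp (Complex.log (z () / ev hx f) / 2)) fun _ => ev hx f := by
    refine contDiffAt_pi.2 fun _ => contDiffAt_const.mul (ContDiffAt.cexp ?_)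
    refine ContDiffAt.div_const ?_ 2
    have h1 : ContDiffAt ℂ ω Complex.log (ev hx f / ev hx f) := by
      rw [div_self hf]
      exact Complex.contDiffAt_log Complex.one_mem_slitPlane
    exact h1.comp (fun _ : Unit => ev hx f)
      (((contDiff_apply ℂ ℂ ()).contDiffAt).div_const (ev hx f))
  obtain ⟨V, h, hxV, g, hg⟩ := exists_comp hA hx (fun _ : Unit => f)
    (fun (z : Unit → ℂ) (_ : Unit) => c * Complex.exp (Complex.log (z () / ev hx f) / 2)) hG
  obtain ⟨V', h', hxV', hu⟩ := exists_isUnit_res hA hxV (f := A.res h f) hf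
  refine ⟨V', h'.trans h, hxV', A.res h' (g ()), Fn.ext_ev fun y hy => ?_⟩
  have hy0 : ev (h (h' hy)) f ≠ 0 := (hu.map (ev hy)).ne_zero
  rw [map_mul, ev_res, hg y (h' hy) (), mul_mul_mul_comm, ← Complex.exp_add, add_halves,
    Complex.exp_log (div_ne_zero hy0 hf), ← sq, hc, mul_div_cancel₀ _ hf, ev_res]

theorem exists_isUnit_det (hA : A.IsLocal) {U : Opens X} {x : X} (hx : x ∈ U) {r : ℕ}
    (P : Matrix (Fin r) (Fin r) (A.Fn U)) (hP : (P.map (ev hx)).det ≠ 0) :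
    ∃ (V : Opens X) (h : V ≤ U), x ∈ V ∧ IsUnit (P.map (A.res h)).det := by
  have : (P.map (ev hx)).det = ev hx P.det := ((ev hx : A.Fn U →ₐ[ℂ] ℂ).map_det P).symm
  rw [this] at hP
  obtain ⟨V, h, hxV, hu⟩ := exists_isUnit_res hA hx hP
  refine ⟨V, h, hxV, ?_⟩
  rwa [AlgHom.map_det] at hu

/-- Complex idempotent matrices split. -/
theorem _root_.Matrix.exists_split_of_isIdempotentElem {r : ℕ} (P : Matrix (Fin r) (Fin r) ℂ)
    (hP : P * P = P) : ∃ (d : ℕ) (B : Matrix (Fin r) (Fin d) ℂ) (L : Matrix (Fin d) (Fin r) ℂ),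
      P = B * L ∧ L * B = 1 := by
  let b := Module.finBasis ℂ (LinearMap.range P.mulVecLin)
  let B := LinearMap.toMatrix b (Pi.basisFun ℂ (Fin r)) (LinearMap.range P.mulVecLin).subtype
  let L := LinearMap.toMatrix (Pi.basisFun ℂ (Fin r)) b P.mulVecLin.rangeRestrict
  have h1 : P.mulVecLin = (LinearMap.range P.mulVecLin).subtype ∘ₗ P.mulVecLin.rangeRestrict := rfl
  have h2 : P.mulVecLin.rangeRestrict ∘ₗ (LinearMap.range P.mulVecLin).subtype =
      LinearMap.id := by
    refine LinearMap.ext fun ⟨_, z, rfl⟩ => Subtype.ext ?_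
    change P.mulVec (P.mulVec z) = P.mulVec z
    rw [Matrix.mulVec_mulVec, hP]
  refine ⟨_, B, L, ?_, ?_⟩
  · rw [← LinearMap.toMatrix_comp, ← h1]
    exact (LinearMap.toMatrix'_toLin' P).symm
  · rw [← LinearMap.toMatrix_comp, h2, LinearMap.toMatrix_id]

/-- Idempotent matrices of functions split locally.  With `P₀ = P(x)`, the matrix
`Q = P P₀ + (1 - P)(1 - P₀)` is invertible near `x` and satisfies `P Q = Q P₀`, so that `P` is
locally conjugate to the constant matrix `P₀`. -/
theorem exists_split_of_isIdempotentElem (hA : A.IsLocal) {U : Opens X} {x : X} (hx : x ∈ U)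
    {r : ℕ} (P : Matrix (Fin r) (Fin r) (A.Fn U)) (hP : P * P = P) :
    ∃ (V : Opens X) (h : V ≤ U), x ∈ V ∧ ∃ (d : ℕ) (B : Matrix (Fin r) (Fin d) (A.Fn V))
      (L : Matrix (Fin d) (Fin r) (A.Fn V)), P.map (A.res h) = B * L ∧ L * B = 1 := by
  have hP0 : P.map (ev hx) * P.map (ev hx) = P.map (ev hx) := by
    rw [← Matrix.map_mul, hP]
  obtain ⟨d, B, L, hBL, hLB⟩ := Matrix.exists_split_of_isIdempotentElem _ hP0
  let P' : Matrix (Fin r) (Fin r) (A.Fn U) := (P.map (ev hx)).map (algebraMap ℂ (A.Fn U))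
  have hP' : P' * P' = P' := by
    rw [← Matrix.map_mul, hP0]
  let Q := P * P' + (1 - P) * (1 - P')
  have hPQ : P * Q = Q * P' := by
    have h1 : P * (1 - P) = 0 := by rw [mul_sub, hP, mul_one, sub_self]
    have h2 : (1 - P') * P' = 0 := by rw [sub_mul, hP', one_mul, sub_self]
    simp only [Q, mul_add, add_mul, ← mul_assoc, hP, h1, zero_mul, add_zero]
    rw [mul_assoc, hP', mul_assoc (1 - P), h2, mul_zero, add_zero]
  have hQ : (Q.map (ev hx)).det ≠ 0 := by
    have h0 : P'.map (ev hx) = P.map (ev hx) := by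
      ext i j
      simp [P']
    have h1 : (ev hx).mapMatrix Q = 1 := by
      simp only [Q, map_add, map_mul, map_sub, map_one, AlgHom.mapMatrix_apply, h0, hP0]
      rw [mul_sub, sub_mul, sub_mul, hP0, one_mul, mul_one, one_mul]
      abel
    rw [← AlgHom.mapMatrix_apply, h1, Matrix.det_one]
    exact one_ne_zero
  obtain ⟨V, h, hxV, hu⟩ := exists_isUnit_det hA hx Q hQ
  let Q' : Matrix (Fin r) (Fin r) (A.Fn V) := Q.map (A.res h)
  let B' : Matrix (Fin r) (Fin d) (A.Fn V) := B.map (algebraMap ℂ _)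
  let L' : Matrix (Fin d) (Fin r) (A.Fn V) := L.map (algebraMap ℂ _)
  have hu' : IsUnit Q'.det := hu
  refine ⟨V, h, hxV, d, Q' * B', L' * Q'⁻¹, ?_, ?_⟩
  · have h3 : P.map (A.res h) * Q' = Q' * (B' * L') := by
      have h4 : P'.map (A.res h) = B' * L' := by
        simp only [B', L', ← Matrix.map_mul, ← hBL]
        ext1 i j
        exact AlgHom.commutes (A.res h) _
      rw [← h4]
      simp only [Q', ← Matrix.map_mul, hPQ]
    rw [← Matrix.mul_assoc, Matrix.mul_assoc Q', ← h3, Matrix.mul_assoc,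
      Matrix.mul_nonsing_inv _ hu', Matrix.mul_one]
  · rw [Matrix.mul_assoc, ← Matrix.mul_assoc _ Q', Matrix.nonsing_inv_mul _ hu', Matrix.one_mul]
    simp only [B', L', ← Matrix.map_mul, hLB]
    exact Matrix.map_one _ (map_zero _) (map_one _)

/-- A holomorphic choice of eigenvectors `G K`, with eigenvalue `l (G K)`, of the matrices `K` near
the rank one projection `v₀ lᵀ`, obtained from the implicit function theorem for
`(K, v) ↦ K v - l(v) v`. -/
theorem _root_.Matrix.exists_eigenvector_contDiffAt {r : ℕ} (v₀ l : Fin r → ℂ)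
    (hl : l ⬝ᵥ v₀ = 1) :
    ∃ G : (Fin r × Fin r → ℂ) → Fin r → ℂ,
      ContDiffAt ℂ ω G (fun p => v₀ p.1 * l p.2) ∧ G (fun p => v₀ p.1 * l p.2) = v₀ ∧
      ∀ᶠ K in nhds (fun p : Fin r × Fin r => v₀ p.1 * l p.2),
        ∀ j, ∑ k, K (j, k) * G K k = (l ⬝ᵥ G K) * G K j := by
  let f : (Fin r × Fin r → ℂ) × (Fin r → ℂ) → Fin r → ℂ := fun u j =>
    ∑ k, u.1 (j, k) * u.2 k - (∑ k, l k * u.2 k) * u.2 j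
  let u : (Fin r × Fin r → ℂ) × (Fin r → ℂ) := (fun p => v₀ p.1 * l p.2, v₀)
  have hf : ContDiff ℂ ω f := by
    refine contDiff_pi.2 fun j => ?_
    fun_prop
  let l' : (Fin r → ℂ) →L[ℂ] ℂ := ∑ k, l k • ContinuousLinearMap.proj k
  have hl' : ∀ v, l' v = ∑ k, l k * v k := fun v => by simp [l']
  -- at the rank one projection the equation reads `l(v) (v₀ - v) = 0`, with derivative `-1` in `v`
  have h1 : HasFDerivAt (fun v => f (u.1, v)) (-ContinuousLinearMap.id ℂ (Fin r → ℂ)) v₀ := by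
    have h2 : (fun v => f (u.1, v)) = fun v => l' v • (v₀ - v) := by
      funext v j
      simp only [f, u, Pi.smul_apply, Pi.sub_apply, smul_eq_mul, hl', mul_sub, Finset.sum_mul]
      congr 1
      exact Finset.sum_congr rfl fun k _ => by ring
    rw [h2]
    have h3 : HasFDerivAt (fun v => l' v • (v₀ - v))
        (l' v₀ • -ContinuousLinearMap.id ℂ (Fin r → ℂ) + l'.smulRight (v₀ - v₀)) v₀ :=
      (l'.hasFDerivAt (x := v₀)).smul ((hasFDerivAt_id (𝕜 := ℂ) v₀).const_sub v₀)
    have h4 : l' v₀ = 1 := by rw [hl']; exact hl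
    rw [h4, sub_self, one_smul, ContinuousLinearMap.smulRight_zero, add_zero] at h3
    exact h3
  have h5 : fderiv ℂ f u ∘L .inr ℂ (Fin r × Fin r → ℂ) (Fin r → ℂ) =
      -ContinuousLinearMap.id ℂ (Fin r → ℂ) := by
    have h6 := ((hf.differentiable (by simp)) u).hasFDerivAt.comp v₀
      (hasFDerivAt_prodMk_right u.1 v₀)
    exact h6.unique h1
  have h7 : (fderiv ℂ f u ∘L .inr ℂ (Fin r × Fin r → ℂ) (Fin r → ℂ)).IsInvertible := by
    rw [h5]
    exact ⟨ContinuousLinearEquiv.neg ℂ, by ext; simp⟩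
  have hf' : ContDiffAt ℂ ω f u := hf.contDiffAt
  have h8 : f u = 0 := by
    funext j
    have : ∑ k, v₀ j * l k * v₀ k = v₀ j * ∑ k, l k * v₀ k := by
      rw [Finset.mul_sum]
      exact Finset.sum_congr rfl fun k _ => by ring
    simp only [f, u, this, Pi.zero_apply]
    ring
  refine ⟨hf'.implicitFunction (by simp) h7, hf'.contDiffAt_implicitFunction _ h7,
    hf'.implicitFunction_apply_self _ h7, ?_⟩
  filter_upwards [hf'.eventually_apply_implicitFunction (by simp) h7] with K hK j
  have := congrFun hK j
  rw [h8] at this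
  exact sub_eq_zero.1 this

/-- A matrix of functions whose value at `x` is a rank one projection has, near `x`, a simple
eigenvalue `l ⬝ v` whose eigenspace is spanned by `v`.  The eigenvectors are multiples of `v`
because `N = K - (l ⬝ v) + v lᵀ` is invertible near `x`: there its value is a reflection. -/
theorem exists_eigenvector (hA : A.IsLocal) {U : Opens X} {x : X} (hx : x ∈ U) {r : ℕ}
    (K : Matrix (Fin r) (Fin r) (A.Fn U)) (v₀ l : Fin r → ℂ) (hl : l ⬝ᵥ v₀ = 1)
    (hK : ∀ i j, ev hx (K i j) = v₀ i * l j) :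
    ∃ (V : Opens X) (h : V ≤ U) (hxV : x ∈ V) (v : Fin r → A.Fn V) (c : A.Fn V), IsUnit c ∧
      (∀ i, ev hxV (v i) = v₀ i) ∧ (K.map (A.res h)).mulVec v = c • v ∧
      ∀ (V' : Opens X) (h' : V' ≤ V) (w : Fin r → A.Fn V'),
        (K.map (A.res (h'.trans h))).mulVec w = A.res h' c • w →
        ∃ b : A.Fn V', w = b • fun i => A.res h' (v i) := by
  obtain ⟨G, hG, hG0, hGe⟩ := Matrix.exists_eigenvector_contDiffAt v₀ l hl
  have hK' : (fun p : Fin r × Fin r => ev hx (K p.1 p.2)) = fun p => v₀ p.1 * l p.2 :=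
    funext fun p => hK _ _
  obtain ⟨V₁, h₁, hx₁, v₁, hv₁⟩ := exists_comp hA hx (fun p : Fin r × Fin r => K p.1 p.2) G
    (by rw [hK']; exact hG)
  obtain ⟨V₂, h₂, hx₂, hv₂⟩ := exists_of_eventually hA hx₁
    (fun p : Fin r × Fin r => A.res h₁ (K p.1 p.2))
    (P := fun K => ∀ j, ∑ k, K (j, k) * G K k = (l ⬝ᵥ G K) * G K j)
    (by
      have : (fun p : Fin r × Fin r => ev hx₁ (A.res h₁ (K p.1 p.2))) =
        fun p => v₀ p.1 * l p.2 := hK'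
      rw [this]; exact hGe)
  let v₂ : Fin r → A.Fn V₂ := fun i => A.res h₂ (v₁ i)
  let l₂ : Fin r → A.Fn V₂ := fun i => algebraMap ℂ _ (l i)
  let c₂ : A.Fn V₂ := ∑ i, l₂ i * v₂ i
  have hv₂' : ∀ i, ev hx₂ (v₂ i) = v₀ i := fun i => by
    have := hv₁ x hx₁ i
    rw [hK', hG0] at this
    exact this
  have hc₂ : ev hx₂ c₂ = 1 := by
    simp only [c₂, map_sum, map_mul, hv₂', l₂, AlgHom.commutes]
    exact hl
  let K₂ : Matrix (Fin r) (Fin r) (A.Fn V₂) := K.map (A.res (h₂.trans h₁))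
  have hKv : K₂.mulVec v₂ = c₂ • v₂ := by
    funext j
    refine Fn.ext_ev fun y hy => ?_
    have := hv₂ y hy j
    simp only [Matrix.mulVec, dotProduct, Pi.smul_apply, smul_eq_mul, map_mul, map_sum, c₂, l₂,
      AlgHom.commutes]
    have hy' : ∀ i, ev hy (v₂ i) = G (fun p => ev (h₁ (h₂ hy)) (K p.1 p.2)) i :=
      fun i => hv₁ y (h₂ hy) i
    simp only [hy']
    exact this
  let N : Matrix (Fin r) (Fin r) (A.Fn V₂) :=
    K₂ - c₂ • (1 : Matrix (Fin r) (Fin r) (A.Fn V₂)) + Matrix.vecMulVec v₂ l₂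
  have hN : (N.map (ev hx₂)).det ≠ 0 := by
    have h0 : (K₂.map (ev hx₂) : Matrix _ _ ℂ) = Matrix.vecMulVec v₀ l := by
      ext i j
      exact hK i j
    have h00 : ((Matrix.vecMulVec v₂ l₂).map (ev hx₂) : Matrix _ _ ℂ) = Matrix.vecMulVec v₀ l := by
      ext i j
      simp [Matrix.vecMulVec_apply, hv₂', l₂]
    have h1 : N.map (ev hx₂) = 2 • Matrix.vecMulVec v₀ l - 1 := by
      have : (ev hx₂).mapMatrix N = (ev hx₂).mapMatrix K₂ -
          (ev hx₂).mapMatrix (c₂ • (1 : Matrix (Fin r) (Fin r) (A.Fn V₂))) +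
          (ev hx₂).mapMatrix (Matrix.vecMulVec v₂ l₂) := by
        simp only [N, map_add, map_sub]
      simp only [AlgHom.mapMatrix_apply] at this
      rw [this, h0, h00]
      have : ((c₂ • (1 : Matrix (Fin r) (Fin r) (A.Fn V₂))).map (ev hx₂) : Matrix _ _ ℂ) = 1 := by
        ext i j
        simp [hc₂, Matrix.one_apply, apply_ite]
      rw [this]
      module
    have h2 : Matrix.vecMulVec v₀ l * Matrix.vecMulVec v₀ l = Matrix.vecMulVec v₀ l := by
      rw [Matrix.vecMulVec_mul_vecMulVec, hl, one_smul]
    have h3 : N.map (ev hx₂) * N.map (ev hx₂) = 1 := by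
      rw [h1]
      simp only [mul_sub, sub_mul, smul_mul_assoc, mul_smul_comm, h2, mul_one, one_mul]
      module
    exact fun h => by simpa [h] using congrArg Matrix.det h3
  obtain ⟨V₃, h₃, hx₃, hu₃⟩ := exists_isUnit_det hA hx₂ N hN
  obtain ⟨V, h₄, hx₄, hu₄⟩ := exists_isUnit_res hA (f := A.res h₃ c₂) hx₃
    (by rw [ev_res, hc₂]; exact one_ne_zero)
  refine ⟨V, ((h₄.trans h₃).trans h₂).trans h₁, hx₄, fun i => A.res (h₄.trans h₃) (v₂ i),
    A.res (h₄.trans h₃) c₂, hu₄, hv₂', ?_, ?_⟩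
  · funext j
    have := congrArg (A.res (h₄.trans h₃)) (congrFun hKv j)
    simp only [Matrix.mulVec, dotProduct, map_sum, map_mul, Pi.smul_apply, smul_eq_mul] at this ⊢
    exact this
  · intro V' h' w hw
    have hV' : V' ≤ V₂ := h'.trans (h₄.trans h₃)
    let N' := N.map (A.res hV')
    let v' : Fin r → A.Fn V' := fun i => A.res hV' (v₂ i)
    let l' : Fin r → A.Fn V' := fun i => algebraMap ℂ _ (l i)
    have hu' : IsUnit N'.det := by
      have := hu₃.map (A.res (h'.trans h₄))
      rw [AlgHom.map_det] at this
      exact this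
    have hN' : ∀ z, N'.mulVec z =
        (K.map (A.res (hV'.trans (h₂.trans h₁)))).mulVec z - A.res hV' c₂ • z +
          (l' ⬝ᵥ z) • v' := by
      intro z
      have : N' = K.map (A.res (hV'.trans (h₂.trans h₁))) -
          A.res hV' c₂ • (1 : Matrix (Fin r) (Fin r) (A.Fn V')) + Matrix.vecMulVec v' l' := by
        ext1 i j
        have h00 : A.res hV' (l₂ j) = l' j := AlgHom.commutes _ _
        have h01 : A.res hV' ((1 : Matrix (Fin r) (Fin r) (A.Fn V₂)) i j) =
            (1 : Matrix (Fin r) (Fin r) (A.Fn V')) i j := by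
          rw [Matrix.one_apply, Matrix.one_apply]
          split_ifs
          · exact map_one _
          · exact map_zero _
        simp only [N', N, Matrix.map_apply, Matrix.add_apply, Matrix.sub_apply, Matrix.smul_apply,
          smul_eq_mul, Matrix.vecMulVec_apply, map_add, map_sub, map_mul, h00, h01]
        rfl
      rw [this, Matrix.add_mulVec, Matrix.sub_mulVec, Matrix.smul_mulVec, Matrix.one_mulVec,
        Matrix.vecMulVec_mulVec]
      simp
    have hv' : N'.mulVec v' = A.res hV' c₂ • v' := by
      rw [hN']
      have h0 : (K.map (A.res (hV'.trans (h₂.trans h₁)))).mulVec v' = A.res hV' c₂ • v' := by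
        funext j
        have := congrArg (A.res hV') (congrFun hKv j)
        simp only [Matrix.mulVec, dotProduct, map_sum, map_mul, Pi.smul_apply,
          smul_eq_mul] at this ⊢
        exact this
      have h1 : l' ⬝ᵥ v' = A.res hV' c₂ := by
        simp [c₂, dotProduct, l', v', l₂]
      rw [h0, h1, sub_self, zero_add]
    have hw' : N'.mulVec w = (l' ⬝ᵥ w) • v' := by
      rw [hN']
      have : (K.map (A.res (hV'.trans (h₂.trans h₁)))).mulVec w = A.res hV' c₂ • w := hw
      rw [this, sub_self, zero_add]
    have hinj : A.res hV' c₂ • w = (l' ⬝ᵥ w) • v' := by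
      apply Matrix.mulVec_injective_of_isUnit ((Matrix.isUnit_iff_isUnit_det _).2 hu')
      change N'.mulVec _ = N'.mulVec _
      rw [Matrix.mulVec_smul, Matrix.mulVec_smul, hw', hv', smul_comm]
    obtain ⟨d, hd⟩ := (hu₄.map (A.res h')).exists_left_inv
    refine ⟨d * (l' ⬝ᵥ w), ?_⟩
    have h9 : d * A.res hV' c₂ = 1 := hd
    calc w = d • (A.res hV' c₂ • w) := by rw [smul_smul, h9, one_smul]
      _ = (d * (l' ⬝ᵥ w)) • v' := by rw [hinj, smul_smul]

end IsLocal
end FunAlg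

/-! ### Frames -/

namespace FunAlg

variable {X : Type u} [TopologicalSpace X] {A : FunAlg X}

namespace Mod

variable {W : Opens X} {E : A.Mod W}

namespace IsFrame

variable {V : Opens X} {hV : V ≤ W} {r : ℕ} {s : Fin r → E.sec V hV}

theorem restrict (hs : E.IsFrame hV s) {V' : Opens X} (h : V' ≤ V) :
    E.IsFrame (h.trans hV) fun i => E.res hV h (s i) := by
  intro V'' h'
  simp only [E.res_res]
  exact hs V'' (h'.trans h)

/-- The coordinates with respect to a frame. -/
noncomputable def coord (hs : E.IsFrame hV s) {V' : Opens X} (h : V' ≤ V) :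
    E.sec V' (h.trans hV) ≃ₗ[A.Fn V'] (Fin r → A.Fn V') :=
  (LinearEquiv.ofBijective
    (Fintype.linearCombination (A.Fn V') fun i => E.res hV h (s i)) (hs V' h)).symm

theorem sum_coord (hs : E.IsFrame hV s) {V' : Opens X} (h : V' ≤ V)
    (σ : E.sec V' (h.trans hV)) : ∑ i, hs.coord h σ i • E.res hV h (s i) = σ :=
  (hs.coord h).symm_apply_apply σ

theorem coord_sum (hs : E.IsFrame hV s) {V' : Opens X} (h : V' ≤ V) (c : Fin r → A.Fn V') :
    hs.coord h (∑ i, c i • E.res hV h (s i)) = c :=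
  (hs.coord h).apply_symm_apply c

theorem coord_self (hs : E.IsFrame hV s) {V' : Opens X} (h : V' ≤ V) (j : Fin r) :
    hs.coord h (E.res hV h (s j)) = Pi.single j 1 := by
  rw [← hs.coord_sum h (Pi.single j 1)]
  congr 1
  rw [Finset.sum_eq_single j (fun i _ hi => by rw [Pi.single_eq_of_ne hi, zero_smul])
    (fun h => absurd (Finset.mem_univ j) h), Pi.single_eq_same, one_smul]

theorem coord_res (hs : E.IsFrame hV s) {V' V'' : Opens X} (h : V' ≤ V) (h' : V'' ≤ V')
    (σ : E.sec V' (h.trans hV)) (i : Fin r) :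
    hs.coord (h'.trans h) (E.res (h.trans hV) h' σ) i = A.res h' (hs.coord h σ i) := by
  conv_lhs => rw [← hs.sum_coord h σ]
  rw [map_sum]
  simp only [E.res_smul, E.res_res]
  exact congrFun (hs.coord_sum (h'.trans h) fun i => A.res h' (hs.coord h σ i)) i

theorem ext_coord (hs : E.IsFrame hV s) {V' : Opens X} (h : V' ≤ V)
    {σ τ : E.sec V' (h.trans hV)} (H : ∀ i, hs.coord h σ i = hs.coord h τ i) : σ = τ :=
  (hs.coord h).injective (funext H)

end IsFrame

/-- A direct summand of a locally free sheaf is locally free: the matrix of the projection onto it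
splits locally. -/
theorem IsLocallyFree.of_retract (hA : A.IsLocal) {F : A.Mod W} (inc : F.Hom E) (ret : E.Hom F)
    (hri : ∀ V h (z : F.sec V h), ret.app V h (inc.app V h z) = z) (hE : E.IsLocallyFree) :
    F.IsLocallyFree := by
  intro x hx
  obtain ⟨V, hV, hxV, r, s, hs⟩ := hE x hx
  -- the matrix of the projection `inc ∘ ret`
  let P : Matrix (Fin r) (Fin r) (A.Fn V) := fun i j =>
    hs.coord le_rfl (inc.app V hV (ret.app V hV (s j))) i
  have hP' : ∀ (V' : Opens X) (h : V' ≤ V) (c : Fin r → A.Fn V'),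
      inc.app V' (h.trans hV) (ret.app V' (h.trans hV) (∑ j, c j • E.res hV h (s j))) =
        ∑ j, (P.map (A.res h)).mulVec c j • E.res hV h (s j) := by
    intro V' h c
    refine hs.ext_coord h fun i => ?_
    rw [hs.coord_sum]
    simp only [map_sum, map_smul, ← inc.nat, ← ret.nat, Finset.sum_apply, Pi.smul_apply,
      smul_eq_mul, Matrix.mulVec, dotProduct, P]
    refine Finset.sum_congr rfl fun j _ => ?_
    rw [mul_comm, hs.coord_res le_rfl h]
    rfl
  have hP : P * P = P := by
    ext1 i j
    have h1 := hP' V le_rfl (fun k => P k j)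
    have h2 : ∑ k, P k j • E.res hV le_rfl (s k) = inc.app V hV (ret.app V hV (s j)) :=
      hs.sum_coord le_rfl _
    rw [h2, hri, ← h2] at h1
    have h3 := congrFun ((hs.coord_sum le_rfl _).symm.trans
      ((congrArg (hs.coord le_rfl) h1).trans (hs.coord_sum le_rfl _))) i
    rw [Matrix.mul_apply, h3]
    rfl
  obtain ⟨V₁, h₁, hx₁, d, B, L, hBL, hLB⟩ := hA.exists_split_of_isIdempotentElem hxV P hP
  refine ⟨V₁, h₁.trans hV, hx₁, d, fun k => ret.app V₁ _ (∑ j, B j k • E.res hV h₁ (s j)), ?_⟩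
  intro V' h
  let B' : Matrix (Fin r) (Fin d) (A.Fn V') := B.map (A.res h)
  let L' : Matrix (Fin d) (Fin r) (A.Fn V') := L.map (A.res h)
  have hBL' : P.map (A.res (h.trans h₁)) = B' * L' := by
    rw [← Matrix.map_mul, ← hBL]
    rfl
  have hLB' : L' * B' = 1 := by
    rw [← Matrix.map_mul, hLB]
    exact Matrix.map_one _ (map_zero _) (map_one _)
  have key : ∀ f : Fin d → A.Fn V',
      ∑ k, f k • F.res (h₁.trans hV) h (ret.app V₁ _ (∑ j, B j k • E.res hV h₁ (s j))) =
        ret.app V' _ (∑ j, B'.mulVec f j • E.res hV (h.trans h₁) (s j)) := by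
    intro f
    simp only [ret.nat, ← map_smul, ← map_sum]
    congr 1
    simp only [map_sum, E.res_smul, E.res_res, Finset.smul_sum, smul_smul, Matrix.mulVec,
      dotProduct, Finset.sum_smul, B', Matrix.map_apply]
    rw [Finset.sum_comm]
    simp only [mul_comm]
  simp only [key]
  constructor
  · intro f f' hff
    have h2 := congrArg (inc.app V' _) hff
    simp only [hP' V' (h.trans h₁), hBL', Matrix.mulVec_mulVec, Matrix.mul_assoc, hLB',
      Matrix.mul_one] at h2
    have h3 := (hs.coord_sum (h.trans h₁) _).symm.trans
      ((congrArg (hs.coord (h.trans h₁)) h2).trans (hs.coord_sum (h.trans h₁) _))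
    have h4 := congrArg L'.mulVec h3
    rwa [Matrix.mulVec_mulVec, Matrix.mulVec_mulVec, hLB', Matrix.one_mulVec,
      Matrix.one_mulVec] at h4
  · intro z
    let c := hs.coord (h.trans h₁) (inc.app V' (h.trans (h₁.trans hV)) z)
    have hc : ∑ j, c j • E.res hV (h.trans h₁) (s j) = inc.app V' (h.trans (h₁.trans hV)) z :=
      hs.sum_coord _ _
    refine ⟨L'.mulVec c, ?_⟩
    have h2 := hP' V' (h.trans h₁) c
    rw [hBL'] at h2
    change ret.app V' _ (∑ j, B'.mulVec (L'.mulVec c) j • E.res hV (h.trans h₁) (s j)) = z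
    rw [Matrix.mulVec_mulVec, ← h2, hri, hc, hri]

end Mod

end FunAlg

/-! ### Frames of idempotents -/

namespace FunAlg

variable {X : Type u} [TopologicalSpace X] {A : FunAlg X}

namespace FMan

variable {S : A.FMan}

namespace IsIdempotentFrame

variable {n : ℕ} {U : Opens X} {ε : Fin n → A.VField U}

theorem restrict (hε : S.IsIdempotentFrame ε) {V : Opens X} (h : V ≤ U) :
    S.IsIdempotentFrame fun i => VField.res h (ε i) where
  frame := hε.frame.restrict h
  mul_self i := by rw [← S.mul_res, hε.mul_self]
  mul_ne i j hij := by rw [← S.mul_res, hε.mul_ne i j hij, map_zero]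

theorem mul_eq (hε : S.IsIdempotentFrame ε) (i j : Fin n) :
    S.mul U (ε i) (ε j) = if i = j then ε i else 0 := by
  split_ifs with h
  · rw [← h, hε.mul_self]
  · exact hε.mul_ne i j h

theorem exists_sum (hε : S.IsIdempotentFrame ε) (Y : A.VField U) :
    ∃ c : Fin n → A.Fn U, Y = ∑ i, c i • ε i :=
  ⟨hε.frame.coord le_rfl Y, (hε.frame.sum_coord le_rfl Y).symm⟩

theorem sum_mul (hε : S.IsIdempotentFrame ε) (c : Fin n → A.Fn U) (k : Fin n) :
    S.mul U (∑ i, c i • ε i) (ε k) = c k • ε k := by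
  simp [map_sum, LinearMap.sum_apply, hε.mul_eq]

theorem sum_eq (hε : S.IsIdempotentFrame ε) : ∑ i, ε i = VField.res le_top S.e := by
  obtain ⟨c, hc⟩ := hε.exists_sum (VField.res le_top S.e)
  have h1 : ∀ k, c k • ε k = ε k := fun k => by
    rw [← hε.sum_mul c k, ← hc, S.e_mul]
  rw [hc]
  exact Finset.sum_congr rfl fun k _ => (h1 k).symm

/-- Nondegeneracy of the metric, applied to the `k`-th coordinate, gives a field `Y` with
`g(Y, ε k) = 1`; only its component along `ε k` contributes. -/
theorem isUnit_θ (hε : S.IsIdempotentFrame ε) (g : S.Metric) (k : Fin n) :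
    IsUnit (g.θ U (ε k)) := by
  obtain ⟨Y, hY, -⟩ := g.nondegenerate U
    { app := fun V h => (LinearMap.proj k : (Fin n → A.Fn V) →ₗ[A.Fn V] A.Fn V) ∘ₗ
        (hε.frame.coord h).toLinearMap
      nat := fun hV h s => (hε.frame.coord_res hV h s k).symm }
  have h1 := hY U le_rfl (ε k)
  have h2 : hε.frame.coord le_rfl (ε k) = Pi.single k 1 := hε.frame.coord_self le_rfl k
  have h3 : hε.frame.coord le_rfl (ε k) k = g.g U Y (ε k) := h1
  obtain ⟨c, rfl⟩ := hε.exists_sum Y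
  have h4 : g.g U (∑ i, c i • ε i) (ε k) = c k * g.θ U (ε k) := by
    have h5 : ∀ Z, g.g U Z (ε k) = g.θ U (S.mul U Z (ε k)) := fun Z => by
      rw [Metric.θ, ← g.invariant, S.e_mul]
    rw [h5, hε.sum_mul, Metric.θ, map_smul, smul_eq_mul]
    rfl
  rw [h2, Pi.single_eq_same, h4] at h3
  exact IsUnit.of_mul_eq_one_right _ h3.symm

end IsIdempotentFrame

theorem Metric.θ_res (g : S.Metric) {U V : Opens X} (h : V ≤ U) (Y : A.VField U) :
    A.res h (g.θ U Y) = g.θ V (VField.res h Y) :=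
  g.g_res h _ _

end FMan

/-! ### Cardy categories -/

namespace EnrCat

variable {U : Opens X} {C : A.EnrCat.{u, w} U} {S : A.FMan} {g : S.Metric}

/-- Composition of sections over an open set `V`, where `h : V ≤ U`. -/
local notation:75 τ:76 " ∘[" h "] " σ:75 => Mod.Pairing.app (EnrCat.comp _ _ _ _) _ h τ σ

theorem res_comp {a b d : C.Obj} {V V' : Opens X} (hV : V ≤ U) (h : V' ≤ V)
    (τ : (C.Γ b d).sec V hV) (σ : (C.Γ a b).sec V hV) :
    (C.Γ a d).res hV h (τ ∘[hV] σ) = (C.Γ b d).res hV h τ ∘[h.trans hV] (C.Γ a b).res hV h σ :=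
  (C.comp a b d).nat hV h τ σ

namespace CardyStr

variable (c : C.CardyStr g)

/-- The linear form `θ_a` on the sections of `Γ_aa` over `V`, with values in `𝒪(V)`. -/
def trace {a : C.Obj} {V : Opens X} (hV : V ≤ U) : (C.Γ a a).sec V hV →ₗ[A.Fn V] A.Fn V :=
  (c.tr a).app V hV

theorem res_trace {a : C.Obj} {V V' : Opens X} (hV : V ≤ U) (h : V' ≤ V)
    (σ : (C.Γ a a).sec V hV) :
    A.res h (c.trace hV σ) = c.trace (h.trans hV) ((C.Γ a a).res hV h σ) :=
  (c.tr a).nat hV h σ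

theorem trace_comm {a b : C.Obj} {V : Opens X} (hV : V ≤ U) (σ : (C.Γ a b).sec V hV)
    (τ : (C.Γ b a).sec V hV) : c.trace hV (τ ∘[hV] σ) = c.trace hV (σ ∘[hV] τ) :=
  c.tr_comm a b V hV σ τ

/-- The map `ι_a` on sections over `V`. -/
def iotaSec (a : C.Obj) {V : Opens X} (hV : V ≤ U) : A.VField V →ₗ[A.Fn V] (C.Γ a a).sec V hV :=
  (c.iota a).app V hV

/-- The map `ι^a` on sections over `V`. -/
def iotaUpSec {a : C.Obj} {V : Opens X} (hV : V ≤ U) :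
    (C.Γ a a).sec V hV →ₗ[A.Fn V] A.VField V :=
  (c.iotaUp a).app V hV

theorem iotaSec_one (a : C.Obj) {V : Opens X} (hV : V ≤ U) :
    c.iotaSec a hV (VField.res le_top S.e) = C.one a V hV :=
  c.iota_one a V hV

theorem iotaSec_mul (a : C.Obj) {V : Opens X} (hV : V ≤ U) (Y Z : A.VField V) :
    c.iotaSec a hV (S.mul V Y Z) = c.iotaSec a hV Y ∘[hV] c.iotaSec a hV Z :=
  c.iota_mul a V hV Y Z

theorem res_iotaSec (a : C.Obj) {V V' : Opens X} (hV : V ≤ U) (h : V' ≤ V) (Y : A.VField V) :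
    (C.Γ a a).res hV h (c.iotaSec a hV Y) = c.iotaSec a (h.trans hV) (VField.res h Y) :=
  (c.iota a).nat hV h Y

theorem res_iotaUpSec {a : C.Obj} {V V' : Opens X} (hV : V ≤ U) (h : V' ≤ V)
    (σ : (C.Γ a a).sec V hV) :
    VField.res h (c.iotaUpSec hV σ) = c.iotaUpSec (h.trans hV) ((C.Γ a a).res hV h σ) :=
  (c.iotaUp a).nat hV h σ

theorem comp_iotaSec {a b : C.Obj} {V : Opens X} (hV : V ≤ U) (Y : A.VField V)
    (σ : (C.Γ a b).sec V hV) : σ ∘[hV] c.iotaSec a hV Y = c.iotaSec b hV Y ∘[hV] σ :=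
  c.central a b V hV Y σ

theorem θ_iotaUpSec_mul {a : C.Obj} {V : Opens X} (hV : V ≤ U) (Y : A.VField V)
    (σ : (C.Γ a a).sec V hV) :
    g.θ V (S.mul V (c.iotaUpSec hV σ) Y) = c.trace hV (σ ∘[hV] c.iotaSec a hV Y) :=
  c.adjoint a V hV Y σ

/-- The linear form `τ ↦ θ_a(τ σ)` on `Γ_ba`. -/
def trMul {a b : C.Obj} {V : Opens X} (hV : V ≤ U) (σ : (C.Γ a b).sec V hV) :
    ((C.Γ b a).restrict hV).Hom (A.str V) where
  app V' h := c.trace (h.trans hV) ∘ₗ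
    ((C.comp a b a).app V' (h.trans hV)).flip ((C.Γ a b).res hV h σ)
  nat {V' V''} h h' τ := by
    change A.res h' (c.trace (h.trans hV) (τ ∘[h.trans hV] (C.Γ a b).res hV h σ)) = _
    erw [c.res_trace, C.res_comp, (C.Γ a b).res_res]
    rfl

/-- A section of `Γ_ab` is determined by its pairings with the sections of `Γ_ba` over all smaller
open sets. -/
theorem perfect_ext {a b : C.Obj} {V : Opens X} (hV : V ≤ U) {σ σ' : (C.Γ a b).sec V hV}
    (H : ∀ (V' : Opens X) (h : V' ≤ V) (τ : (C.Γ b a).sec V' (h.trans hV)),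
      c.trace (h.trans hV) (τ ∘[h.trans hV] (C.Γ a b).res hV h σ) =
        c.trace (h.trans hV) (τ ∘[h.trans hV] (C.Γ a b).res hV h σ')) : σ = σ' :=
  (c.perfect a b V hV (c.trMul hV σ)).unique (fun _ _ _ => rfl) H

/-- Dual frames of `Γ_ab` and `Γ_ba` over `V`. -/
structure DualFrames {a b : C.Obj} {V : Opens X} (hV : V ≤ U) {r : ℕ}
    (s : Fin r → (C.Γ a b).sec V hV) (t : Fin r → (C.Γ b a).sec V hV) : Prop where
  left : (C.Γ a b).IsFrame hV s
  right : (C.Γ b a).IsFrame hV t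
  dual : ∀ i j, c.trace hV (t j ∘[hV] s i) = (if i = j then 1 else 0 : A.Fn V)

namespace DualFrames

variable {c} {a b : C.Obj} {V : Opens X} {hV : V ≤ U} {r : ℕ}
  {s : Fin r → (C.Γ a b).sec V hV} {t : Fin r → (C.Γ b a).sec V hV}

theorem restrict (d : c.DualFrames hV s t) {V' : Opens X} (h : V' ≤ V) :
    c.DualFrames (h.trans hV) (fun i => (C.Γ a b).res hV h (s i))
      fun i => (C.Γ b a).res hV h (t i) where
  left := d.left.restrict h
  right := d.right.restrict h
  dual i j := by
    rw [← C.res_comp, ← c.res_trace, d.dual]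
    split_ifs
    · exact map_one _
    · exact map_zero _

theorem sum_left (d : c.DualFrames hV s t) (σ : (C.Γ a b).sec V hV) :
    ∑ i, c.trace hV (t i ∘[hV] σ) • s i = σ := by
  obtain ⟨x, rfl⟩ := (d.left V le_rfl).surjective σ
  simp only [Mod.res_id, map_sum, map_smul, d.dual]
  refine Finset.sum_congr rfl fun i _ => ?_
  congr 1
  rw [Finset.sum_eq_single i (fun j _ hj => by rw [if_neg hj]; exact mul_zero _)
    (fun h => absurd (Finset.mem_univ i) h), if_pos rfl]
  exact mul_one _

theorem sum_right (d : c.DualFrames hV s t) (τ : (C.Γ b a).sec V hV) :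
    ∑ i, c.trace hV (τ ∘[hV] s i) • t i = τ := by
  obtain ⟨x, rfl⟩ := (d.right V le_rfl).surjective τ
  simp only [Mod.res_id, map_sum, map_smul, LinearMap.sum_apply, LinearMap.smul_apply, d.dual]
  refine Finset.sum_congr rfl fun i _ => ?_
  congr 1
  rw [Finset.sum_eq_single i (fun j _ hj => by rw [if_neg hj.symm]; exact mul_zero _)
    (fun h => absurd (Finset.mem_univ i) h), if_pos rfl]
  exact mul_one _

end DualFrames

/-- By perfectness of the pairing, the coordinates with respect to a frame of `Γ_ba` are represented
by sections of `Γ_ab`, which form the dual frame. -/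
theorem exists_dualFrames_of_isFrame {a b : C.Obj} {V : Opens X} (hV : V ≤ U) {r : ℕ}
    (t : Fin r → (C.Γ b a).sec V hV) (ht : (C.Γ b a).IsFrame hV t) :
    ∃ s : Fin r → (C.Γ a b).sec V hV, c.DualFrames hV s t := by
  have H := fun i => (c.perfect a b V hV
    { app := fun V' h => (LinearMap.proj i : (Fin r → A.Fn V') →ₗ[A.Fn V'] A.Fn V') ∘ₗ
        (ht.coord h).toLinearMap
      nat := fun h h' τ => (ht.coord_res h h' τ i).symm }).exists
  choose s hs using H
  have hs' : ∀ i V' (h : V' ≤ V) (τ : (C.Γ b a).sec V' (h.trans hV)),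
      ht.coord h τ i = c.trace (h.trans hV) (τ ∘[h.trans hV] (C.Γ a b).res hV h (s i)) := hs
  have dual : ∀ i j, c.trace hV (t j ∘[hV] s i) = (if i = j then 1 else 0 : A.Fn V) := by
    intro i j
    have h1 := hs' i V le_rfl (t j)
    have h2 : ht.coord le_rfl (t j) = Pi.single j 1 := by
      have := ht.coord_self le_rfl j
      rwa [Mod.res_id] at this
    rw [h2, Mod.res_id] at h1
    rw [← h1, Pi.single_apply]
  refine ⟨s, ⟨?_, ht, dual⟩⟩
  intro V' h
  have dual' : ∀ i j, c.trace (h.trans hV)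
      ((C.Γ b a).res hV h (t j) ∘[h.trans hV] (C.Γ a b).res hV h (s i)) =
        (if i = j then 1 else 0 : A.Fn V') := fun i j => by
    rw [← C.res_comp, ← c.res_trace, dual]
    split_ifs
    · exact map_one _
    · exact map_zero _
  constructor
  · intro x y hxy
    funext j
    have h1 := congrArg (fun σ => c.trace (h.trans hV)
      ((C.Γ b a).res hV h (t j) ∘[h.trans hV] σ)) hxy
    simp only [map_sum, map_smul, dual'] at h1
    have h2 : ∀ z : Fin r → A.Fn V', ∑ i, z i • (if i = j then 1 else 0 : A.Fn V') = z j :=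
      fun z => by simp
    exact (h2 x).symm.trans (h1.trans (h2 y))
  · intro σ
    refine ⟨fun i => c.trace (h.trans hV) ((C.Γ b a).res hV h (t i) ∘[h.trans hV] σ), ?_⟩
    refine c.perfect_ext (h.trans hV) fun V'' h' τ => ?_
    conv_rhs => rw [← ht.sum_coord (h'.trans h) τ]
    rw [map_sum]
    simp only [(C.Γ a b).res_smul, map_sum, map_smul, LinearMap.sum_apply, LinearMap.smul_apply,
      Mod.res_res]
    refine Finset.sum_congr rfl fun i _ => ?_
    rw [hs' i V'' (h'.trans h) τ, smul_eq_mul, smul_eq_mul, mul_comm]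
    congr 1
    rw [c.res_trace, C.res_comp, Mod.res_res]

theorem exists_dualFrames (a b : C.Obj) {x : X} (hx : x ∈ U) :
    ∃ (V : Opens X) (hV : V ≤ U), x ∈ V ∧ ∃ (r : ℕ) (s : Fin r → (C.Γ a b).sec V hV)
      (t : Fin r → (C.Γ b a).sec V hV), c.DualFrames hV s t := by
  obtain ⟨V, hV, hxV, r, t, ht⟩ := c.locallyFree b a x hx
  obtain ⟨s, hs⟩ := c.exists_dualFrames_of_isFrame hV t ht
  exact ⟨V, hV, hxV, r, s, t, hs⟩

theorem DualFrames.cardy {c : C.CardyStr g} {a b : C.Obj} {V : Opens X} {hV : V ≤ U} {r : ℕ}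
    {s : Fin r → (C.Γ a b).sec V hV} {t : Fin r → (C.Γ b a).sec V hV}
    (d : c.DualFrames hV s t) (σ : (C.Γ a a).sec V hV) :
    ∑ i, (s i ∘[hV] σ) ∘[hV] t i = c.iotaSec b hV (c.iotaUpSec hV σ) :=
  c.cardy a b V hV r s t d.left d.right d.dual σ

variable {n : ℕ}

/-- With respect to a frame `ε` of orthogonal idempotents, the coefficient of `ε k` in `ι^a σ` is
`θ_a(σ ι_a(ε k)) / θ(ε k)`. -/
theorem exists_iotaUp_eq {V : Opens X} {ε : Fin n → A.VField V} (hε : S.IsIdempotentFrame ε)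
    (hV : V ≤ U) (a : C.Obj) (σ : (C.Γ a a).sec V hV) :
    ∃ f : Fin n → A.Fn V, c.iotaUpSec hV σ = ∑ k, f k • ε k ∧
      ∀ k, f k * g.θ V (ε k) = c.trace hV (σ ∘[hV] c.iotaSec a hV (ε k)) := by
  obtain ⟨f, hf⟩ := hε.exists_sum (c.iotaUpSec hV σ)
  refine ⟨f, hf, fun k => ?_⟩
  rw [← c.θ_iotaUpSec_mul, hf, hε.sum_mul, FMan.Metric.θ, FMan.Metric.θ, map_smul, smul_eq_mul]

theorem sum_iotaSec {V : Opens X} {ε : Fin n → A.VField V} (hε : S.IsIdempotentFrame ε)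
    (hV : V ≤ U) (a : C.Obj) : ∑ k, c.iotaSec a hV (ε k) = C.one a V hV := by
  rw [← map_sum, hε.sum_eq, c.iotaSec_one]

theorem iotaSec_comp {V : Opens X} {ε : Fin n → A.VField V} (hε : S.IsIdempotentFrame ε)
    (hV : V ≤ U) (a : C.Obj) (i j : Fin n) :
    c.iotaSec a hV (ε i) ∘[hV] c.iotaSec a hV (ε j) =
      if i = j then c.iotaSec a hV (ε i) else 0 := by
  rw [← c.iotaSec_mul, hε.mul_eq]
  split_ifs
  · rfl
  · exact map_zero _

end CardyStr
end EnrCat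
end FunAlg

/-! ### Adjoining images of idempotents -/

namespace FunAlg

variable {X : Type u} [TopologicalSpace X] {A : FunAlg X}

namespace EnrCat

variable {U : Opens X} {C : A.EnrCat.{u, w} U} {S : A.FMan} {g : S.Metric}

local notation:75 τ:76 " ∘[" h "] " σ:75 => Mod.Pairing.app (EnrCat.comp _ _ _ _) _ h τ σ

/-- A family, indexed by `O`, of objects of `C` with idempotent endomorphisms defined over `U`. -/
structure IdempotentFamily (C : A.EnrCat.{u, w} U) (O : Type w) where
  base : O → C.Obj
  p : ∀ o, (C.Γ (base o) (base o)).sec U le_rfl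
  idem : ∀ o, p o ∘[le_rfl] p o = p o

namespace IdempotentFamily

variable {O : Type w} (I : C.IdempotentFamily O)

/-- The restriction to `V` of an idempotent of the family. -/
def pr (o : O) {V : Opens X} (h : V ≤ U) : (C.Γ (I.base o) (I.base o)).sec V h :=
  (C.Γ (I.base o) (I.base o)).res le_rfl h (I.p o)

theorem pr_res (o : O) {V V' : Opens X} (hV : V ≤ U) (h : V' ≤ V) :
    (C.Γ (I.base o) (I.base o)).res hV h (I.pr o hV) = I.pr o (h.trans hV) :=
  Mod.res_res _ _ _ _ _

theorem pr_pr (o : O) {V : Opens X} (h : V ≤ U) : I.pr o h ∘[h] I.pr o h = I.pr o h := by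
  unfold pr
  rw [← C.res_comp, I.idem]

theorem pr_pr_assoc {o : O} {a : C.Obj} {V : Opens X} (h : V ≤ U)
    (σ : (C.Γ a (I.base o)).sec V h) : I.pr o h ∘[h] (I.pr o h ∘[h] σ) = I.pr o h ∘[h] σ := by
  rw [← C.assoc, I.pr_pr]

/-- The sections `σ` of `Γ(base o, base o')` with `p_{o'} σ = σ = σ p_o`. -/
def hom (o o' : O) {V : Opens X} (h : V ≤ U) :
    Submodule (A.Fn V) ((C.Γ (I.base o) (I.base o')).sec V h) where
  carrier := {σ | I.pr o' h ∘[h] σ = σ ∧ σ ∘[h] I.pr o h = σ}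
  add_mem' {σ τ} hσ hτ := ⟨by rw [map_add, hσ.1, hτ.1],
    by rw [map_add, LinearMap.add_apply, hσ.2, hτ.2]⟩
  zero_mem' := ⟨map_zero _, by rw [map_zero, LinearMap.zero_apply]⟩
  smul_mem' f σ hσ := ⟨by rw [map_smul, hσ.1], by rw [map_smul, LinearMap.smul_apply, hσ.2]⟩

theorem res_mem_hom {o o' : O} {V V' : Opens X} (hV : V ≤ U) (h : V' ≤ V)
    {σ : (C.Γ (I.base o) (I.base o')).sec V hV} (hσ : σ ∈ I.hom o o' hV) :
    (C.Γ (I.base o) (I.base o')).res hV h σ ∈ I.hom o o' (h.trans hV) :=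
  ⟨by rw [← I.pr_res o' hV h, ← C.res_comp, hσ.1], by
    rw [← I.pr_res o hV h, ← C.res_comp, hσ.2]⟩

theorem comp_mem_hom {o o' o'' : O} {V : Opens X} (h : V ≤ U)
    {τ : (C.Γ (I.base o') (I.base o'')).sec V h} {σ : (C.Γ (I.base o) (I.base o')).sec V h}
    (hτ : τ ∈ I.hom o' o'' h) (hσ : σ ∈ I.hom o o' h) : τ ∘[h] σ ∈ I.hom o o'' h :=
  ⟨by rw [← C.assoc, hτ.1], by rw [C.assoc, hσ.2]⟩

theorem pr_mem_hom (o : O) {V : Opens X} (h : V ≤ U) : I.pr o h ∈ I.hom o o h :=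
  ⟨I.pr_pr o h, I.pr_pr o h⟩

theorem pr_comp_pr_mem_hom (o o' : O) {V : Opens X} (h : V ≤ U)
    (σ : (C.Γ (I.base o) (I.base o')).sec V h) :
    (I.pr o' h ∘[h] σ) ∘[h] I.pr o h ∈ I.hom o o' h :=
  ⟨by rw [← C.assoc, I.pr_pr_assoc], by rw [C.assoc, I.pr_pr]⟩

theorem res_pr_comp_pr {o o' : O} {V V' : Opens X} (hV : V ≤ U) (h : V' ≤ V)
    (σ : (C.Γ (I.base o) (I.base o')).sec V hV) :
    (C.Γ (I.base o) (I.base o')).res hV h ((I.pr o' hV ∘[hV] σ) ∘[hV] I.pr o hV) =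
      (I.pr o' (h.trans hV) ∘[h.trans hV] (C.Γ (I.base o) (I.base o')).res hV h σ)
        ∘[h.trans hV] I.pr o (h.trans hV) := by
  rw [C.res_comp, C.res_comp, I.pr_res, I.pr_res]

theorem iotaSec_mem_hom (c : C.CardyStr g) (o : O) {V : Opens X} (h : V ≤ U) (Y : A.VField V) :
    I.pr o h ∘[h] c.iotaSec (I.base o) h Y ∈ I.hom o o h :=
  ⟨I.pr_pr_assoc h _, by rw [C.assoc, ← c.comp_iotaSec, I.pr_pr_assoc]⟩

/-- The presheaf of morphisms between the images of two idempotents. -/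
def Γ (o o' : O) : A.Mod U where
  sec V h := I.hom o o' h
  res hV h := (((C.Γ (I.base o) (I.base o')).res hV h).comp
    (I.hom o o' hV).toAddSubgroup.subtype).codRestrict (I.hom o o' (h.trans hV)).toAddSubgroup
      fun σ => I.res_mem_hom hV h σ.2
  res_smul hV h f σ := Subtype.ext (Mod.res_smul _ hV h f σ.1)
  res_id hV σ := Subtype.ext (Mod.res_id _ hV σ.1)
  res_res hV h h' σ := Subtype.ext (Mod.res_res _ hV h h' σ.1)

/-- The category of the images of the idempotents of the family. -/
def cat : A.EnrCat.{u, w} U where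
  Obj := O
  Γ := I.Γ
  comp o o' o'' :=
    { app := fun V h => LinearMap.mk₂ (A.Fn V)
        (fun (τ : I.hom o' o'' h) (σ : I.hom o o' h) =>
          (⟨τ.1 ∘[h] σ.1, I.comp_mem_hom h τ.2 σ.2⟩ : I.hom o o'' h))
        (fun τ τ' σ => Subtype.ext (LinearMap.map_add₂ _ τ.1 τ'.1 σ.1))
        (fun f τ σ => Subtype.ext (LinearMap.map_smul₂ _ f τ.1 σ.1))
        (fun τ σ σ' => Subtype.ext (map_add _ σ.1 σ'.1))
        (fun f τ σ => Subtype.ext (map_smul _ f σ.1))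
      nat := fun hV h τ σ => Subtype.ext (C.res_comp hV h τ.1 σ.1) }
  one o V h := ⟨I.pr o h, I.pr_mem_hom o h⟩
  one_res o V V' hV h := Subtype.ext (I.pr_res o hV h)
  one_comp o o' V h σ := Subtype.ext σ.2.1
  comp_one o o' V h σ := Subtype.ext σ.2.2
  assoc _ _ _ _ V h ρ τ σ := Subtype.ext (C.assoc _ _ _ _ V h ρ.1 τ.1 σ.1)

theorem isSheaf_Γ (c : C.CardyStr g) (o o' : O) : (I.Γ o o').IsSheaf := by
  intro V hV J N hN hcov s hs
  obtain ⟨t, ht, hu⟩ := c.isSheaf (I.base o) (I.base o') V hV J N hN hcov (fun i => (s i).1)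
    (fun i j => congrArg Subtype.val (hs i j))
  have h1 : ∀ t' : (C.Γ (I.base o) (I.base o')).sec V hV,
      (∀ i, (C.Γ (I.base o) (I.base o')).res hV (hN i) t' = (s i).1) → t' = t := hu
  refine ⟨⟨t, h1 _ fun i => ?_, h1 _ fun i => ?_⟩, fun i => Subtype.ext (ht i), fun t' ht' =>
    Subtype.ext (hu _ fun i => congrArg Subtype.val (ht' i))⟩
  · rw [C.res_comp, ht, I.pr_res]
    exact (s i).2.1
  · rw [C.res_comp, ht, I.pr_res]
    exact (s i).2.2

theorem locallyFree_Γ (c : C.CardyStr g) (hA : A.IsLocal) (o o' : O) :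
    (I.Γ o o').IsLocallyFree := by
  refine Mod.IsLocallyFree.of_retract hA
    (E := C.Γ (I.base o) (I.base o'))
    { app := fun V h => (I.hom o o' h).subtype
      nat := fun _ _ _ => rfl }
    { app := fun V h => (((C.comp _ _ _).app V h).flip (I.pr o h) ∘ₗ
        (C.comp _ _ _).app V h (I.pr o' h)).codRestrict _
          fun σ => I.pr_comp_pr_mem_hom o o' h σ
      nat := fun {V V'} hV h σ => Subtype.ext ?_ } ?_ (c.locallyFree _ _)
  · change (C.Γ (I.base o) (I.base o')).res hV h ((I.pr o' hV ∘[hV] σ) ∘[hV] I.pr o hV) =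
      (I.pr o' (h.trans hV) ∘[h.trans hV] _) ∘[h.trans hV] I.pr o (h.trans hV)
    exact I.res_pr_comp_pr hV h σ
  · intro V h z
    refine Subtype.ext ?_
    change (I.pr o' h ∘[h] z.1) ∘[h] I.pr o h = z.1
    rw [z.2.1, z.2.2]

variable (c : C.CardyStr g)

theorem trace_pr_comp_pr {o o' : O} {V : Opens X} (h : V ≤ U)
    {τ : (C.Γ (I.base o') (I.base o)).sec V h} (hτ : τ ∈ I.hom o' o h)
    (σ : (C.Γ (I.base o) (I.base o')).sec V h) :
    c.trace h (τ ∘[h] ((I.pr o' h ∘[h] σ) ∘[h] I.pr o h)) = c.trace h (τ ∘[h] σ) := by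
  rw [C.assoc, ← C.assoc (ρ := τ), hτ.2, ← C.assoc, c.trace_comm, ← C.assoc, hτ.1]

theorem trace_pr_comp_pr' {o o' : O} {V : Opens X} (h : V ≤ U)
    {τ : (C.Γ (I.base o') (I.base o)).sec V h} (hτ : τ ∈ I.hom o' o h)
    (σ : (C.Γ (I.base o) (I.base o')).sec V h) :
    c.trace h (((I.pr o' h ∘[h] σ) ∘[h] I.pr o h) ∘[h] τ) = c.trace h (σ ∘[h] τ) := by
  rw [c.trace_comm, I.trace_pr_comp_pr c h hτ, c.trace_comm]

/-- The linear form of the image of an idempotent. -/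
def tr (o : O) : (I.Γ o o).Hom (A.str U) where
  app V h := c.trace h ∘ₗ (I.hom o o h).subtype
  nat hV h σ := (c.tr (I.base o)).nat hV h σ.1

theorem perfect (o o' : O) (V : Opens X) (hV : V ≤ U)
    (φ : ((I.Γ o' o).restrict hV).Hom (A.str V)) :
    ∃! σ : I.hom o o' hV, ∀ (V' : Opens X) (h : V' ≤ V) (τ : I.hom o' o (h.trans hV)),
      φ.app V' h τ = c.trace (h.trans hV)
        (τ.1 ∘[h.trans hV] (C.Γ (I.base o) (I.base o')).res hV h σ.1) := by
  let φ' : ((C.Γ (I.base o') (I.base o)).restrict hV).Hom (A.str V) :=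
    { app := fun V' h => φ.app V' h ∘ₗ
        (((C.comp _ _ _).app V' (h.trans hV)).flip (I.pr o' (h.trans hV)) ∘ₗ
          (C.comp _ _ _).app V' (h.trans hV) (I.pr o (h.trans hV))).codRestrict
            (I.hom o' o (h.trans hV)) fun σ => I.pr_comp_pr_mem_hom o' o (h.trans hV) σ
      nat := fun {V' V''} h h' τ => by
        refine (φ.nat h h' _).trans (congrArg (φ.app V'' (h'.trans h)) (Subtype.ext ?_))
        change (C.Γ (I.base o') (I.base o)).res (h.trans hV) h'
            ((I.pr o (h.trans hV) ∘[h.trans hV] τ) ∘[h.trans hV] I.pr o' (h.trans hV)) =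
          (I.pr o _ ∘[(h'.trans h).trans hV] _) ∘[(h'.trans h).trans hV] I.pr o' _
        exact I.res_pr_comp_pr (h.trans hV) h' τ }
  have hφ' : ∀ (V' : Opens X) (h : V' ≤ V) (τ : (C.Γ (I.base o') (I.base o)).sec V' (h.trans hV)),
      φ'.app V' h τ = φ.app V' h ⟨_, I.pr_comp_pr_mem_hom o' o (h.trans hV) τ⟩ :=
    fun _ _ _ => rfl
  obtain ⟨σ, hσ, hu⟩ := c.perfect (I.base o) (I.base o') V hV φ'
  have hσ' : ∀ (V' : Opens X) (h : V' ≤ V) (τ : (C.Γ (I.base o') (I.base o)).sec V' (h.trans hV)),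
      φ'.app V' h τ = c.trace (h.trans hV)
        (τ ∘[h.trans hV] (C.Γ (I.base o) (I.base o')).res hV h σ) := hσ
  refine ⟨⟨_, I.pr_comp_pr_mem_hom o o' hV σ⟩, fun V' h τ => ?_, fun σ' hσ'' => ?_⟩
  · change _ = c.trace (h.trans hV) (τ.1 ∘[h.trans hV] (C.Γ (I.base o) (I.base o')).res hV h
      ((I.pr o' hV ∘[hV] σ) ∘[hV] I.pr o hV))
    rw [I.res_pr_comp_pr, I.trace_pr_comp_pr c _ τ.2, ← hσ', hφ']
    congr 1
    refine Subtype.ext ?_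
    change τ.1 = (I.pr o _ ∘[h.trans hV] τ.1) ∘[h.trans hV] I.pr o' _
    rw [τ.2.1, τ.2.2]
  · have h1 : σ'.1 = σ := hu _ fun V' h τ => by
      change φ'.app V' h τ = c.trace (h.trans hV)
        (τ ∘[h.trans hV] (C.Γ (I.base o) (I.base o')).res hV h σ'.1)
      rw [hφ', hσ'', I.trace_pr_comp_pr' c _ (I.res_mem_hom hV h σ'.2)]
    refine Subtype.ext ?_
    change σ'.1 = (I.pr o' hV ∘[hV] σ) ∘[hV] I.pr o hV
    rw [← h1, σ'.2.1, σ'.2.2]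

/-- The Cardy condition for images of idempotents.  The Casimir element `∑ S k ⊗ T k` of the
ambient category, multiplied by the idempotents, becomes the one of the images, which does not
depend on the frames. -/
theorem sum_comp_comp {o o' : O} {V : Opens X} {h : V ≤ U} {m r : ℕ}
    {S' : Fin m → (C.Γ (I.base o) (I.base o')).sec V h}
    {T' : Fin m → (C.Γ (I.base o') (I.base o)).sec V h} (d : c.DualFrames h S' T')
    (s : Fin r → (C.Γ (I.base o) (I.base o')).sec V h)
    (t : Fin r → (C.Γ (I.base o') (I.base o)).sec V h)
    (ht : ∀ i, t i ∈ I.hom o' o h)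
    (hs : ∀ w ∈ I.hom o o' h, ∑ i, c.trace h (t i ∘[h] w) • s i = w)
    {σ : (C.Γ (I.base o) (I.base o)).sec V h} (hσ : σ ∈ I.hom o o h) :
    ∑ i, (s i ∘[h] σ) ∘[h] t i =
      I.pr o' h ∘[h] c.iotaSec (I.base o') h (c.iotaUpSec h σ) := by
  have h1 : ∀ k, (I.pr o' h ∘[h] S' k) ∘[h] I.pr o h =
      ∑ i, c.trace h (t i ∘[h] S' k) • s i := fun k => by
    rw [← hs _ (I.pr_comp_pr_mem_hom o o' h (S' k))]
    exact Finset.sum_congr rfl fun i _ => by rw [I.trace_pr_comp_pr c h (ht i)]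
  have h2 : ∀ i, ∑ k, c.trace h (t i ∘[h] S' k) • ((I.pr o h ∘[h] T' k) ∘[h] I.pr o' h) =
      t i := fun i => by
    conv_rhs => rw [← (ht i).2, ← (ht i).1, ← d.sum_right (t i)]
    simp only [map_sum, map_smul, LinearMap.sum_apply, LinearMap.smul_apply]
  have h3 : σ = I.pr o h ∘[h] (σ ∘[h] I.pr o h) := by rw [hσ.2, hσ.1]
  rw [← (I.iotaSec_mem_hom c o' h _).2, ← d.cardy]
  calc ∑ i, (s i ∘[h] σ) ∘[h] t i
      = ∑ i, ∑ k, c.trace h (t i ∘[h] S' k) •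
          ((s i ∘[h] σ) ∘[h] ((I.pr o h ∘[h] T' k) ∘[h] I.pr o' h)) := by
        refine Finset.sum_congr rfl fun i _ => ?_
        conv_lhs => rw [← h2 i]
        simp only [map_sum, map_smul]
    _ = ∑ k, (((I.pr o' h ∘[h] S' k) ∘[h] I.pr o h) ∘[h] σ) ∘[h]
          ((I.pr o h ∘[h] T' k) ∘[h] I.pr o' h) := by
        rw [Finset.sum_comm]
        refine Finset.sum_congr rfl fun k _ => ?_
        rw [h1 k]
        simp only [map_sum, map_smul, LinearMap.sum_apply, LinearMap.smul_apply]
    _ = _ := by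
        simp only [map_sum, LinearMap.sum_apply]
        refine Finset.sum_congr rfl fun k _ => ?_
        conv_rhs => rw [h3]
        simp only [C.assoc]

theorem _root_.FunAlg.Mod.IsSheaf.ext {W : Opens X} {E : A.Mod W} (hE : E.IsSheaf) {V : Opens X}
    {hV : V ≤ W} {σ τ : E.sec V hV}
    (H : ∀ x ∈ V, ∃ (V' : Opens X) (h : V' ≤ V), x ∈ V' ∧ E.res hV h σ = E.res hV h τ) :
    σ = τ := by
  choose N hN hx hst using fun x : V => H x.1 x.2
  refine (hE V hV V N hN (fun x hxV => ?_) (fun i => E.res hV (hN i) σ) fun i j => ?_).unique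
    (fun _ => rfl) fun i => (hst i).symm
  · exact Opens.mem_iSup.2 ⟨⟨x, hxV⟩, hx ⟨x, hxV⟩⟩
  · rw [E.res_res, E.res_res]

theorem cardy (o o' : O) {V : Opens X} (h : V ≤ U) {r : ℕ} (s : Fin r → (I.Γ o o').sec V h)
    (t : Fin r → (I.Γ o' o).sec V h) (hs : (I.Γ o o').IsFrame h s)
    (dual : ∀ i j, c.trace h ((t j).1 ∘[h] (s i).1) = if i = j then 1 else 0)
    (σ : I.hom o o h) :
    ∑ i, ((s i).1 ∘[h] σ.1) ∘[h] (t i).1 =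
      I.pr o' h ∘[h] c.iotaSec (I.base o') h (c.iotaUpSec h σ.1) := by
  refine (c.isSheaf (I.base o') (I.base o')).ext fun x hx => ?_
  obtain ⟨V₁, h₁, hx₁, m, S', T', d⟩ := c.exists_dualFrames (I.base o) (I.base o') (h hx)
  have h₂ : V ⊓ V₁ ≤ V := inf_le_left
  refine ⟨V ⊓ V₁, h₂, ⟨hx, hx₁⟩, ?_⟩
  have d' := d.restrict (inf_le_right : V ⊓ V₁ ≤ V₁)
  have dual' : ∀ i j, c.trace (h₂.trans h) ((C.Γ _ _).res h h₂ (t j).1 ∘[h₂.trans h]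
      (C.Γ _ _).res h h₂ (s i).1) = if i = j then 1 else 0 := fun i j => by
    rw [← C.res_comp, ← c.res_trace, dual]
    split_ifs
    · exact map_one _
    · exact map_zero _
  have key := I.sum_comp_comp c d' (fun i => (C.Γ _ _).res h h₂ (s i).1)
    (fun i => (C.Γ _ _).res h h₂ (t i).1) (fun i => I.res_mem_hom h h₂ (t i).2)
    (fun w hw => ?_) (I.res_mem_hom h h₂ σ.2)
  · rw [C.res_comp, I.pr_res, c.res_iotaSec, c.res_iotaUpSec, ← key, map_sum]
    refine Finset.sum_congr rfl fun i _ => ?_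
    rw [C.res_comp, C.res_comp]
  · obtain ⟨f, hf⟩ := (hs (V ⊓ V₁) h₂).surjective ⟨w, hw⟩
    have hf' : ∑ i, f i • (C.Γ _ _).res h h₂ (s i).1 = w := by
      have := congrArg (I.hom o o' (h₂.trans h)).subtype hf
      erw [map_sum] at this
      exact this
    rw [← hf']
    refine Finset.sum_congr rfl fun i _ => ?_
    congr 1
    simp only [map_sum, map_smul, dual']
    simp

theorem res_pr_comp_iotaSec (o : O) {V V' : Opens X} (hV : V ≤ U) (h : V' ≤ V)
    (Y : A.VField V) :
    (C.Γ (I.base o) (I.base o)).res hV h (I.pr o hV ∘[hV] c.iotaSec (I.base o) hV Y) =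
      I.pr o (h.trans hV) ∘[h.trans hV] c.iotaSec (I.base o) (h.trans hV) (VField.res h Y) := by
  rw [C.res_comp, c.res_iotaSec, I.pr_res]

/-- The map `ι` of the image of an idempotent. -/
def iota (o : O) : (A.tangent U).Hom (I.Γ o o) where
  app V h := ((C.comp _ _ _).app V h (I.pr o h) ∘ₗ c.iotaSec (I.base o) h).codRestrict
    (I.hom o o h) fun Y => I.iotaSec_mem_hom c o h Y
  nat {V V'} hV h Y := Subtype.ext (I.res_pr_comp_iotaSec c o hV h Y)

theorem pr_comp_iotaSec_mul (o : O) {V : Opens X} (h : V ≤ U) (Y Z : A.VField V) :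
    I.pr o h ∘[h] c.iotaSec (I.base o) h (S.mul V Y Z) =
      (I.pr o h ∘[h] c.iotaSec (I.base o) h Y) ∘[h] (I.pr o h ∘[h] c.iotaSec (I.base o) h Z) := by
  rw [← C.assoc (ρ := I.pr o h ∘[h] c.iotaSec (I.base o) h Y), (I.iotaSec_mem_hom c o h Y).2,
    c.iotaSec_mul, C.assoc]

/-- The images of a family of idempotents in a Cardy category form a Cardy category. -/
def cardyStr (hA : A.IsLocal) : I.cat.CardyStr g where
  isSheaf := I.isSheaf_Γ c
  locallyFree := I.locallyFree_Γ c hA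
  tr := I.tr c
  tr_comm o o' V h σ τ := c.trace_comm h σ.1 τ.1
  perfect := I.perfect c
  iota := I.iota c
  iota_one o V h := Subtype.ext
    ((congrArg _ (c.iotaSec_one (I.base o) h)).trans (C.comp_one _ _ V h (I.pr o h)))
  iota_mul o V h Y Z := Subtype.ext (I.pr_comp_iotaSec_mul c o h Y Z)
  iotaUp o :=
    { app := fun V h => c.iotaUpSec h ∘ₗ (I.hom o o h).subtype
      nat := fun hV h σ => c.res_iotaUpSec hV h σ.1 }
  central o o' V h Y σ := Subtype.ext (by
    change σ.1 ∘[h] (I.pr o h ∘[h] c.iotaSec _ h Y) = (I.pr o' h ∘[h] c.iotaSec _ h Y) ∘[h] σ.1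
    rw [← C.assoc, σ.2.2, C.assoc, ← c.comp_iotaSec, ← C.assoc, σ.2.1])
  adjoint o V h Y σ := by
    change g.θ V (S.mul V (c.iotaUpSec h σ.1) Y) =
      c.trace h (σ.1 ∘[h] (I.pr o h ∘[h] c.iotaSec _ h Y))
    rw [c.θ_iotaUpSec_mul, ← C.assoc, σ.2.2]
  cardy o o' V h r s t hs ht dual σ := Subtype.ext
    ((map_sum (I.hom o' o' h).subtype _ _).trans (I.cardy c o o' h s t hs dual σ))

end IdempotentFamily

/-- The family which consists of the identities of all objects of `C` and of a further
idempotent `p`. -/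
def IdempotentFamily.adjoin (a : C.Obj) (p : (C.Γ a a).sec U le_rfl) (hp : p ∘[le_rfl] p = p) :
    C.IdempotentFamily (Option C.Obj) where
  base o := o.getD a
  p o := match o with
    | none => p
    | some b => C.one b U le_rfl
  idem o := match o with
    | none => hp
    | some b => C.one_comp _ _ _ _ _

namespace IdempotentFamily

variable (c : C.CardyStr g) (a : C.Obj) (p : (C.Γ a a).sec U le_rfl) (hp : p ∘[le_rfl] p = p)

theorem pr_adjoin_some (b : C.Obj) {V : Opens X} (h : V ≤ U) :
    (adjoin a p hp).pr (some b) h = C.one b V h :=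
  C.one_res b le_rfl h

theorem mem_hom_adjoin (b b' : C.Obj) {V : Opens X} (h : V ≤ U) (σ : (C.Γ b b').sec V h) :
    σ ∈ (adjoin a p hp).hom (some b) (some b') h :=
  ⟨by rw [pr_adjoin_some]; exact C.one_comp _ _ _ _ _,
    by rw [pr_adjoin_some]; exact C.comp_one _ _ _ _ _⟩

/-- The embedding of a Cardy category into the one obtained by adjoining the image of an
idempotent. -/
def adjoinEmbedding (hA : A.IsLocal) : Embedding c ((adjoin a p hp).cardyStr c hA) where
  obj := some
  map b b' :=
    { app := fun V h => LinearMap.id.codRestrict ((adjoin a p hp).hom (some b) (some b') h)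
        (mem_hom_adjoin a p hp b b' h)
      nat := fun _ _ _ => rfl }
  bij b b' V h := ⟨fun σ τ hστ => congrArg Subtype.val hστ, fun σ => ⟨σ.1, rfl⟩⟩
  map_one b V h := Subtype.ext (pr_adjoin_some a p hp b h).symm
  map_comp _ _ _ _ _ _ _ := rfl
  map_tr _ _ _ _ := rfl
  map_iota b V h Y := Subtype.ext (by
    change _ = (adjoin a p hp).pr (some b) h ∘[h] _
    rw [pr_adjoin_some]
    exact (C.one_comp _ _ _ _ _).symm)
  map_iotaUp _ _ _ _ := rfl

end IdempotentFamily

end EnrCat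
end FunAlg

/-! ### Adjoining an isolated simple object -/

namespace FunAlg

variable {X : Type u} [TopologicalSpace X] {A : FunAlg X}

namespace FMan.IsIdempotentFrame

variable {S : A.FMan} {n : ℕ} {U : Opens X} {ε : Fin n → A.VField U}

/-- The coefficient of `ε i` in a vector field. -/
noncomputable def coeff (hε : S.IsIdempotentFrame ε) (i : Fin n) {V : Opens X} (h : V ≤ U) :
    A.VField V →ₗ[A.Fn V] A.Fn V :=
  (LinearMap.proj i : (Fin n → A.Fn V) →ₗ[A.Fn V] A.Fn V) ∘ₗ (hε.frame.coord h).toLinearMap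

variable (hε : S.IsIdempotentFrame ε) (i : Fin n)

theorem coeff_sum {V : Opens X} (h : V ≤ U) (c : Fin n → A.Fn V) :
    hε.coeff i h (∑ k, c k • VField.res h (ε k)) = c i :=
  congrFun (hε.frame.coord_sum h c) i

theorem res_coeff {V V' : Opens X} (h : V ≤ U) (h' : V' ≤ V) (Y : A.VField V) :
    A.res h' (hε.coeff i h Y) = hε.coeff i (h'.trans h) (VField.res h' Y) :=
  (hε.frame.coord_res h h' Y i).symm

theorem mul_ε {V : Opens X} (h : V ≤ U) (Y : A.VField V) :
    S.mul V Y (VField.res h (ε i)) = hε.coeff i h Y • VField.res h (ε i) := by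
  obtain ⟨c, rfl⟩ := (hε.restrict h).exists_sum Y
  rw [(hε.restrict h).sum_mul, hε.coeff_sum]

theorem ε_mul {V : Opens X} (h : V ≤ U) (Y : A.VField V) :
    S.mul V (VField.res h (ε i)) Y = hε.coeff i h Y • VField.res h (ε i) := by
  obtain ⟨c, rfl⟩ := (hε.restrict h).exists_sum Y
  rw [hε.coeff_sum]
  simp [map_sum, (hε.restrict h).mul_eq]

theorem coeff_smul_ε {V : Opens X} (h : V ≤ U) (f : A.Fn V) :
    hε.coeff i h (f • VField.res h (ε i)) = f := by
  have := hε.coeff_sum i h (Pi.single i f)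
  rw [Pi.single_eq_same] at this
  rwa [Finset.sum_eq_single i (fun j _ hj => by rw [Pi.single_eq_of_ne hj, zero_smul])
    (fun h => absurd (Finset.mem_univ i) h), Pi.single_eq_same] at this

theorem coeff_mul {V : Opens X} (h : V ≤ U) (Y Z : A.VField V) :
    hε.coeff i h (S.mul V Y Z) = hε.coeff i h Y * hε.coeff i h Z := by
  have h1 := hε.mul_ε i h (S.mul V Y Z)
  rw [S.mul_assoc, hε.mul_ε, map_smul, hε.mul_ε, smul_smul] at h1
  have := congrArg (hε.coeff i h) h1
  rw [coeff_smul_ε, coeff_smul_ε] at this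
  rw [← this, mul_comm]

theorem coeff_one {V : Opens X} (h : V ≤ U) :
    hε.coeff i h (VField.res le_top S.e) = 1 := by
  have := congrArg (hε.coeff i h) (hε.mul_ε i h (VField.res le_top S.e))
  rw [S.e_mul, coeff_smul_ε] at this
  rw [← this]
  have h1 := hε.coeff_smul_ε i h 1
  rwa [one_smul] at h1

end FMan.IsIdempotentFrame

namespace Mod

/-- The zero presheaf of modules. -/
def zero (W : Opens X) : A.Mod W where
  sec _ _ := PUnit
  res _ _ := 0
  res_smul _ _ _ _ := rfl
  res_id _ _ := rfl
  res_res _ _ _ _ := rfl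

/-- The zero pairing. -/
def Pairing.zero {W : Opens X} (E F G : A.Mod W) :
    Pairing E F G W le_rfl le_rfl le_rfl where
  app _ _ := 0
  nat _ _ _ _ := map_zero _

theorem zero_isSheaf (W : Opens X) : (zero W : A.Mod W).IsSheaf :=
  fun _ _ _ _ _ _ _ _ => ⟨PUnit.unit, fun _ => rfl, fun _ _ => rfl⟩

theorem zero_locallyFree (W : Opens X) : (zero W : A.Mod W).IsLocallyFree :=
  fun _ hx => ⟨W, le_rfl, hx, 0, Fin.elim0, fun _ _ =>
    ⟨fun _ _ _ => funext fun i => i.elim0, fun _ => ⟨Fin.elim0, rfl⟩⟩⟩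

theorem str_isSheaf (hA : A.IsLocal) (W : Opens X) : (A.str W).IsSheaf := by
  intro V hV J N hN hcov s hs
  have hex : ∀ x : V, ∃ j, x.1 ∈ N j := fun x => Opens.mem_iSup.1 (hcov x.2)
  choose j hj using hex
  have heq : ∀ (x : V) (k : J) (hk : x.1 ∈ N k), ev (hj x) (s (j x)) = ev hk (s k) :=
    fun x k hk => congrArg (ev (A := A) (⟨hj x, hk⟩ : x.1 ∈ N (j x) ⊓ N k)) (hs (j x) k)
  have hmem : (fun x : V => ev (hj x) (s (j x))) ∈ A.alg V := by
    refine hA.glue V _ fun x => ⟨N (j x), hN _, hj x, ?_⟩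
    convert (s (j x)).2 using 1
    funext y
    exact heq ⟨y.1, _⟩ (j x) y.2
  refine ⟨⟨_, hmem⟩, fun k => Fn.ext_ev fun x hx => heq ⟨x, hN k hx⟩ k hx, fun t ht =>
    Fn.ext_ev fun x hx => ?_⟩
  exact congrArg (ev (A := A) (hj ⟨x, hx⟩)) (ht (j ⟨x, hx⟩))

theorem str_locallyFree (W : Opens X) : (A.str W).IsLocallyFree := by
  refine fun _ hx => ⟨W, le_rfl, hx, 1, fun _ => (1 : A.Fn W), fun V h => ?_⟩
  have h1 : ∀ c : Fin 1 → A.Fn V, ∑ i, c i • (A.str W).res le_rfl h (1 : A.Fn W) = c 0 := by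
    intro c
    rw [Fin.sum_univ_one]
    exact (congrArg (c 0 * ·) (map_one (A.res h))).trans (mul_one _)
  refine ⟨fun c d hcd => funext fun i => ?_, fun f => ⟨fun _ => f, h1 _⟩⟩
  rw [Subsingleton.elim i 0]
  exact (h1 c).symm.trans (hcd.trans (h1 d))

/-- The multiplication of functions. -/
def Pairing.mul (W : Opens X) : Pairing (A.str W) (A.str W) (A.str W) W le_rfl le_rfl le_rfl where
  app V _ := LinearMap.mul (A.Fn V) (A.Fn V)
  nat _ h s t := map_mul (A.res h) (show A.Fn _ from s) (show A.Fn _ from t)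

end Mod

namespace EnrCat

variable {U : Opens X}

/-- The sheaves of morphisms after adjoining an isolated object with endomorphisms `𝒪`. -/
def isolatedΓ (C : A.EnrCat.{u, w} U) : Option C.Obj → Option C.Obj → A.Mod U
  | some a, some b => C.Γ a b
  | none, none => A.str U
  | some _, none => Mod.zero U
  | none, some _ => Mod.zero U

/-- Composition after adjoining an isolated object. -/
def isolatedComp (C : A.EnrCat.{u, w} U) : ∀ a b d : Option C.Obj,
    Mod.Pairing (C.isolatedΓ b d) (C.isolatedΓ a b) (C.isolatedΓ a d) U le_rfl le_rfl le_rfl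
  | some a, some b, some d => C.comp a b d
  | none, none, none => Mod.Pairing.mul U
  | some _, some _, none => Mod.Pairing.zero _ _ _
  | some _, none, some _ => Mod.Pairing.zero _ _ _
  | some _, none, none => Mod.Pairing.zero _ _ _
  | none, some _, some _ => Mod.Pairing.zero _ _ _
  | none, some _, none => Mod.Pairing.zero _ _ _
  | none, none, some _ => Mod.Pairing.zero _ _ _

/-- A category with an isolated object with endomorphisms `𝒪` adjoined. -/
def isolated (C : A.EnrCat.{u, w} U) : A.EnrCat.{u, w} U where
  Obj := Option C.Obj
  Γ := C.isolatedΓ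
  comp := C.isolatedComp
  one a V h := match a with
    | some a => C.one a V h
    | none => (1 : A.Fn V)
  one_res a V V' hV h := match a with
    | some a => C.one_res a hV h
    | none => map_one (A.res h)
  one_comp a b V h σ := match a, b, σ with
    | some a, some b, σ => C.one_comp a b V h σ
    | none, none, σ => one_mul (M := A.Fn V) σ
    | some _, none, _ => rfl
    | none, some _, _ => rfl
  comp_one a b V h σ := match a, b, σ with
    | some a, some b, σ => C.comp_one a b V h σ
    | none, none, σ => mul_one (M := A.Fn V) σ
    | some _, none, _ => rfl
    | none, some _, _ => rfl
  assoc a b c d V h ρ τ σ := match a, b, c, d, ρ, τ, σ with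
    | some a, some b, some c, some d, ρ, τ, σ => C.assoc a b c d V h ρ τ σ
    | none, none, none, none, ρ, τ, σ => mul_assoc (G := A.Fn V) ρ τ σ
    | some _, _, _, none, _, _, _ => rfl
    | none, _, _, some _, _, _, _ => rfl
    | some _, none, none, some _, _, _, _ => rfl
    | some a, none, some c, some d, ρ, _, _ => (map_zero ((C.comp a c d).app V h ρ)).symm
    | some a, some b, none, some d, _, _, σ => LinearMap.map_zero₂ ((C.comp a b d).app V h) σ
    | none, some _, some _, none, _, _, _ => rfl
    | none, some _, none, none, ρ, _, _ => (mul_zero (M₀ := A.Fn V) ρ).symm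
    | none, none, some _, none, _, _, σ => zero_mul (M₀ := A.Fn V) σ

variable {C : A.EnrCat.{u, w} U} {S : A.FMan} {g : S.Metric} (c : C.CardyStr g) {n : ℕ}
  {ε : Fin n → A.VField U} (hε : S.IsIdempotentFrame ε) (i : Fin n) (l m : A.Fn U)

/-- The linear forms after adjoining an isolated object: the one of the new object is
multiplication by `l`. -/
def isolatedTr : ∀ a : Option C.Obj, (C.isolatedΓ a a).Hom (A.str U)
  | some a => c.tr a
  | none =>
    { app := fun V h => LinearMap.mulLeft (A.Fn V) (A.res h l)
      nat := fun hV h f => map_mul (A.res h) (A.res hV l) (show A.Fn _ from f) }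

/-- The maps `ι_a` after adjoining an isolated object: for the new object, the coefficient of
`ε i`. -/
noncomputable def isolatedIota : ∀ a : Option C.Obj, (A.tangent U).Hom (C.isolatedΓ a a)
  | some a => c.iota a
  | none =>
    { app := fun V h => hε.coeff i h
      nat := fun hV h Y => hε.res_coeff i hV h Y }

/-- The maps `ι^a` after adjoining an isolated object: `f ↦ f m ε_i` for the new object, where
`m` is the inverse of `l`. -/
def isolatedIotaUp (ε : Fin n → A.VField U) : ∀ a : Option C.Obj,
    (C.isolatedΓ a a).Hom (A.tangent U)
  | some a => c.iotaUp a
  | none =>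
    { app := fun V h => LinearMap.toSpanSingleton (A.Fn V) (A.VField V)
        (A.res h m • VField.res h (ε i))
      nat := fun hV h f => by
        refine ((A.tangent U).res_smul hV h (show A.Fn _ from f) _).trans (congrArg _ ?_)
        exact (A.tangent U).res_smul hV h (A.res hV m) _ }

/-- The pairing `(τ, σ) ↦ l τ σ` on `𝒪` is perfect if `l` is invertible. -/
theorem str_perfect {l m : A.Fn U} (hm : m * l = 1) (V : Opens X) (hV : V ≤ U)
    (φ : ((A.str U).restrict hV).Hom (A.str V)) :
    ∃! σ : A.Fn V, ∀ (V' : Opens X) (h : V' ≤ V) (τ : A.Fn V'),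
      φ.app V' h τ = A.res (h.trans hV) l * (τ * A.res h σ) := by
  have h1 : ∀ {V' : Opens X} (h : V' ≤ U), A.res h m * A.res h l = 1 := fun h => by
    rw [← map_mul, hm, map_one]
  let φ1 : A.Fn V := φ.app V le_rfl (1 : A.Fn V)
  have hφ : ∀ (V' : Opens X) (h : V' ≤ V) (τ : A.Fn V'), φ.app V' h τ = τ * A.res h φ1 := by
    intro V' h τ
    have h2 : A.res h φ1 = φ.app V' h (A.res h (1 : A.Fn V)) := φ.nat le_rfl h _
    rw [map_one] at h2
    have h3 : φ.app V' h (τ • (1 : A.Fn V')) = τ • φ.app V' h (1 : A.Fn V') :=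
      (φ.app V' h).map_smul τ _
    rw [smul_eq_mul, mul_one] at h3
    rw [h2]
    exact h3
  refine ⟨A.res hV m * φ1, fun V' h τ => ?_, fun σ hσ => ?_⟩
  · rw [hφ, map_mul, res_res, mul_left_comm τ, ← mul_assoc, mul_comm (A.res _ l), h1, one_mul]
  · have h2 := hσ V le_rfl 1
    rw [hφ, one_mul, one_mul, res_self, res_self] at h2
    rw [h2, ← mul_assoc, h1, one_mul]

variable {l m}

/-- For the pairing `(τ, σ) ↦ l τ σ` on `𝒪`, the Casimir map is multiplication by `l⁻¹`. -/
theorem isolated_cardy_none (hm : m * l = 1) {V : Opens X} (h : V ≤ U) {r : ℕ}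
    (s t : Fin r → A.Fn V) (hs : (A.str U).IsFrame h s)
    (dual : ∀ i j, A.res h l * (t j * s i) = if i = j then 1 else 0) (f : A.Fn V) :
    ∑ k, s k * f * t k = f * A.res h m := by
  obtain ⟨x, hx⟩ := (hs V le_rfl).surjective (1 : A.Fn V)
  have hx' : ∑ k, x k * s k = 1 := hx
  have h1 : ∀ j, A.res h l * t j = x j := fun j => by
    rw [← mul_one (A.res h l * t j), ← hx', Finset.mul_sum]
    have : ∀ k, A.res h l * t j * (x k * s k) = x k * if k = j then 1 else 0 := fun k => by
      rw [← dual]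
      ring
    simp [this]
  have h2 : A.res h m * A.res h l = 1 := by rw [← map_mul, hm, map_one]
  have h3 : ∀ j, t j = A.res h m * x j := fun j => by rw [← h1, ← mul_assoc, h2, one_mul]
  calc ∑ k, s k * f * t k = f * A.res h m * ∑ k, x k * s k := by
        rw [Finset.mul_sum]
        exact Finset.sum_congr rfl fun k _ => by rw [h3]; ring
    _ = _ := by rw [hx', mul_one]

/-- If `l² = θ(ε_i)` and all `ι_a(ε_i)` vanish, an isolated object with `ι(ε_i) = 1` can be adjoined
to a Cardy category. -/
noncomputable def isolatedCardyStr (hA : A.IsLocal) (hl : l * l = g.θ U (ε i)) (hm : m * l = 1)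
    (H : ∀ a, c.iotaSec a le_rfl (ε i) = 0) : C.isolated.CardyStr g :=
  have H' : ∀ a {V : Opens X} (h : V ≤ U), c.iotaSec a h (VField.res h (ε i)) = 0 :=
    fun a V h => by rw [← c.res_iotaSec a le_rfl h, H, map_zero]
  { isSheaf := fun a b => match a, b with
      | some a, some b => c.isSheaf a b
      | none, none => Mod.str_isSheaf hA U
      | some _, none => Mod.zero_isSheaf U
      | none, some _ => Mod.zero_isSheaf U
    locallyFree := fun a b => match a, b with
      | some a, some b => c.locallyFree a b
      | none, none => Mod.str_locallyFree U
      | some _, none => Mod.zero_locallyFree U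
      | none, some _ => Mod.zero_locallyFree U
    tr := isolatedTr c l
    tr_comm := fun a b V h σ τ => match a, b, σ, τ with
      | some a, some b, σ, τ => c.tr_comm a b V h σ τ
      | none, none, σ, τ => congrArg (A.res h l * ·) (mul_comm (G := A.Fn V) τ σ)
      | some a, none, σ, τ => ((c.tr a).app V h).map_zero.trans (mul_zero (A.res h l)).symm
      | none, some b, σ, τ => (mul_zero (A.res h l)).trans ((c.tr b).app V h).map_zero.symm
    perfect := fun a b V hV φ => match a, b, φ with
      | some a, some b, φ => c.perfect a b V hV φ
      | none, none, φ => str_perfect hm V hV φ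
      | some a, none, φ => ⟨PUnit.unit, fun V' h τ =>
          (φ.app V' h).map_zero.trans ((c.tr a).app V' _).map_zero.symm, fun _ _ => rfl⟩
      | none, some b, φ => ⟨PUnit.unit, fun V' h τ =>
          (φ.app V' h).map_zero.trans (mul_zero (A.res _ l)).symm, fun _ _ => rfl⟩
    iota := isolatedIota c hε i
    iota_one := fun a V h => match a with
      | some a => c.iota_one a V h
      | none => hε.coeff_one i h
    iota_mul := fun a V h Y Z => match a with
      | some a => c.iota_mul a V h Y Z
      | none => hε.coeff_mul i h Y Z
    iotaUp := isolatedIotaUp c i m ε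
    central := fun a b V h Y σ => match a, b, σ with
      | some a, some b, σ => c.central a b V h Y σ
      | none, none, σ => mul_comm (G := A.Fn V) σ _
      | some _, none, _ => rfl
      | none, some _, _ => rfl
    adjoint := fun a V h Y σ => match a, σ with
      | some a, σ => c.adjoint a V h Y σ
      | none, σ => by
        change g.θ V (S.mul V ((show A.Fn V from σ) • A.res h m • VField.res h (ε i)) Y) =
          A.res h l * ((show A.Fn V from σ) * hε.coeff i h Y)
        have h2 : A.res h m * A.res h l = 1 := by rw [← map_mul, hm, map_one]
        rw [map_smul, map_smul, LinearMap.smul_apply, LinearMap.smul_apply, hε.ε_mul, FMan.Metric.θ,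
          map_smul, map_smul, map_smul]
        change (show A.Fn V from σ) *
          (A.res h m * (hε.coeff i h Y * g.θ V (VField.res h (ε i)))) = _
        rw [← g.θ_res, ← hl, map_mul]
        linear_combination ((show A.Fn V from σ) * hε.coeff i h Y * A.res h l) * h2
    cardy := fun a b V h r s t hs ht dual σ => match a, b, s, t, hs, ht, dual, σ with
      | some a, some b, s, t, hs, ht, dual, σ => c.cardy a b V h r s t hs ht dual σ
      | none, none, s, t, hs, ht, dual, σ =>
        (isolated_cardy_none hm h s t hs dual σ).trans (by
          change _ = hε.coeff i h ((show A.Fn V from σ) • A.res h m • VField.res h (ε i))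
          rw [smul_smul, hε.coeff_smul_ε])
      | some a, none, s, t, hs, ht, dual, σ => by
        obtain ⟨f, hf, hfk⟩ := c.exists_iotaUp_eq (hε.restrict h) h a σ
        have h1 := hfk i
        rw [H' a h, map_zero, map_zero] at h1
        have h2 : f i = 0 := ((hε.restrict h).isUnit_θ g i).mul_left_eq_zero.1 h1
        have h3 : (0 : A.Fn V) = hε.coeff i h (c.iotaUpSec h σ) := by
          rw [hf, hε.coeff_sum, h2]
        refine Eq.trans ?_ h3
        exact Finset.sum_eq_zero fun k _ => rfl
      | none, some b, s, t, hs, ht, dual, σ => by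
        have h3 : 0 = c.iotaSec b h
            ((show A.Fn V from σ) • A.res h m • VField.res h (ε i)) := by
          rw [map_smul, map_smul, H' b h, smul_zero, smul_zero]
        refine Eq.trans ?_ h3
        exact Finset.sum_eq_zero fun k _ => rfl }

/-- The embedding of a Cardy category into the one with an isolated object adjoined. -/
noncomputable def isolatedEmbedding (hA : A.IsLocal) (hl : l * l = g.θ U (ε i)) (hm : m * l = 1)
    (H : ∀ a, c.iotaSec a le_rfl (ε i) = 0) :
    Embedding c (isolatedCardyStr c hε i hA hl hm H) where
  obj := some
  map a b := { app := fun _ _ => LinearMap.id, nat := fun _ _ _ => rfl }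
  bij _ _ _ _ := Function.bijective_id
  map_one _ _ _ := rfl
  map_comp _ _ _ _ _ _ _ := rfl
  map_tr _ _ _ _ := rfl
  map_iota _ _ _ _ := rfl
  map_iotaUp _ _ _ _ := rfl

end EnrCat
end FunAlg

/-! ### Frobenius algebras with a central Casimir map -/

/-- A finite dimensional algebra with a nondegenerate linear form `θ` and orthogonal central
idempotents `e j` of sum `1` is semisimple as soon as its Casimir map `z ↦ ∑ s_k z t_k` is
`z ↦ ∑ c_j θ(z e_j) e_j` with `c_j ≠ 0`: for `z` in the radical, which is nilpotent, all
`θ(z e_j)` vanish. -/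
theorem isSemisimpleRing_of_casimir {R : Type*} [Ring R] [Algebra ℂ R] [FiniteDimensional ℂ R]
    (θ : R →ₗ[ℂ] ℂ) (hθ : ∀ z, (∀ w, θ (z * w) = 0) → z = 0) {n r : ℕ} (e : Fin n → R)
    (he : ∀ i j, e i * e j = if i = j then e i else 0) (hsum : ∑ j, e j = 1) (s t : Fin r → R)
    (c : Fin n → ℂ) (hc : ∀ j, c j ≠ 0)
    (cas : ∀ z, ∑ k, s k * z * t k = ∑ j, (c j * θ (z * e j)) • e j) : IsSemisimpleRing R := by
  have : IsArtinianRing R := IsArtinianRing.of_finite ℂ R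
  rw [IsArtinianRing.isSemisimpleRing_iff_jacobson, eq_bot_iff]
  obtain ⟨N, hN⟩ := IsSemiprimaryRing.isNilpotent (R := R)
  have key : ∀ z ∈ Ring.jacobson R, θ z = 0 := by
    intro z hz
    -- otherwise the radical contains `e j`, which would be a nilpotent idempotent
    have h1 : ∀ j, θ (z * e j) = 0 := by
      intro j
      by_contra hj
      have h2 : (∑ k, s k * z * t k) * e j ∈ Ring.jacobson R :=
        Ideal.mul_mem_right _ _ (Ideal.sum_mem _ fun k _ =>
          Ideal.mul_mem_right _ _ (Ideal.mul_mem_left _ _ hz))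
      have h3 : (∑ k, s k * z * t k) * e j = (c j * θ (z * e j)) • e j := by
        rw [cas, Finset.sum_mul]
        simp [he]
      rw [h3] at h2
      have h4 : e j ∈ Ring.jacobson R := by
        have := (Ring.jacobson R).smul_of_tower_mem (c j * θ (z * e j))⁻¹ h2
        rwa [smul_smul, inv_mul_cancel₀ (mul_ne_zero (hc j) hj), one_smul] at this
      have h5 : ∀ m : ℕ, e j ∈ Ring.jacobson R ^ m := by
        intro m
        induction m with
        | zero =>
          rw [Submodule.pow_zero, Ideal.one_eq_top]
          exact Submodule.mem_top
        | succ m ih =>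
          have := Ideal.mul_mem_mul h4 ih
          rwa [he, if_pos rfl, ← Ideal.IsTwoSided.pow_succ] at this
      have h6 : e j = 0 := by
        have := h5 N
        rwa [hN] at this
      exact hj (by rw [h6, mul_zero, map_zero])
    rw [← mul_one z, ← hsum, Finset.mul_sum, map_sum]
    exact Finset.sum_eq_zero fun j _ => h1 j
  intro z hz
  exact hθ z fun w => key _ (Ideal.mul_mem_right _ _ hz)

/-- In a finite dimensional semisimple complex algebra, every nonzero central idempotent `e`
dominates an idempotent `p` of rank one, that is, with `p R p = ℂ p`. -/
theorem exists_rankOne_of_isSemisimpleRing {R : Type*} [Ring R] [Algebra ℂ R]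
    [FiniteDimensional ℂ R] [IsSemisimpleRing R] (e : R) (he : e * e = e) (he0 : e ≠ 0)
    (hcen : ∀ z, e * z = z * e) :
    ∃ (p : R) (l : R →ₗ[ℂ] ℂ), p * p = p ∧ p * e = p ∧ l p = 1 ∧ ∀ z, p * z * p = l z • p := by
  obtain ⟨n, d, hd, ⟨φ⟩⟩ := IsSemisimpleRing.exists_algEquiv_pi_matrix_of_isAlgClosed ℂ R
  obtain ⟨k, hk⟩ : ∃ k, φ e k ≠ 0 := by
    by_contra! h
    exact he0 (φ.injective ((funext h).trans (map_zero φ).symm))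
  have hek : φ e k = 1 := by
    -- the component of `e` is central, hence scalar
    have h1 : ∀ M : Matrix (Fin (d k)) (Fin (d k)) ℂ, φ e k * M = M * φ e k := fun M => by
      have := congrArg (fun z => φ z k) (hcen (φ.symm (Pi.single k M)))
      simpa using this
    obtain ⟨α, hα⟩ := Matrix.mem_range_scalar_iff_commute_single'.2
      fun i j => (h1 (Matrix.single i j 1)).symm
    have h2 : φ e k * φ e k = φ e k := by
      have := congrArg (fun z => φ z k) he
      simpa using this
    rw [← hα] at h2 hk ⊢
    have h3 : α * α = α := by
      rw [← map_mul] at h2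
      exact Matrix.scalar_inj.1 h2
    have h4 : α ≠ 0 := fun h => hk (by rw [h, map_zero])
    rw [mul_right_cancel₀ h4 (h3.trans (one_mul α).symm), map_one]
  let P : Matrix (Fin (d k)) (Fin (d k)) ℂ := Matrix.single 0 0 1
  have hP : ∀ M : Matrix (Fin (d k)) (Fin (d k)) ℂ, P * M * P = M 0 0 • P := fun M => by
    simp [P, Matrix.single_mul_mul_single]
  have hPP : P * P = P := by simp [P]
  refine ⟨φ.symm (Pi.single k P),
    { toFun := fun z => φ z k 0 0
      map_add' := fun _ _ => by simp
      map_smul' := fun _ _ => by simp }, ?_, ?_, ?_, fun z => ?_⟩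
  · rw [← map_mul, ← Pi.single_mul, hPP]
  · apply φ.injective
    rw [map_mul, φ.apply_symm_apply]
    funext j
    rcases eq_or_ne j k with rfl | hj
    · simp [hek]
    · simp [hj]
  · simp [P]
  · apply φ.injective
    simp only [map_mul, map_smul, φ.apply_symm_apply, LinearMap.coe_mk, AddHom.coe_mk]
    funext j
    rcases eq_or_ne j k with rfl | hj
    · simp [hP]
    · simp [hj]

/-- The fibre, at a point of the spectrum of `K` given by a surjection `K → ℂ`, of an algebra `R`
over `K` with a perfect pairing and a Casimir map with values in the span of the central idempotents
`e j` contains an idempotent of rank one below every `e i` which does not vanish there.  It is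
the value of some `σ` in `R`; values of elements are expressed through coordinates. -/
theorem exists_rankOne_of_casimir {K R : Type*} [CommRing K] [Algebra K ℂ] [Ring R]
    [Algebra K R] (hK : Function.Surjective (algebraMap K ℂ)) {n r : ℕ}
    (b : Module.Basis (Fin r) K R) (t : Fin r → R) (θ : R →ₗ[K] K)
    (hθ : ∀ z w, θ (z * w) = θ (w * z)) (hb : ∀ z, ∑ k, θ (t k * z) • b k = z) (e : Fin n → R)
    (he : ∀ i j, e i * e j = if i = j then e i else 0) (hsum : ∑ j, e j = 1)
    (hcen : ∀ j z, e j * z = z * e j) (u : Fin n → K) (hu : ∀ j, IsUnit (u j))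
    (cas : ∀ z, ∃ f : Fin n → K, ∑ k, b k * z * t k = ∑ j, f j • e j ∧
      ∀ j, f j * u j = θ (z * e j))
    (i : Fin n) (hi : ∃ k, algebraMap K ℂ (b.repr (e i) k) ≠ 0) :
    ∃ (σ : R) (l : Fin r → ℂ), σ * e i = σ ∧
      (∑ k, l k * algebraMap K ℂ (b.repr σ k) = 1) ∧
      (∀ j k, algebraMap K ℂ (b.repr (σ * b k * σ) j) = algebraMap K ℂ (b.repr σ j) * l k) ∧
      ∀ j, algebraMap K ℂ (b.repr (σ * σ) j) = algebraMap K ℂ (b.repr σ j) := by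
  let b' : Module.Basis (Fin r) ℂ (ℂ ⊗[K] R) := b.baseChange ℂ
  have hrepr : ∀ z k, b'.repr ((1 : ℂ) ⊗ₜ[K] z) k = algebraMap K ℂ (b.repr z k) := fun z k => by
    rw [Module.Basis.baseChange_repr_tmul, Algebra.smul_def, mul_one]
  have : FiniteDimensional ℂ (ℂ ⊗[K] R) := Module.Finite.of_basis b'
  let θ' : ℂ ⊗[K] R →ₗ[ℂ] ℂ := (TensorProduct.AlgebraTensorModule.rid K ℂ ℂ).toLinearMap ∘ₗ
    θ.baseChange ℂ
  have hθ' : ∀ (z : ℂ) w, θ' (z ⊗ₜ[K] w) = algebraMap K ℂ (θ w) * z := fun z w => by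
    simp [θ', Algebra.smul_def]
  let e' : Fin n → ℂ ⊗[K] R := fun j => 1 ⊗ₜ[K] e j
  have hb' : ∀ z : ℂ ⊗[K] R, ∑ k, θ' ((1 : ℂ) ⊗ₜ[K] t k * z) • b' k = z := by
    intro z
    induction z with
    | zero => simp
    | tmul x w =>
      conv_rhs => rw [← hb w, TensorProduct.tmul_sum]
      refine Finset.sum_congr rfl fun k _ => ?_
      rw [Algebra.TensorProduct.tmul_mul_tmul, one_mul, hθ', Module.Basis.baseChange_apply,
        TensorProduct.smul_tmul', ← TensorProduct.smul_tmul, smul_eq_mul, mul_one,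
        Algebra.smul_def]
    | add z w hz hw =>
      conv_rhs => rw [← hz, ← hw]
      simp only [mul_add, map_add, add_smul, Finset.sum_add_distrib]
  have hcomm' : ∀ z w, θ' (z * w) = θ' (w * z) := by
    intro z w
    induction z with
    | zero => simp
    | add z z' hz hz' => rw [add_mul, mul_add, map_add, map_add, hz, hz']
    | tmul x y =>
      induction w with
      | zero => simp
      | add z z' hz hz' => rw [add_mul, mul_add, map_add, map_add, hz, hz']
      | tmul x' y' =>
        rw [Algebra.TensorProduct.tmul_mul_tmul, Algebra.TensorProduct.tmul_mul_tmul, hθ', hθ',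
          hθ y, mul_comm x]
  -- `ℂ ⊗[K] R` is the fibre of `R`
  have hss : IsSemisimpleRing (ℂ ⊗[K] R) := by
    refine isSemisimpleRing_of_casimir θ' (fun z hz => ?_) e' (fun j k => ?_) ?_ b'
      (fun k => 1 ⊗ₜ[K] t k) (fun j => (algebraMap K ℂ (u j))⁻¹)
      (fun j => inv_ne_zero ((hu j).map (algebraMap K ℂ)).ne_zero) fun z => ?_
    · rw [← hb' z]
      refine Finset.sum_eq_zero fun k _ => ?_
      rw [hcomm', hz, zero_smul]
    · simp only [e', Algebra.TensorProduct.tmul_mul_tmul, he, one_mul]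
      split_ifs
      · rfl
      · rw [TensorProduct.tmul_zero]
    · rw [← TensorProduct.tmul_sum, hsum]
      rfl
    · induction z with
      | zero => simp
      | add z w hz hw =>
        simp only [mul_add, add_mul, Finset.sum_add_distrib, hz, hw, map_add, add_smul]
      | tmul x w =>
        obtain ⟨f, hf, hfu⟩ := cas w
        have h1 : ∀ k, b' k * x ⊗ₜ[K] w * (1 : ℂ) ⊗ₜ[K] t k = x ⊗ₜ[K] (b k * w * t k) :=
          fun k => by
          rw [Module.Basis.baseChange_apply, Algebra.TensorProduct.tmul_mul_tmul,
            Algebra.TensorProduct.tmul_mul_tmul, one_mul, mul_one]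
        simp only [h1]
        rw [← TensorProduct.tmul_sum, hf, TensorProduct.tmul_sum]
        refine Finset.sum_congr rfl fun j _ => ?_
        have h2 : algebraMap K ℂ (u j) ≠ 0 := ((hu j).map (algebraMap K ℂ)).ne_zero
        simp only [e', Algebra.TensorProduct.tmul_mul_tmul, mul_one]
        rw [hθ', ← hfu, map_mul, TensorProduct.smul_tmul', ← TensorProduct.smul_tmul,
          Algebra.smul_def, smul_eq_mul, mul_one]
        congr 1
        field_simp
  obtain ⟨k₀, hk₀⟩ := hi
  obtain ⟨p, l, hpp, hpe, hlp, hp⟩ := exists_rankOne_of_isSemisimpleRing (e' i)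
    (by simp [e', he]) (fun h => hk₀ (by rw [← hrepr]; change b'.repr (e' i) k₀ = 0; simp [h]))
    (fun z => by
      induction z with
      | zero => simp
      | add z w hz hw => rw [mul_add, add_mul, hz, hw]
      | tmul x w => simp [e', hcen])
  obtain ⟨σ₀, hσ₀⟩ : ∃ σ₀ : R, (1 : ℂ) ⊗ₜ[K] σ₀ = p := by
    choose v hv using fun k => hK (b'.repr p k)
    refine ⟨∑ k, v k • b k, b'.ext_elem fun k => ?_⟩
    rw [hrepr, b.repr_sum_self, hv]
  have hσ : (1 : ℂ) ⊗ₜ[K] (σ₀ * e i) = p := by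
    rw [← hpe, ← hσ₀, Algebra.TensorProduct.tmul_mul_tmul, one_mul]
  refine ⟨σ₀ * e i, fun k => l (b' k), ?_, ?_, fun j k => ?_, fun j => ?_⟩
  · rw [mul_assoc, he, if_pos rfl]
  · have h1 : ∀ k, algebraMap K ℂ (b.repr (σ₀ * e i) k) = b'.repr p k := fun k => by
      rw [← hrepr, hσ]
    simp only [h1]
    rw [← hlp]
    conv_rhs => rw [← b'.sum_repr p, map_sum]
    exact Finset.sum_congr rfl fun k _ => by rw [map_smul, smul_eq_mul, mul_comm]
  · have h1 : (1 : ℂ) ⊗ₜ[K] (σ₀ * e i * b k * (σ₀ * e i)) = p * b' k * p := by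
      rw [← hσ, Module.Basis.baseChange_apply, Algebra.TensorProduct.tmul_mul_tmul,
        Algebra.TensorProduct.tmul_mul_tmul, one_mul, one_mul]
    rw [← hrepr, ← hrepr, h1, hσ, hp, map_smul, Finsupp.smul_apply, smul_eq_mul, mul_comm]
  · have h1 : (1 : ℂ) ⊗ₜ[K] (σ₀ * e i * (σ₀ * e i)) = p * p := by
      rw [← hσ, Algebra.TensorProduct.tmul_mul_tmul, one_mul]
    rw [← hrepr, ← hrepr, h1, hσ, hpp]

/-! ### Idempotents in the sheaves `Γ_aa` -/

/-- If `q` spans the eigenspace of `w ↦ σ w σ` for a unit eigenvalue, then `q` spans `q R q`, and it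
absorbs whatever idempotent `σ` absorbs. -/
theorem exists_mul_mul_eq_smul_of_eigenvector {K R : Type*} [CommRing K] [Ring R] [Algebra K R]
    {σ q : R} {c : K} (hc : IsUnit c) (hq : σ * q * σ = c • q)
    (H : ∀ w, σ * w * σ = c • w → ∃ b : K, w = b • q) :
    (∀ z, ∃ b : K, q * z * q = b • q) ∧ ∀ e, σ * e = σ → q * e = q := by
  obtain ⟨κ, hκ⟩ := H (σ * q) (by
    calc σ * (σ * q) * σ = σ * (σ * q * σ) := by noncomm_ring
      _ = _ := by rw [hq, mul_smul_comm])
  obtain ⟨κ', hκ'⟩ := H (q * σ) (by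
    calc σ * (q * σ) * σ = σ * q * σ * σ := by noncomm_ring
      _ = _ := by rw [hq, smul_mul_assoc])
  have h1 : (κ * κ') • q = c • q := by
    rw [← hq, hκ, smul_mul_assoc, hκ', smul_smul]
  refine ⟨fun z => H _ ?_, fun e he => ?_⟩
  · calc σ * (q * z * q) * σ = σ * q * z * (q * σ) := by noncomm_ring
      _ = (κ * κ') • q * z * q := by
        rw [hκ, hκ', mul_smul_comm, smul_mul_assoc, smul_mul_assoc, smul_mul_assoc,
          smul_mul_assoc, smul_smul, mul_comm κ']
      _ = _ := by rw [h1, smul_mul_assoc, smul_mul_assoc]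
  · refine hc.smul_left_cancel.1 ?_
    rw [← smul_mul_assoc, ← hq, mul_assoc, he]

/-- The values of the coordinates of a product depend only on those of the factors. -/
theorem Module.Basis.map_repr_mul {K R F : Type*} [CommRing K] [Ring R] [Algebra K R] [CommRing F]
    {r : ℕ} (b : Module.Basis (Fin r) K R) (φ : K →+* F) (z w : R) (j : Fin r) :
    φ (b.repr (z * w) j) =
      ∑ k, ∑ l, φ (b.repr z k) * φ (b.repr w l) * φ (b.repr (b k * b l) j) := by
  conv_lhs => rw [← b.sum_repr z, ← b.sum_repr w, Finset.sum_mul_sum]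
  simp only [map_sum, Finsupp.finsetSum_apply, smul_mul_smul_comm, map_smul, Finsupp.smul_apply,
    smul_eq_mul, map_mul]

namespace FunAlg

variable {X : Type u} [TopologicalSpace X] {A : FunAlg X}

/-- The basis of the sections over a smaller open set given by a frame. -/
noncomputable def Mod.IsFrame.basis {W : Opens X} {E : A.Mod W} {V : Opens X} {hV : V ≤ W} {r : ℕ}
    {s : Fin r → E.sec V hV} (hs : E.IsFrame hV s) {V' : Opens X} (h : V' ≤ V) :
    Module.Basis (Fin r) (A.Fn V') (E.sec V' (h.trans hV)) :=
  Module.Basis.ofEquivFun (hs.coord h)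

namespace EnrCat

variable {U : Opens X} (C : A.EnrCat.{u, w} U)

/-- Composition of sections over an open set `V`, where `h : V ≤ U`. -/
local notation:75 τ:76 " ∘[" h "] " σ:75 => Mod.Pairing.app (EnrCat.comp _ _ _ _) _ h τ σ

/-- The algebra of endomorphisms of an object over an open set `V`. -/
def EndSec (a : C.Obj) {V : Opens X} (h : V ≤ U) : Type u := (C.Γ a a).sec V h

namespace EndSec

variable (a : C.Obj) {V : Opens X} (h : V ≤ U)

instance : AddCommGroup (C.EndSec a h) := inferInstanceAs (AddCommGroup ((C.Γ a a).sec V h))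

instance : Module (A.Fn V) (C.EndSec a h) := inferInstanceAs (Module (A.Fn V) ((C.Γ a a).sec V h))

instance : Ring (C.EndSec a h) where
  __ := (inferInstance : AddCommGroup (C.EndSec a h))
  mul τ σ := (C.comp a a a).app V h τ σ
  one := C.one a V h
  left_distrib τ σ σ' := map_add ((C.comp a a a).app V h τ) σ σ'
  right_distrib τ τ' σ := LinearMap.map_add₂ ((C.comp a a a).app V h) τ τ' σ
  zero_mul σ := LinearMap.map_zero₂ ((C.comp a a a).app V h) σ
  mul_zero τ := map_zero ((C.comp a a a).app V h τ)
  mul_assoc ρ τ σ := C.assoc a a a a V h ρ τ σ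
  one_mul σ := C.one_comp a a V h σ
  mul_one σ := C.comp_one a a V h σ

instance : Algebra (A.Fn V) (C.EndSec a h) :=
  Algebra.ofModule (fun f τ σ => LinearMap.map_smul₂ ((C.comp a a a).app V h) f τ σ)
    fun f τ σ => map_smul ((C.comp a a a).app V h τ) f σ

variable {C a}

/-- Restriction of endomorphisms. -/
def res {V' : Opens X} (hV : V ≤ U) (h : V' ≤ V) : C.EndSec a hV →+* C.EndSec a (h.trans hV) where
  toFun := (C.Γ a a).res hV h
  map_one' := C.one_res a hV h
  map_mul' := C.res_comp hV h
  map_zero' := map_zero ((C.Γ a a).res hV h)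
  map_add' := map_add ((C.Γ a a).res hV h)

theorem res_smul {V' : Opens X} (hV : V ≤ U) (h : V' ≤ V) (f : A.Fn V) (z : C.EndSec a hV) :
    res hV h (f • z) = A.res h f • res hV h z :=
  (C.Γ a a).res_smul hV h f z

theorem res_res {V' V'' : Opens X} (hV : V ≤ U) (h : V' ≤ V) (h' : V'' ≤ V')
    (z : C.EndSec a hV) : res (h.trans hV) h' (res hV h z) = res hV (h'.trans h) z :=
  (C.Γ a a).res_res hV h h' z

end EndSec

namespace CardyStr

variable {C} {S : A.FMan} {g : S.Metric} {n : ℕ}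

/-- If `ι_a(ε i)` does not vanish at a point `x`, then it dominates, in a neighbourhood of `x`, an
idempotent `p` with `p Γ_aa p = 𝒪 p`: the fibre of `Γ_aa` at `x` contains an idempotent of rank one,
the value of some `σ`, and `p` is a multiple of the eigenvector of `z ↦ σ z σ` which extends it. -/
theorem exists_rankOne_idempotent (c : C.CardyStr g) (hA : A.IsLocal) {ε : Fin n → A.VField U}
    (hε : S.IsIdempotentFrame ε) (a : C.Obj) (i : Fin n) {x : X} (hxU : x ∈ U)
    (hi : ∀ (V : Opens X) (hV : V ≤ U) (hx : x ∈ V) (r : ℕ) (s : Fin r → (C.Γ a a).sec V hV)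
      (hs : (C.Γ a a).IsFrame hV s),
      ∃ k, ev hx (hs.coord le_rfl (c.iotaSec a hV (VField.res hV (ε i))) k) ≠ 0) :
    ∃ (V : Opens X) (hV : V ≤ U), x ∈ V ∧ ∃ p : (C.Γ a a).sec V hV, p ∘[hV] p = p ∧
      p ∘[hV] c.iotaSec a hV (VField.res hV (ε i)) = p ∧
      ∀ (V' : Opens X) (h : V' ≤ V) (z : (C.Γ a a).sec V' (h.trans hV)),
        ∃! f : A.Fn V', ((C.Γ a a).res hV h p ∘[h.trans hV] z) ∘[h.trans hV] (C.Γ a a).res hV h p =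
          f • (C.Γ a a).res hV h p := by
  obtain ⟨V₀, hV₀, hx₀, r, s, t, d⟩ := c.exists_dualFrames a a hxU
  have hε₀ := hε.restrict hV₀
  let R₀ := C.EndSec a hV₀
  let b₀ : Module.Basis (Fin r) (A.Fn V₀) R₀ := d.left.basis le_rfl
  let s₀ : Fin r → R₀ := s
  have hb₀ : ∀ k, b₀ k = s₀ k := fun k => by
    refine b₀.repr.injective ((b₀.repr_self k).trans (Finsupp.ext fun j => ?_))
    have h1 := congrFun (d.left.coord_self le_rfl k) j
    rw [Mod.res_id] at h1
    refine Eq.trans ?_ h1.symm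
    rw [Finsupp.single_apply, Pi.single_apply]
    simp only [eq_comm]
  let e₀ : Fin n → R₀ := fun j => c.iotaSec a hV₀ (VField.res hV₀ (ε j))
  let : Algebra (A.Fn V₀) ℂ := (ev hx₀).toRingHom.toAlgebra
  obtain ⟨σ, l, hσe, hl, hK, hσσ⟩ := exists_rankOne_of_casimir (K := A.Fn V₀) (R := R₀)
    (fun z => ⟨algebraMap ℂ (A.Fn V₀) z, (ev hx₀).commutes z⟩) b₀ t (c.trace hV₀)
    (fun z w => c.trace_comm hV₀ w z)
    (fun z => by
      simp only [hb₀]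
      exact d.sum_left z) e₀
    (fun j k => c.iotaSec_comp hε₀ hV₀ a j k) (c.sum_iotaSec hε₀ hV₀ a)
    (fun j z => (c.comp_iotaSec hV₀ _ z).symm) (fun j => g.θ V₀ (VField.res hV₀ (ε j)))
    (fun j => hε₀.isUnit_θ g j)
    (fun z => by
      obtain ⟨f, hf, hfu⟩ := c.exists_iotaUp_eq hε₀ hV₀ a z
      refine ⟨f, ?_, hfu⟩
      simp only [hb₀]
      refine (d.cardy z).trans ?_
      rw [hf, map_sum]
      exact Finset.sum_congr rfl fun j _ => map_smul _ _ _) i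
    (by
      obtain ⟨k, hk⟩ := hi V₀ hV₀ hx₀ r s d.left
      exact ⟨k, hk⟩)
  -- the matrix of `w ↦ σ w σ`
  have key : ∀ {V' : Opens X} (h : V' ≤ V₀) (w : Fin r → A.Fn V'),
      (d.left.coord h) ((EndSec.res hV₀ h σ * (∑ k, w k • EndSec.res hV₀ h (s₀ k) :
        C.EndSec a (h.trans hV₀)) * EndSec.res hV₀ h σ : C.EndSec a (h.trans hV₀))) =
      ((Matrix.of fun j k => b₀.repr (σ * b₀ k * σ) j).map (A.res h)).mulVec w := by
    intro V' h w
    rw [Finset.mul_sum, Finset.sum_mul]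
    refine (map_sum (d.left.coord h) _ _).trans (funext fun j => ?_)
    rw [Finset.sum_apply]
    refine Finset.sum_congr rfl fun k _ => ?_
    rw [mul_smul_comm, smul_mul_assoc, ← map_mul, ← map_mul]
    refine (congrFun (map_smul (d.left.coord h) _ _) j).trans ((mul_comm _ _).trans ?_)
    refine congrArg (· * w k) ?_
    refine (d.left.coord_res le_rfl h _ j).trans ?_
    simp only [hb₀]
    rfl
  obtain ⟨V, h, hxV, v, cc, hcc, hv, hKv, hKer⟩ := IsLocal.exists_eigenvector hA hx₀
    (Matrix.of fun j k => b₀.repr (σ * b₀ k * σ) j) (fun j => ev hx₀ (b₀.repr σ j)) l hl hK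
  let q : C.EndSec a (h.trans hV₀) := ∑ k, v k • EndSec.res hV₀ h (s₀ k)
  have hq' : ∀ {V' : Opens X} (h' : V' ≤ V), EndSec.res (h.trans hV₀) h' q =
      ∑ k, A.res h' (v k) • EndSec.res hV₀ (h'.trans h) (s₀ k) := fun h' => by
    simp only [q, map_sum, EndSec.res_smul, EndSec.res_res]
  have hcoord : ∀ {V' : Opens X} (h' : V' ≤ V) (k : Fin r), d.left.coord (h'.trans h)
      (EndSec.res (h.trans hV₀) h' q) k = A.res h' (v k) := fun h' k => by
    rw [hq']
    exact congrFun (d.left.coord_sum (h'.trans h) _) k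
  have hcoord₀ : ∀ k, d.left.coord h q k = v k := congrFun (d.left.coord_sum h v)
  have hKer' : ∀ {V' : Opens X} (h' : V' ≤ V) (w : C.EndSec a (h'.trans (h.trans hV₀))),
      EndSec.res hV₀ (h'.trans h) σ * w * EndSec.res hV₀ (h'.trans h) σ = A.res h' cc • w →
        ∃ b : A.Fn V', w = b • EndSec.res (h.trans hV₀) h' q := by
    intro V' h' w hw
    obtain ⟨b, hb⟩ := hKer V' h' (d.left.coord (h'.trans h) w) (by
      rw [← key (h'.trans h)]
      have h1 : (∑ k, d.left.coord (h'.trans h) w k • EndSec.res hV₀ (h'.trans h) (s₀ k) :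
          C.EndSec a (h'.trans (h.trans hV₀))) = w := d.left.sum_coord (h'.trans h) w
      rw [h1, hw]
      exact map_smul (d.left.coord (h'.trans h)) _ _)
    refine ⟨b, (d.left.coord (h'.trans h)).injective (hb.trans ?_)⟩
    refine Eq.trans ?_ (map_smul (d.left.coord (h'.trans h)) b _).symm
    exact congrArg (b • ·) (funext fun k => (hcoord h' k).symm)
  have hσq : ∀ {V' : Opens X} (h' : V' ≤ V), EndSec.res hV₀ (h'.trans h) σ *
      EndSec.res (h.trans hV₀) h' q * EndSec.res hV₀ (h'.trans h) σ =
        A.res h' cc • EndSec.res (h.trans hV₀) h' q := by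
    intro V' h'
    have h1 : EndSec.res hV₀ h σ * q * EndSec.res hV₀ h σ = cc • q := by
      refine (d.left.coord h).injective ((key h v).trans (hKv.trans ?_))
      refine Eq.trans ?_ (map_smul (d.left.coord h) cc _).symm
      exact congrArg (cc • ·) (funext fun k => (hcoord₀ k).symm)
    rw [← EndSec.res_smul, ← h1, map_mul, map_mul, EndSec.res_res]
  have hmain := fun {V' : Opens X} (h' : V' ≤ V) => exists_mul_mul_eq_smul_of_eigenvector
    (hcc.map (A.res h')) (hσq h') (hKer' h')
  -- `q` is idempotent up to the scalar `ν`, which is `1` at `x` because there `q` agrees with `σ`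
  obtain ⟨ν, hν⟩ : ∃ ν : A.Fn V, q * q = ν • q := by
    obtain ⟨ν, hν⟩ := (hmain le_rfl).1 1
    rw [mul_one] at hν
    have h1 : EndSec.res (h.trans hV₀) le_rfl q = q := (C.Γ a a).res_id _ _
    rw [h1] at hν
    exact ⟨ν, hν⟩
  obtain ⟨j, hj⟩ : ∃ j, ev hx₀ (b₀.repr σ j) ≠ 0 := by
    by_contra! h0
    refine one_ne_zero (hl.symm.trans (Finset.sum_eq_zero fun k _ => ?_))
    exact (congrArg (l k * ·) (h0 k)).trans (mul_zero _)
  have hνx : ev hxV ν = 1 := by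
    let b : Module.Basis (Fin r) (A.Fn V) (C.EndSec a (h.trans hV₀)) := d.left.basis h
    have h1 : ∀ z : R₀, ∀ k, ev hxV (b.repr (EndSec.res hV₀ h z) k) = ev hx₀ (b₀.repr z k) :=
      fun z k => congrArg (ev hxV) (d.left.coord_res le_rfl h z k)
    have h2 : ∀ k, ev hxV (b.repr q k) = ev hx₀ (b₀.repr σ k) := fun k =>
      (congrArg (ev hxV) (hcoord₀ k)).trans (hv k)
    have h3 : ev hxV (b.repr (q * q) j) =
        ev hxV (b.repr (EndSec.res hV₀ h σ * EndSec.res hV₀ h σ) j) := by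
      refine (b.map_repr_mul (ev hxV).toRingHom q q j).trans
        (Eq.trans ?_ (b.map_repr_mul (ev hxV).toRingHom _ _ j).symm)
      refine Finset.sum_congr rfl fun k _ => Finset.sum_congr rfl fun m _ => ?_
      have h4 : ∀ k, (ev hxV).toRingHom (b.repr q k) =
          (ev hxV).toRingHom (b.repr (EndSec.res hV₀ h σ) k) :=
        fun k => (h2 k).trans (h1 σ k).symm
      rw [h4, h4]
    rw [← map_mul, h1, hν] at h3
    have h5 : ev hxV (b.repr (ν • q) j) = ev hxV ν * ev hxV (b.repr q j) := by
      rw [map_smul, Finsupp.smul_apply, smul_eq_mul, map_mul]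
    rw [h5, h2] at h3
    exact mul_right_cancel₀ hj ((h3.trans (hσσ j)).trans (one_mul _).symm)
  -- invertibility of `ν` makes `ν⁻¹ q` idempotent, that of the coordinate `v j` of `q` makes
  -- the scalars `f` with `p z p = f p` unique
  obtain ⟨V₁, h₁, hx₁, hu⟩ := IsLocal.exists_isUnit_res hA hxV (f := ν * v j) (by
    rw [map_mul, hνx, hv, one_mul]
    exact hj)
  rw [map_mul] at hu
  obtain ⟨u, hu1⟩ := (isUnit_of_mul_isUnit_left hu).exists_left_inv
  have hu0 : IsUnit u := IsUnit.of_mul_eq_one _ hu1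
  let q₁ : C.EndSec a (h₁.trans (h.trans hV₀)) := EndSec.res (h.trans hV₀) h₁ q
  have hq₁ : q₁ * q₁ = A.res h₁ ν • q₁ := by
    rw [← map_mul, hν, EndSec.res_smul]
  have hp : ∀ (V' : Opens X) (h' : V' ≤ V₁), (EndSec.res (h₁.trans (h.trans hV₀)) h' (u • q₁) :
      C.EndSec a _) = A.res h' u • EndSec.res (h.trans hV₀) (h'.trans h₁) q := fun V' h' => by
    rw [EndSec.res_smul, EndSec.res_res]
  refine ⟨V₁, h₁.trans (h.trans hV₀), hx₁, u • q₁, ?_, ?_, fun V' h' z => ?_⟩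
  · change (u • q₁) * (u • q₁) = u • q₁
    rw [smul_mul_smul_comm, hq₁, smul_smul, mul_assoc, hu1, mul_one]
  · let e₁ : C.EndSec a (h₁.trans (h.trans hV₀)) :=
      c.iotaSec a (h₁.trans (h.trans hV₀)) (VField.res (h₁.trans (h.trans hV₀)) (ε i))
    have h3 : q₁ * e₁ = q₁ := by
      refine (hmain h₁).2 _ ?_
      have h4 : e₁ = EndSec.res hV₀ (h₁.trans h) (e₀ i) :=
        (c.res_iotaSec a hV₀ (h₁.trans h) (VField.res hV₀ (ε i))).symm
      rw [h4, ← map_mul, hσe]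
    change (u • q₁) * e₁ = u • q₁
    rw [smul_mul_assoc, h3]
  · let z' : C.EndSec a (h'.trans (h₁.trans (h.trans hV₀))) := z
    obtain ⟨b, hb⟩ := (hmain (h'.trans h₁)).1 z'
    have hp' := hp V' h'
    refine ⟨A.res h' u * b, ?_, fun f hf => ?_⟩
    · change EndSec.res (h₁.trans (h.trans hV₀)) h' (u • q₁) * z' *
        EndSec.res (h₁.trans (h.trans hV₀)) h' (u • q₁) = (A.res h' u * b) •
        EndSec.res (h₁.trans (h.trans hV₀)) h' (u • q₁)
      rw [hp', smul_mul_assoc, smul_mul_assoc, mul_smul_comm, hb, smul_smul, smul_smul, smul_smul]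
      congr 1
      ring
    · change EndSec.res (h₁.trans (h.trans hV₀)) h' (u • q₁) * z' *
        EndSec.res (h₁.trans (h.trans hV₀)) h' (u • q₁) = f •
        EndSec.res (h₁.trans (h.trans hV₀)) h' (u • q₁) at hf
      rw [hp', smul_mul_assoc, smul_mul_assoc, mul_smul_comm, hb, smul_smul, smul_smul,
        smul_smul] at hf
      have h5 := congrArg (fun y => d.left.coord (h'.trans (h₁.trans h)) y j) hf
      have h6 : ∀ y : A.Fn V', d.left.coord (h'.trans (h₁.trans h))
          (y • EndSec.res (h.trans hV₀) (h'.trans h₁) q) j = y * A.res (h'.trans h₁) (v j) :=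
        fun y => (congrFun (map_smul (d.left.coord (h'.trans (h₁.trans h))) y _) j).trans
          (congrArg (y * ·) (hcoord (h'.trans h₁) j))
      have h7 := (h6 _).symm.trans (h5.trans (h6 _))
      have h8 : IsUnit (A.res (h'.trans h₁) (v j)) :=
        (isUnit_of_mul_isUnit_right hu).map (A.res h')
      refine (hu0.map (A.res h')).mul_right_cancel ?_
      rw [← h8.mul_right_cancel h7]
      ring

/-- An idempotent endomorphism which vanishes at a point vanishes in a neighbourhood of it: if `L`
is the matrix of the left multiplication by the idempotent `e`, then `1 - L` is invertible near the
point and `(1 - L) e = 0`. -/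
theorem exists_res_eq_zero_of_idempotent (hA : A.IsLocal) {a : C.Obj} {V : Opens X} {hV : V ≤ U}
    {r : ℕ} {s : Fin r → (C.Γ a a).sec V hV} (hs : (C.Γ a a).IsFrame hV s) {x : X} (hx : x ∈ V)
    {e : (C.Γ a a).sec V hV} (he : e ∘[hV] e = e)
    (h0 : ∀ k, ev hx (hs.coord le_rfl e k) = 0) :
    ∃ (V' : Opens X) (h : V' ≤ V), x ∈ V' ∧ (C.Γ a a).res hV h e = 0 := by
  let b : Module.Basis (Fin r) (A.Fn V) (C.EndSec a hV) := hs.basis le_rfl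
  let e' : C.EndSec a hV := e
  have he' : e' * e' = e' := he
  let L : Matrix (Fin r) (Fin r) (A.Fn V) := fun j k => b.repr (e' * b k) j
  have hL : ∀ j k, ev hx (L j k) = 0 := fun j k => by
    refine (b.map_repr_mul (ev hx).toRingHom e' (b k) j).trans ?_
    refine Finset.sum_eq_zero fun m _ => Finset.sum_eq_zero fun l _ => ?_
    have h1 : (ev hx).toRingHom (b.repr e' m) = 0 := h0 m
    rw [h1, zero_mul, zero_mul]
  have hLe : L.mulVec (fun k => b.repr e' k) = fun k => b.repr e' k := by
    funext j
    have h1 : b.repr (e' * e') j = ∑ k, b.repr e' k * b.repr (e' * b k) j := by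
      conv_lhs => rw [← b.sum_repr e', Finset.mul_sum]
      simp only [map_sum, Finsupp.finsetSum_apply, mul_smul_comm, map_smul, Finsupp.smul_apply,
        smul_eq_mul]
      simp only [b.sum_repr]
    rw [he'] at h1
    conv_rhs => rw [h1]
    change ∑ k, b.repr (e' * b k) j * b.repr e' k = _
    exact Finset.sum_congr rfl fun k _ => mul_comm _ _
  obtain ⟨V', h, hx', hu⟩ := IsLocal.exists_isUnit_det hA hx (1 - L) (by
    have h1 : (1 - L).map (ev hx) = 1 := by
      ext1 j k
      rw [Matrix.map_apply, Matrix.sub_apply, map_sub, hL, sub_zero, Matrix.one_apply,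
        Matrix.one_apply]
      split_ifs
      · exact map_one _
      · exact map_zero _
    rw [h1, Matrix.det_one]
    exact one_ne_zero)
  refine ⟨V', h, hx', (hs.coord h).injective ?_⟩
  rw [map_zero]
  have h2 : hs.coord h ((C.Γ a a).res hV h e) = fun k => A.res h (b.repr e' k) :=
    funext fun k => hs.coord_res le_rfl h e k
  rw [h2]
  refine Matrix.mulVec_injective_of_isUnit ((Matrix.isUnit_iff_isUnit_det _).2 hu) ?_
  rw [Matrix.mulVec_zero]
  have h3 : (1 - L).mulVec (fun k => b.repr e' k) = 0 := by
    rw [Matrix.sub_mulVec, hLe, Matrix.one_mulVec, sub_self]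
  funext j
  have h4 := congrArg (A.res h) (congrFun h3 j)
  rw [Pi.zero_apply, map_zero, Matrix.mulVec, dotProduct, map_sum] at h4
  simp only [map_mul] at h4
  exact h4

/-- Over a connected open set, an idempotent endomorphism which is not zero vanishes nowhere. -/
theorem ev_coord_ne_zero_of_isPreconnected (c : C.CardyStr g) (hA : A.IsLocal)
    (hU : IsPreconnected (U : Set X)) {a : C.Obj} {e : (C.Γ a a).sec U le_rfl}
    (he : e ∘[le_rfl] e = e) (he0 : e ≠ 0) {V : Opens X} {hV : V ≤ U} {x : X} (hx : x ∈ V) {r : ℕ}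
    {s : Fin r → (C.Γ a a).sec V hV} (hs : (C.Γ a a).IsFrame hV s) :
    ∃ k, ev hx (hs.coord le_rfl ((C.Γ a a).res le_rfl hV e) k) ≠ 0 := by
  by_contra! h0
  have hidem : ∀ {V : Opens X} (hV : V ≤ U),
      (C.Γ a a).res le_rfl hV e ∘[hV] (C.Γ a a).res le_rfl hV e = (C.Γ a a).res le_rfl hV e :=
    fun hV => by rw [← C.res_comp, he]
  -- `U` is the disjoint union of the open sets where `e` is locally zero and where it does not
  -- vanish
  let Z : Set X := {y | ∃ (V : Opens X) (h : V ≤ U), y ∈ V ∧ (C.Γ a a).res le_rfl h e = 0}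
  let N : Set X := {y | ∃ (V : Opens X) (h : V ≤ U) (r : ℕ) (s : Fin r → (C.Γ a a).sec V h)
    (hs : (C.Γ a a).IsFrame h s) (k : Fin r) (hy : y ∈ V),
      ev hy (hs.coord le_rfl ((C.Γ a a).res le_rfl h e) k) ≠ 0}
  have hZo : IsOpen Z := isOpen_iff_mem_nhds.2 fun y ⟨V, h, hy, hV⟩ =>
    Filter.mem_of_superset (V.isOpen.mem_nhds hy) fun z hz => ⟨V, h, hz, hV⟩
  have hNo : IsOpen N := isOpen_iff_mem_nhds.2 fun y ⟨V, h, r, s, hs, k, hy, hk⟩ => by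
    obtain ⟨V', h', hy', hV'⟩ := IsLocal.exists_of_eventually hA hy
      (fun _ : Unit => hs.coord le_rfl ((C.Γ a a).res le_rfl h e) k)
      (P := fun z => z () ≠ 0) ((continuous_apply ()).continuousAt.eventually_ne hk)
    exact Filter.mem_of_superset (V'.isOpen.mem_nhds hy') fun z hz =>
      ⟨V, h, r, s, hs, k, h' hz, hV' z hz⟩
  have hZ : ∀ {V : Opens X} (h : V ≤ U) {r : ℕ} {s : Fin r → (C.Γ a a).sec V h}
      (hs : (C.Γ a a).IsFrame h s) {y : X} (hy : y ∈ V),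
      (∀ k, ev hy (hs.coord le_rfl ((C.Γ a a).res le_rfl h e) k) = 0) → y ∈ Z := by
    intro V h r s hs y hy hy0
    obtain ⟨V', h', hy', hV'⟩ := exists_res_eq_zero_of_idempotent hA hs hy (hidem h) hy0
    rw [Mod.res_res] at hV'
    exact ⟨V', _, hy', hV'⟩
  have hcov : (U : Set X) ⊆ Z ∪ N := by
    intro y hy
    obtain ⟨V, h, hyV, r, s, hs⟩ := c.locallyFree a a y hy
    by_cases hk : ∀ k, ev hyV (hs.coord le_rfl ((C.Γ a a).res le_rfl h e) k) = 0
    · exact Or.inl (hZ h hs hyV hk)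
    · push Not at hk
      obtain ⟨k, hk⟩ := hk
      exact Or.inr ⟨V, h, r, s, hs, k, hyV, hk⟩
  have hdisj : (U : Set X) ∩ (Z ∩ N) = ∅ := by
    rw [Set.eq_empty_iff_forall_notMem]
    rintro y ⟨-, ⟨V, h, hy, hV⟩, V', h', r, s, hs, k, hy', hV'⟩
    refine hV' ?_
    have h1 := hs.coord_res le_rfl (inf_le_right : V ⊓ V' ≤ V') ((C.Γ a a).res le_rfl h' e) k
    have h2 : (C.Γ a a).res le_rfl (inf_le_left.trans h : V ⊓ V' ≤ U) e = 0 := by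
      rw [← (C.Γ a a).res_res le_rfl h inf_le_left, hV, map_zero]
    rw [Mod.res_res, h2, map_zero] at h1
    exact congrArg (ev (⟨hy, hy'⟩ : y ∈ V ⊓ V')) h1.symm
  rcases isPreconnected_iff_subset_of_disjoint.1 hU Z N hZo hNo hcov hdisj with H | H
  · refine he0 ((c.isSheaf a a).ext fun y hy => ?_)
    obtain ⟨V, h, hyV, hV⟩ := H hy
    exact ⟨V, h, hyV, by rw [hV, map_zero]⟩
  · have : x ∈ (U : Set X) ∩ (Z ∩ N) := ⟨hV hx, hZ hV hs hx h0, H (hV hx)⟩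
    rw [hdisj] at this
    exact this

end CardyStr

end EnrCat

end FunAlg

/-! ### Restriction of labels -/

namespace FunAlg

variable {X : Type u} [TopologicalSpace X] {A : FunAlg X}

namespace LinStack

open Pseudofunctor.LocallyDiscreteOpToCat

variable (B : LinStack.{u, w} A)

/-- The isomorphism `a|_W ≅ (a|_V)|_W`. -/
def rsIso {U V W : Opens X} (hV : V ≤ U) (hW : W ≤ V) (a : B.Lab U) :
    B.rs (hW.trans hV) a ≅ B.rs hW (B.rs hV a) where
  hom := (B.F.mapComp' (homOfLE hV).op.toLoc (homOfLE hW).op.toLoc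
    (homOfLE (hW.trans hV)).op.toLoc rfl).hom.toNatTrans.app a
  inv := (B.F.mapComp' (homOfLE hV).op.toLoc (homOfLE hW).op.toLoc
    (homOfLE (hW.trans hV)).op.toLoc rfl).inv.toNatTrans.app a
  hom_inv_id := by
    rw [← Cat.Hom₂.comp_app, Iso.hom_inv_id]
    rfl
  inv_hom_id := by
    rw [← Cat.Hom₂.comp_app, Iso.inv_hom_id]
    rfl

theorem rsIso_hom_comp_map {U V W W' : Opens X} (hV : V ≤ U) (hW : W ≤ V) (hW' : W' ≤ W)
    (a : B.Lab U) :
    (B.rsIso (hW.trans hV) hW' a).hom ≫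
        (B.F.map (homOfLE hW').op.toLoc).toFunctor.map (B.rsIso hV hW a).hom =
      (B.rsIso hV (hW'.trans hW) a).hom ≫ (B.rsIso hW hW' (B.rs hV a)).hom :=
  (B.F.mapComp'₀₂₃_hom_comp_mapComp'_hom_whiskerRight_app (homOfLE hV).op.toLoc
    (homOfLE hW).op.toLoc (homOfLE hW').op.toLoc _ _ _ rfl rfl rfl a)

theorem map_comp_rsIso_inv {U V W W' : Opens X} (hV : V ≤ U) (hW : W ≤ V) (hW' : W' ≤ W)
    (a : B.Lab U) :
    (B.F.map (homOfLE hW').op.toLoc).toFunctor.map (B.rsIso hV hW a).inv ≫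
        (B.rsIso (hW.trans hV) hW' a).inv =
      (B.rsIso hW hW' (B.rs hV a)).inv ≫ (B.rsIso hV (hW'.trans hW) a).inv :=
  B.F.mapComp'_inv_whiskerRight_mapComp'₀₂₃_inv_app (homOfLE hV).op.toLoc
    (homOfLE hW).op.toLoc (homOfLE hW').op.toLoc _ _ _ rfl rfl rfl a

theorem res_Γ_eq {U₁ U₂ W V V' : Opens X} (a : B.Lab U₁) (b : B.Lab U₂) (h₁ : W ≤ U₁)
    (h₂ : W ≤ U₂) (hV : V ≤ W) (h : V' ≤ V)
    (σ : B.rs (hV.trans h₁) a ⟶ B.rs (hV.trans h₂) b) :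
    (B.Γ a b W h₁ h₂).res hV h σ = (B.rsIso (hV.trans h₁) h a).hom ≫
      (B.F.map (homOfLE h).op.toLoc).toFunctor.map σ ≫ (B.rsIso (hV.trans h₂) h b).inv :=
  rfl

/-- Morphisms `(a|_V)|_W ⟶ (b|_V)|_W` as morphisms `a|_W ⟶ b|_W`. -/
def conjEquiv {U₁ U₂ V W : Opens X} (h₁ : V ≤ U₁) (h₂ : V ≤ U₂) (hW : W ≤ V) (a : B.Lab U₁)
    (b : B.Lab U₂) : (B.rs hW (B.rs h₁ a) ⟶ B.rs hW (B.rs h₂ b)) ≃ₗ[A.Fn W]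
      (B.rs (hW.trans h₁) a ⟶ B.rs (hW.trans h₂) b) where
  toFun σ := (B.rsIso h₁ hW a).hom ≫ σ ≫ (B.rsIso h₂ hW b).inv
  invFun σ := (B.rsIso h₁ hW a).inv ≫ σ ≫ (B.rsIso h₂ hW b).hom
  map_add' σ τ := by rw [Preadditive.add_comp, Preadditive.comp_add]
  map_smul' f σ := by rw [Linear.smul_comp, Linear.comp_smul]; rfl
  left_inv σ := by simp
  right_inv σ := by simp

theorem res_conjEquiv {U₁ U₂ V W W' : Opens X} (h₁ : V ≤ U₁) (h₂ : V ≤ U₂) (hW : W ≤ V)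
    (h : W' ≤ W) (a : B.Lab U₁) (b : B.Lab U₂)
    (σ : B.rs hW (B.rs h₁ a) ⟶ B.rs hW (B.rs h₂ b)) :
    (B.Γ a b V h₁ h₂).res hW h (B.conjEquiv h₁ h₂ hW a b σ) =
      B.conjEquiv h₁ h₂ (h.trans hW) a b
        ((B.Γ (B.rs h₁ a) (B.rs h₂ b) V le_rfl le_rfl).res hW h σ) := by
  refine (B.res_Γ_eq a b h₁ h₂ hW h _).trans ?_
  change _ = (B.rsIso h₁ (h.trans hW) a).hom ≫ ((B.rsIso hW h (B.rs h₁ a)).hom ≫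
      (B.F.map (homOfLE h).op.toLoc).toFunctor.map σ ≫ (B.rsIso hW h (B.rs h₂ b)).inv) ≫
      (B.rsIso h₂ (h.trans hW) b).inv
  change _ ≫ (B.F.map (homOfLE h).op.toLoc).toFunctor.map
    ((B.rsIso h₁ hW a).hom ≫ σ ≫ (B.rsIso h₂ hW b).inv) ≫ _ = _
  rw [Functor.map_comp, Functor.map_comp, Category.assoc, Category.assoc, Category.assoc,
    Category.assoc]
  have h1 := B.rsIso_hom_comp_map h₁ hW h a
  have h2 := B.map_comp_rsIso_inv h₂ hW h b
  rw [← Category.assoc, h1, Category.assoc]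
  congr 3

/-- The isomorphism `Γ(a|_V, b|_V) ≅ Γ(a, b)|_V`. -/
def conjHom {U₁ U₂ V : Opens X} (h₁ : V ≤ U₁) (h₂ : V ≤ U₂) (a : B.Lab U₁) (b : B.Lab U₂) :
    ((B.enr V).Γ (B.rs h₁ a) (B.rs h₂ b)).Hom (B.Γ a b V h₁ h₂) where
  app W hW := (B.conjEquiv h₁ h₂ hW a b).toLinearMap
  nat hW h σ := B.res_conjEquiv h₁ h₂ hW h a b σ

theorem conjEquiv_comp {U₁ U₂ U₃ V W : Opens X} (h₁ : V ≤ U₁) (h₂ : V ≤ U₂) (h₃ : V ≤ U₃)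
    (hW : W ≤ V) {a : B.Lab U₁} {b : B.Lab U₂} {d : B.Lab U₃}
    (σ : B.rs hW (B.rs h₁ a) ⟶ B.rs hW (B.rs h₂ b))
    (τ : B.rs hW (B.rs h₂ b) ⟶ B.rs hW (B.rs h₃ d)) :
    B.conjEquiv h₁ h₃ hW a d (σ ≫ τ) =
      B.conjEquiv h₁ h₂ hW a b σ ≫ B.conjEquiv h₂ h₃ hW b d τ := by
  simp [conjEquiv]

theorem conjEquiv_id {U V W : Opens X} (h : V ≤ U) (hW : W ≤ V) (a : B.Lab U) :
    B.conjEquiv h h hW a a (𝟙 _) = 𝟙 _ := by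
  simp [conjEquiv]

/-- The restriction of an isomorphism of labels to a smaller open set. -/
def resIso {U₁ U₂ V V' : Opens X} {h₁ : V ≤ U₁} {h₂ : V ≤ U₂} {a : B.Lab U₁} {b : B.Lab U₂}
    (φ : B.rs h₁ a ≅ B.rs h₂ b) (h : V' ≤ V) : B.rs (h.trans h₁) a ≅ B.rs (h.trans h₂) b :=
  B.rsIso h₁ h a ≪≫ (B.F.map (homOfLE h).op.toLoc).toFunctor.mapIso φ ≪≫ (B.rsIso h₂ h b).symm

end LinStack

namespace Mod

variable {W : Opens X}

theorem IsSheaf.of_bijective {E F : A.Mod W} (m : E.Hom F)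
    (hm : ∀ V h, Function.Bijective (m.app V h)) (hE : E.IsSheaf) : F.IsSheaf := by
  intro V hV J N hN hcov s hs
  choose s' hs' using fun j => (hm (N j) ((hN j).trans hV)).surjective (s j)
  obtain ⟨t, ht, hu⟩ := hE V hV J N hN hcov s' fun i j => by
    apply (hm _ _).injective
    rw [← m.nat, ← m.nat, hs', hs', hs]
  refine ⟨m.app V hV t, fun j => by rw [m.nat, ht, hs'], fun t' ht' => ?_⟩
  obtain ⟨t'', rfl⟩ := (hm V hV).surjective t'
  refine congrArg _ (hu t'' fun j => (hm _ _).injective ?_)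
  rw [← m.nat, ht', hs']

end Mod

namespace CardyFibration

variable {S : A.FMan} {g : S.Metric} (B : CardyFibration.{u, w} g)

theorem isSheaf_Γ {U₁ U₂ W : Opens X} (a : B.Lab U₁) (b : B.Lab U₂) (h₁ : W ≤ U₁) (h₂ : W ≤ U₂) :
    (B.Γ a b W h₁ h₂).IsSheaf :=
  Mod.IsSheaf.of_bijective (B.conjHom h₁ h₂ a b)
    (fun _ hV => (B.conjEquiv h₁ h₂ hV a b).bijective) ((B.cardy W).isSheaf _ _)

/-- The endomorphism `ι_a(Y)` of `a|_V`. -/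
def ιL {U V : Opens X} (a : B.Lab U) (h : V ≤ U) (Y : A.VField V) : B.rs h a ⟶ B.rs h a :=
  (B.cardy U).iotaSec a h Y

theorem conjEquiv_ιL {U V W : Opens X} (a : B.Lab U) (hV : V ≤ U) (hW : W ≤ V)
    (Y : A.VField W) :
    B.conjEquiv hV hV hW a a (B.ιL (B.rs hV a) hW Y) = B.ιL a (hW.trans hV) Y :=
  B.iota_res hV hW a Y

theorem ιL_comm {U₁ U₂ V : Opens X} {a : B.Lab U₁} {b : B.Lab U₂} (h₁ : V ≤ U₁) (h₂ : V ≤ U₂)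
    (Y : A.VField V) (σ : B.rs h₁ a ⟶ B.rs h₂ b) : B.ιL a h₁ Y ≫ σ = σ ≫ B.ιL b h₂ Y := by
  obtain ⟨σ', rfl⟩ := (B.conjEquiv h₁ h₂ le_rfl a b).surjective σ
  have h : B.ιL (B.rs h₁ a) le_rfl Y ≫ σ' = σ' ≫ B.ιL (B.rs h₂ b) le_rfl Y :=
    (B.cardy V).comp_iotaSec le_rfl Y σ'
  rw [← B.conjEquiv_ιL a h₁ le_rfl, ← B.conjEquiv_ιL b h₂ le_rfl, ← B.conjEquiv_comp,
    ← B.conjEquiv_comp, h]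

theorem res_ιL {U V V' : Opens X} (a : B.Lab U) (h : V ≤ U) (h' : V' ≤ V) (Y : A.VField V) :
    (B.Γ a a U le_rfl le_rfl).res h h' (B.ιL a h Y) = B.ιL a (h'.trans h) (VField.res h' Y) :=
  (B.cardy U).res_iotaSec a h h' Y

theorem ιL_mul {U V : Opens X} (a : B.Lab U) (h : V ≤ U) (Y Z : A.VField V) :
    B.ιL a h (S.mul V Y Z) = B.ιL a h Z ≫ B.ιL a h Y :=
  (B.cardy U).iotaSec_mul a h Y Z

/-- A label `a` over `U` is simple with support `Y` if `Γ_aa = 𝒪` and `ι_a(Y) = 1`. -/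
structure IsSimple {U : Opens X} (a : B.Lab U) (Y : A.VField U) : Prop where
  supported : B.ιL a le_rfl Y = 𝟙 (B.rs le_rfl a)
  bij : ∀ (V : Opens X) (h : V ≤ U), Function.Bijective fun f : A.Fn V => f • 𝟙 (B.rs h a)

namespace IsSimple

variable {B} {U : Opens X} {a : B.Lab U} {Y : A.VField U}

theorem ιL_res (ha : B.IsSimple a Y) {V : Opens X} (h : V ≤ U) :
    B.ιL a h (VField.res h Y) = 𝟙 (B.rs h a) := by
  have h1 := B.res_ιL a le_rfl h Y
  rw [ha.supported] at h1
  exact h1.symm.trans ((B.enr U).one_res a le_rfl h)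

/-- The condition `Γ_aa ≅ 𝒪` is about an arbitrary isomorphism of modules; the identity of `a` is
then a basis as well. -/
theorem of_hom (hY : B.ιL a le_rfl Y = 𝟙 (B.rs le_rfl a))
    (m : (A.str U).Hom ((B.enr U).Γ a a)) (hm : ∀ V h, Function.Bijective (m.app V h)) :
    B.IsSimple a Y := by
  refine ⟨hY, fun V h => ?_⟩
  let m' : A.Fn V →ₗ[A.Fn V] (B.rs h a ⟶ B.rs h a) := m.app V h
  have hm' : Function.Bijective m' := hm V h
  obtain ⟨f₀, hf₀⟩ := hm'.surjective (𝟙 _)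
  obtain ⟨f₁, hf₁⟩ := hm'.surjective (m' 1 ≫ m' 1)
  have h1 : ∀ f, m' f = f • m' 1 := fun f => by rw [← map_smul, smul_eq_mul, mul_one]
  have h2 : f₀ * f₁ = 1 := by
    apply hm'.injective
    rw [h1, mul_smul, ← h1 f₁, hf₁, ← Linear.smul_comp, ← h1, hf₀, Category.id_comp]
  have h3 : (fun f : A.Fn V => f • 𝟙 (B.rs h a)) = m' ∘ fun f => f * f₀ := by
    funext f
    rw [Function.comp_apply, h1, mul_smul, ← h1, hf₀]
  rw [h3]
  refine hm'.comp ⟨fun x y hxy => ?_, fun x => ⟨x * f₁, ?_⟩⟩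
  · have h4 := congrArg (· * f₁) hxy
    simp only [mul_assoc, h2, mul_one] at h4
    exact h4
  · simp only [mul_assoc, mul_comm f₁, h2, mul_one]

end IsSimple

end CardyFibration

end FunAlg

/-! ### Comparison of simple labels -/

namespace FunAlg

variable {X : Type u} [TopologicalSpace X] {A : FunAlg X}

theorem nontrivial_Fn {V : Opens X} {x : X} (hx : x ∈ V) : Nontrivial (A.Fn V) :=
  (ev hx : A.Fn V →ₐ[ℂ] ℂ).toRingHom.domain_nontrivial

namespace EnrCat

variable {U : Opens X} {C : A.EnrCat.{u, w} U} {S : A.FMan} {g : S.Metric} {n : ℕ}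

/-- Composition of sections over an open set `V`, where `h : V ≤ U`. -/
local notation:75 τ:76 " ∘[" h "] " σ:75 => Mod.Pairing.app (EnrCat.comp _ _ _ _) _ h τ σ

/-- Two objects with endomorphisms `𝒪` on which the same idempotent acts as the identity are locally
isomorphic: by the Cardy condition for the identity, a sum of composites `a → b → a` is invertible,
so one of them is. -/
theorem CardyStr.exists_inverse_of_simple (c : C.CardyStr g) (hA : A.IsLocal)
    {ε : Fin n → A.VField U} (hε : S.IsIdempotentFrame ε) (i : Fin n) {a b : C.Obj}
    (ha : ∀ V (h : V ≤ U), Function.Bijective fun f : A.Fn V => f • C.one a V h)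
    (hb : ∀ V (h : V ≤ U), Function.Bijective fun f : A.Fn V => f • C.one b V h)
    (hai : c.iotaSec a le_rfl (ε i) = C.one a U le_rfl)
    (hbi : c.iotaSec b le_rfl (ε i) = C.one b U le_rfl) {x : X} (hx : x ∈ U) :
    ∃ (V : Opens X) (h : V ≤ U), x ∈ V ∧ ∃ (σ : (C.Γ a b).sec V h) (τ : (C.Γ b a).sec V h),
      τ ∘[h] σ = C.one a V h ∧ σ ∘[h] τ = C.one b V h := by
  -- the trace of the identity of `a` is invertible
  obtain ⟨V₁, h₁, hx₁, r, s, t, d⟩ := c.exists_dualFrames a a hx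
  have hu : IsUnit (c.trace h₁ (C.one a V₁ h₁)) := by
    have h2 := d.sum_left (C.one a V₁ h₁)
    choose y hy using fun k => (ha V₁ h₁).surjective (s k)
    choose z hz using fun k => (ha V₁ h₁).surjective (t k)
    simp only at hy hz
    simp only [← hy, ← hz, map_smul, LinearMap.smul_apply, C.one_comp] at h2
    simp only [smul_smul, ← Finset.sum_smul] at h2
    have h3 := (ha V₁ h₁).injective (h2.trans (one_smul (A.Fn V₁) _).symm)
    refine IsUnit.of_mul_eq_one (∑ k, z k * y k) ?_
    rw [← h3, Finset.mul_sum]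
    exact Finset.sum_congr rfl fun k _ => by rw [smul_eq_mul]; ring
  obtain ⟨V₂, h₂, hx₂, m, s, t, d⟩ := c.exists_dualFrames a b hx
  let V := V₁ ⊓ V₂
  have hV : V ≤ U := inf_le_left.trans h₁
  have hxV : x ∈ V := ⟨hx₁, hx₂⟩
  have hu' : IsUnit (c.trace hV (C.one a V hV)) := by
    have := hu.map (A.res (inf_le_left : V ≤ V₁))
    rwa [c.res_trace, C.one_res] at this
  replace d := d.restrict (inf_le_right : V ≤ V₂)
  set s' := fun k => (C.Γ a b).res h₂ (inf_le_right : V ≤ V₂) (s k)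
  set t' := fun k => (C.Γ b a).res h₂ (inf_le_right : V ≤ V₂) (t k)
  have hiV : c.iotaSec b hV (VField.res hV (ε i)) = C.one b V hV := by
    rw [← c.res_iotaSec b le_rfl hV, hbi, C.one_res]
  have hεV := hε.restrict hV
  obtain ⟨f, hf, hfθ⟩ := c.exists_iotaUp_eq hεV hV a (C.one a V hV)
  have hfi : IsUnit (f i) := by
    have h1 := hfθ i
    rw [← c.res_iotaSec a le_rfl hV, hai, C.one_res, C.one_comp] at h1
    exact isUnit_of_mul_isUnit_left (h1 ▸ hu')
  have hsum : ∑ k, s' k ∘[hV] t' k = f i • C.one b V hV := by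
    have h1 := d.cardy (C.one a V hV)
    have h3 : ∀ k, (s' k ∘[hV] C.one a V hV) = s' k := fun k => C.comp_one _ _ _ _ _
    have h4 : ∑ k, (s' k ∘[hV] C.one a V hV) ∘[hV] t' k = ∑ k, s' k ∘[hV] t' k :=
      Finset.sum_congr rfl fun k _ => by rw [h3]
    refine h4.symm.trans (h1.trans ?_)
    rw [hf, map_sum, ← hiV]
    simp only [map_smul]
    refine Finset.sum_eq_single i (fun j _ hj => ?_) fun h => absurd (Finset.mem_univ i) h
    have h2 := c.iotaSec_comp hεV hV b j i
    rw [if_neg hj, hiV, C.comp_one] at h2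
    rw [h2, smul_zero]
  choose y hy using fun k => (hb V hV).surjective (s' k ∘[hV] t' k)
  simp only at hy
  obtain ⟨k, hk⟩ : ∃ k, ev hxV (y k) ≠ 0 := by
    by_contra! h0
    simp only [← hy, ← Finset.sum_smul] at hsum
    have h1 := congrArg (ev hxV) ((hb V hV).injective hsum)
    rw [map_sum, Finset.sum_eq_zero fun k _ => h0 k] at h1
    exact (hfi.map (ev hxV)).ne_zero h1.symm
  obtain ⟨V', h, hx', hu⟩ := IsLocal.exists_isUnit_res hA hxV hk
  obtain ⟨y', hy'⟩ := hu.exists_left_inv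
  let σ := (C.Γ a b).res hV h (s' k)
  let τ := (C.Γ b a).res hV h (t' k)
  have hστ : σ ∘[h.trans hV] τ = A.res h (y k) • C.one b V' (h.trans hV) := by
    rw [← C.res_comp, ← hy, Mod.res_smul, C.one_res]
  obtain ⟨z, hz⟩ := (ha V' (h.trans hV)).surjective (τ ∘[h.trans hV] σ)
  simp only at hz
  -- the two scalars `σ τ` and `τ σ` agree
  have hzy : z = A.res h (y k) := by
    have h1 : (τ ∘[h.trans hV] σ) ∘[h.trans hV] (τ ∘[h.trans hV] σ) =
        A.res h (y k) • (τ ∘[h.trans hV] σ) := by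
      rw [C.assoc, ← C.assoc (ρ := σ), hστ, map_smul, LinearMap.smul_apply, C.one_comp, map_smul]
    have h2 : (σ ∘[h.trans hV] τ) ∘[h.trans hV] (σ ∘[h.trans hV] τ) =
        z • (σ ∘[h.trans hV] τ) := by
      rw [C.assoc, ← C.assoc (ρ := τ), ← hz, map_smul, LinearMap.smul_apply, C.one_comp, map_smul]
    rw [hστ, map_smul, C.comp_one, smul_smul, smul_smul] at h2
    exact (hu.mul_right_cancel ((hb V' (h.trans hV)).injective h2)).symm
  refine ⟨V', h.trans hV, hx', σ, y' • τ, ?_, ?_⟩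
  · rw [map_smul, LinearMap.smul_apply, ← hz, hzy, smul_smul, hy', one_smul]
  · rw [map_smul, hστ, smul_smul, hy', one_smul]

end EnrCat

namespace CardyFibration

variable {S : A.FMan} {g : S.Metric} (B : CardyFibration.{u, w} g) {n : ℕ}

namespace IsSimple

variable {B} {U₁ U₂ : Opens X} {a : B.Lab U₁} {b : B.Lab U₂} {Y : A.VField U₁}

/-- Simple labels with orthogonal supports admit only the zero morphism. -/
theorem eq_zero (ha : B.IsSimple a Y) {Z : A.VField U₂} (hb : B.IsSimple b Z) {V : Opens X}
    (h₁ : V ≤ U₁) (h₂ : V ≤ U₂) (hYZ : S.mul V (VField.res h₁ Y) (VField.res h₂ Z) = 0)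
    (σ : B.rs h₁ a ⟶ B.rs h₂ b) : σ = 0 := by
  have h3 : B.ιL b h₂ (VField.res h₁ Y) = 0 := by
    have h4 := B.ιL_mul b h₂ (VField.res h₁ Y) (VField.res h₂ Z)
    rw [hYZ, hb.ιL_res, Category.id_comp] at h4
    exact h4.symm.trans (map_zero ((B.cardy U₂).iotaSec b h₂))
  have h5 := B.ιL_comm h₁ h₂ (VField.res h₁ Y) σ
  rwa [h3, ha.ιL_res, Limits.comp_zero, Category.id_comp] at h5

/-- The scalar endomorphisms of the restriction of a simple label. -/
theorem bij_rs (ha : B.IsSimple a Y) {V W : Opens X} (h₁ : V ≤ U₁) (h : W ≤ V) :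
    Function.Bijective fun f : A.Fn W => f • 𝟙 (B.rs h (B.rs h₁ a)) := by
  have h1 : (fun f : A.Fn W => f • 𝟙 (B.rs h (B.rs h₁ a))) =
      (B.conjEquiv h₁ h₁ h a a).symm ∘ fun f : A.Fn W => f • 𝟙 (B.rs (h.trans h₁) a) := by
    funext f
    rw [Function.comp_apply, map_smul, ← B.conjEquiv_id h₁ h a, LinearEquiv.symm_apply_apply]
  rw [h1]
  exact (LinearEquiv.bijective _).comp (ha.bij W (h.trans h₁))

/-- Simple labels with the same support are locally isomorphic. -/
theorem exists_iso (hA : A.IsLocal) (ha : B.IsSimple a Y) {Z : A.VField U₂}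
    (hb : B.IsSimple b Z) {V : Opens X} (h₁ : V ≤ U₁) (h₂ : V ≤ U₂) {ε : Fin n → A.VField V}
    (hε : S.IsIdempotentFrame ε) {i : Fin n} (hY : VField.res h₁ Y = ε i)
    (hZ : VField.res h₂ Z = ε i) {x : X} (hx : x ∈ V) :
    ∃ (W : Opens X) (h : W ≤ V), x ∈ W ∧
      Nonempty (B.rs (h.trans h₁) a ≅ B.rs (h.trans h₂) b) := by
  have hι : ∀ {U : Opens X} {a : B.Lab U} {Y : A.VField U} (ha : B.IsSimple a Y) (h₁ : V ≤ U),
      VField.res h₁ Y = ε i →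
        B.ιL (B.rs h₁ a) le_rfl (ε i) = 𝟙 (B.rs le_rfl (B.rs h₁ a)) := by
    intro U a Y ha h₁ hY
    apply (B.conjEquiv h₁ h₁ le_rfl a a).injective
    rw [B.conjEquiv_ιL, B.conjEquiv_id, ← hY]
    exact ha.ιL_res h₁
  obtain ⟨W, h, hxW, σ, τ, h3, h4⟩ := (B.cardy V).exists_inverse_of_simple hA hε i
    (fun W h => ha.bij_rs h₁ h) (fun W h => hb.bij_rs h₂ h) (hι ha h₁ hY) (hι hb h₂ hZ) hx
  let φ : B.rs h (B.rs h₁ a) ≅ B.rs h (B.rs h₂ b) := ⟨σ, τ, h3, h4⟩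
  exact ⟨W, h, hxW, ⟨B.rsIso h₁ h a ≪≫ φ ≪≫ (B.rsIso h₂ h b).symm⟩⟩

end IsSimple

theorem hasRank_zero {U₁ U₂ W : Opens X} {a : B.Lab U₁} {b : B.Lab U₂} {h₁ : W ≤ U₁}
    {h₂ : W ≤ U₂} (H : ∀ V (h : V ≤ W) (σ : B.rs (h.trans h₁) a ⟶ B.rs (h.trans h₂) b), σ = 0) :
    (B.Γ a b W h₁ h₂).HasRank 0 :=
  fun x hx => ⟨W, le_rfl, hx, Fin.elim0, fun V h =>
    ⟨fun _ _ _ => funext fun i => i.elim0, fun σ => ⟨Fin.elim0, (H V h σ).symm⟩⟩⟩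

/-- If `a` has endomorphisms `𝒪` and is isomorphic to `b` over `W`, then every isomorphism is a
basis of `Γ_ab`. -/
theorem bijective_smul_hom {U₁ U₂ W : Opens X} {a : B.Lab U₁} {b : B.Lab U₂} {h₁ : W ≤ U₁}
    {h₂ : W ≤ U₂} (ha : Function.Bijective fun f : A.Fn W => f • 𝟙 (B.rs h₁ a))
    (φ : B.rs h₁ a ≅ B.rs h₂ b) : Function.Bijective fun f : A.Fn W => f • φ.hom := by
  have h3 : (fun f : A.Fn W => f • φ.hom) =
      (fun σ : B.rs h₁ a ⟶ B.rs h₁ a => σ ≫ φ.hom) ∘ fun f : A.Fn W => f • 𝟙 (B.rs h₁ a) := by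
    funext f
    rw [Function.comp_apply, Linear.smul_comp, Category.id_comp]
  rw [h3]
  refine Function.Bijective.comp ⟨fun σ τ h => ?_, fun τ => ⟨τ ≫ φ.inv, ?_⟩⟩ ha
  · exact (cancel_mono φ.hom).1 h
  · simp

/-- Labels which are locally isomorphic to a simple label differ from it by an invertible sheaf. -/
theorem hasRank_one {U₁ U₂ W : Opens X} {a : B.Lab U₁} {b : B.Lab U₂} {h₁ : W ≤ U₁}
    {h₂ : W ≤ U₂} {Y : A.VField U₁} (ha : B.IsSimple a Y)
    (H : ∀ x ∈ W, ∃ (V : Opens X) (h : V ≤ W), x ∈ V ∧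
      Nonempty (B.rs (h.trans h₁) a ≅ B.rs (h.trans h₂) b)) :
    (B.Γ a b W h₁ h₂).HasRank 1 := by
  intro x hx
  obtain ⟨V, h, hxV, ⟨φ⟩⟩ := H x hx
  refine ⟨V, h, hxV, fun _ => φ.hom, fun V' h' => ?_⟩
  have h3 : (fun c : Fin 1 → A.Fn V' => ∑ i, c i • (B.Γ a b W h₁ h₂).res h h' φ.hom) =
      (fun f : A.Fn V' => f • (B.resIso φ h').hom) ∘ Equiv.funUnique (Fin 1) (A.Fn V') := by
    funext c
    rw [Fin.sum_univ_one]
    rfl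
  exact h3 ▸ (B.bijective_smul_hom (ha.bij V' _) _).comp (Equiv.bijective _)

/-- Composition induces an isomorphism `⨁ j, Γ(d_j, a) ⊗ Γ(b, d_j) ≅ Γ(b, a)` if, locally, `a` is
isomorphic to one of the `d_j`, with endomorphisms `𝒪`, and has only zero morphisms from the
others. -/
theorem isTensorIso {J : Type} [Fintype J] {U₁ U₂ W W₃ : Opens X}
    {U₃ W₁ W₂ : J → Opens X} {a : B.Lab U₁} {b : B.Lab U₂} {d : ∀ j, B.Lab (U₃ j)}
    {k₁ : ∀ j, W₁ j ≤ U₃ j} {k₂ : ∀ j, W₁ j ≤ U₁} {k₃ : ∀ j, W₂ j ≤ U₂} {k₄ : ∀ j, W₂ j ≤ U₃ j}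
    {k₅ : W₃ ≤ U₂} {k₆ : W₃ ≤ U₁} {h₁ : ∀ j, W ≤ W₁ j} {h₂ : ∀ j, W ≤ W₂ j} {h₃ : W ≤ W₃}
    (p : ∀ j, Mod.Pairing (B.Γ (d j) a (W₁ j) (k₁ j) (k₂ j)) (B.Γ b (d j) (W₂ j) (k₃ j) (k₄ j))
      (B.Γ b a W₃ k₅ k₆) W (h₁ j) (h₂ j) h₃)
    (hp : ∀ j V (h : V ≤ W)
      (τ : B.rs ((h.trans (h₁ j)).trans (k₁ j)) (d j) ⟶ B.rs ((h.trans (h₁ j)).trans (k₂ j)) a)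
      (σ : B.rs ((h.trans (h₂ j)).trans (k₃ j)) b ⟶ B.rs ((h.trans (h₂ j)).trans (k₄ j)) (d j)),
        (p j).app V h τ σ = σ ≫ τ)
    (H : ∀ x ∈ W, ∃ (V : Opens X) (h : V ≤ W), x ∈ V ∧ ∃ j₀,
      (∀ j, j ≠ j₀ → ∀ (V' : Opens X) (h' : V' ≤ V) (σ : B.rs (((h'.trans h).trans (h₁ j)).trans
        (k₁ j)) (d j) ⟶ B.rs (((h'.trans h).trans (h₁ j)).trans (k₂ j)) a), σ = 0) ∧
      (∀ (V' : Opens X) (h' : V' ≤ V), Function.Bijective fun f : A.Fn V' =>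
        f • 𝟙 (B.rs (((h'.trans h).trans (h₁ j₀)).trans (k₁ j₀)) (d j₀))) ∧
      Nonempty (B.rs ((h.trans (h₁ j₀)).trans (k₁ j₀)) (d j₀) ≅
        B.rs ((h.trans (h₁ j₀)).trans (k₂ j₀)) a)) :
    Mod.IsTensorIso p := by
  classical
  intro x hx
  obtain ⟨V, h, hxV, j₀, hz, hs, ⟨φ⟩⟩ := H x hx
  refine ⟨V, h, hxV, fun V' h' => ?_⟩
  let ψ := B.resIso φ h'
  have hψ := B.bijective_smul_hom (hs V' h') ψ
  let T := fun j => (B.Γ (d j) a (W₁ j) (k₁ j) (k₂ j)).sec V' ((h'.trans h).trans (h₁ j)) ⊗[A.Fn V']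
          (B.Γ b (d j) (W₂ j) (k₃ j) (k₄ j)).sec V' ((h'.trans h).trans (h₂ j))
  let ψ' : (B.Γ (d j₀) a (W₁ j₀) (k₁ j₀) (k₂ j₀)).sec V' ((h'.trans h).trans (h₁ j₀)) := ψ.hom
  have hsub : ∀ j, j ≠ j₀ → ∀ t : T j, t = 0 := by
    intro j hj t
    induction t using TensorProduct.induction_on with
    | zero => rfl
    | add t t' ht ht' => rw [ht, ht', add_zero]
    | tmul τ σ => rw [show τ = 0 from hz j hj V' h' τ, TensorProduct.zero_tmul]
  have hspan : ∀ t : T j₀, ∃ σ, t = ψ' ⊗ₜ σ := by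
    intro t
    induction t using TensorProduct.induction_on with
    | zero => exact ⟨0, (TensorProduct.tmul_zero _ _).symm⟩
    | add t t' ht ht' =>
      obtain ⟨σ, rfl⟩ := ht
      obtain ⟨σ', rfl⟩ := ht'
      exact ⟨σ + σ', (TensorProduct.tmul_add _ _ _).symm⟩
    | tmul τ σ =>
      obtain ⟨f, hf⟩ := hψ.surjective τ
      have hf' : f • ψ' = τ := hf
      exact ⟨f • σ, by rw [← hf', TensorProduct.smul_tmul]⟩
  have hsum : ∀ t : ∀ j, T j, ∑ j, TensorProduct.lift ((p j).app V' (h'.trans h)) (t j) =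
      TensorProduct.lift ((p j₀).app V' (h'.trans h)) (t j₀) := fun t =>
    Finset.sum_eq_single j₀ (fun j _ hj => by rw [hsub j hj (t j), map_zero])
      fun h => absurd (Finset.mem_univ j₀) h
  constructor
  · intro t t' htt
    funext j
    by_cases hj : j = j₀
    · subst hj
      have h3 := (hsum t).symm.trans (htt.trans (hsum t'))
      obtain ⟨σ, hσ⟩ := hspan (t j)
      obtain ⟨σ', hσ'⟩ := hspan (t' j)
      rw [hσ, hσ', TensorProduct.lift.tmul, TensorProduct.lift.tmul] at h3
      have h4 := (hp j V' (h'.trans h) ψ.hom σ).symm.trans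
        (h3.trans (hp j V' (h'.trans h) ψ.hom σ'))
      rw [hσ, hσ', (cancel_mono ψ.hom).1 h4]
    · exact (hsub j hj (t j)).trans (hsub j hj (t' j)).symm
  · intro σ
    let σ' : B.rs (((h'.trans h).trans h₃).trans k₅) b ⟶
      B.rs (((h'.trans h).trans h₃).trans k₆) a := σ
    let t₀ : T j₀ := ψ' ⊗ₜ (show B.rs _ b ⟶ B.rs _ (d j₀) from σ' ≫ ψ.inv)
    refine ⟨Function.update (fun _ => 0) j₀ t₀, (hsum _).trans ?_⟩
    rw [Function.update_self]
    refine (TensorProduct.lift.tmul _ _).trans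
      ((hp j₀ V' (h'.trans h) ψ.hom (σ' ≫ ψ.inv)).trans ?_)
    exact (Category.assoc _ _ _).trans
      ((congrArg (σ' ≫ ·) ψ.inv_hom_id).trans (Category.comp_id σ'))

end CardyFibration

end FunAlg

/-! ### The 2-vector bundle of a system of simple labels -/

namespace FunAlg

variable {X : Type u} [TopologicalSpace X] {A : FunAlg X}

/-- Idempotent functions on connected sets are constant, by continuity. -/
theorem IsLocal.eq_zero_or_one (hA : A.IsLocal) {U : Opens X} (hU : IsPreconnected (U : Set X))
    {c : A.Fn U} (hc : c * c = c) : c = 0 ∨ c = 1 := by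
  have : PreconnectedSpace U := isPreconnected_iff_preconnectedSpace.1 hU
  have hcont : Continuous c.1 := hA.cont U _ c.2
  have h01 : ∀ y, c.1 y = 0 ∨ c.1 y = 1 := fun y => by
    have h1 : c.1 y * c.1 y = c.1 y := congrFun (congrArg Subtype.val hc) y
    rcases eq_or_ne (c.1 y) 0 with h | h
    · exact Or.inl h
    · exact Or.inr (mul_right_cancel₀ h (h1.trans (one_mul _).symm))
  have hclopen : IsClopen (c.1 ⁻¹' {0}) := by
    refine ⟨isClosed_singleton.preimage hcont, ?_⟩
    have h1 : c.1 ⁻¹' {0} = (c.1 ⁻¹' {1})ᶜ := by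
      ext y
      rcases h01 y with h | h <;> simp [h]
    rw [h1]
    exact (isClosed_singleton.preimage hcont).isOpen_compl
  rcases isClopen_iff.1 hclopen with h | h
  · refine Or.inr (Subtype.ext (funext fun y => (h01 y).resolve_left fun h0 => ?_))
    have : y ∈ c.1 ⁻¹' {0} := h0
    rwa [h] at this
  · refine Or.inl (Subtype.ext (funext fun y => ?_))
    have : y ∈ c.1 ⁻¹' {0} := h ▸ Set.mem_univ y
    exact this

/-- Over a nonempty connected open set, two frames of orthogonal idempotents differ by a
permutation. -/
theorem FMan.IsIdempotentFrame.exists_perm {S : A.FMan} {n : ℕ} (hA : A.IsLocal) {U : Opens X}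
    (hU : IsPreconnected (U : Set X)) {x : X} (hx : x ∈ U) {ε ε' : Fin n → A.VField U}
    (hε : S.IsIdempotentFrame ε) (hε' : S.IsIdempotentFrame ε') :
    ∃ π : Equiv.Perm (Fin n), ∀ i, ε i = ε' (π i) := by
  have := nontrivial_Fn (A := A) hx
  have h01 : ∀ {ε ε' : Fin n → A.VField U} (hε : S.IsIdempotentFrame ε)
      (hε' : S.IsIdempotentFrame ε') i j,
      hε.coeff i le_rfl (ε' j) = 0 ∨ hε.coeff i le_rfl (ε' j) = 1 := fun hε hε' i j =>
    hA.eq_zero_or_one hU (by rw [← hε.coeff_mul, hε'.mul_self])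
  have hself : ∀ i, hε.coeff i le_rfl (ε i) = 1 := fun i => by
    have := hε.coeff_smul_ε i le_rfl 1
    rwa [one_smul] at this
  have hne : ∀ i, ε i ≠ 0 := fun i h => by
    have := hself i
    rw [h, map_zero] at this
    exact zero_ne_one this
  have hex : ∀ i, ∃ j, ε i = ε' j := by
    intro i
    have h1 : ∑ j, hε.coeff i le_rfl (ε' j) = 1 := by
      rw [← map_sum, hε'.sum_eq, hε.coeff_one]
    obtain ⟨j, -, hj⟩ := Finset.exists_ne_zero_of_sum_ne_zero (h1.trans_ne one_ne_zero)
    have h2 : S.mul U (ε' j) (ε i) = hε.coeff i le_rfl (ε' j) • ε i := hε.mul_ε i le_rfl (ε' j)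
    have h3 : S.mul U (ε' j) (ε i) = hε'.coeff j le_rfl (ε i) • ε' j := hε'.ε_mul j le_rfl (ε i)
    rw [(h01 hε hε' i j).resolve_left hj, one_smul] at h2
    rw [h2] at h3
    refine ⟨j, ?_⟩
    rcases h01 hε' hε j i with h | h
    · rw [h, zero_smul] at h3
      exact absurd h3 (hne i)
    · rwa [h, one_smul] at h3
  choose f hf using hex
  have hinj : Function.Injective f := by
    intro i j hij
    by_contra hne'
    have h1 : ε i = ε j := by rw [hf i, hf j, hij]
    have h2 := hε.mul_ne i j hne'
    rw [← h1, hε.mul_self] at h2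
    exact hne i h2
  exact ⟨Equiv.ofBijective f (Finite.injective_iff_bijective.1 hinj), hf⟩

theorem exists_isPreconnected_le [LocallyConnectedSpace X] {U : Opens X} {x : X} (hx : x ∈ U) :
    ∃ V : Opens X, V ≤ U ∧ x ∈ V ∧ IsPreconnected (V : Set X) :=
  ⟨⟨connectedComponentIn U x, U.isOpen.connectedComponentIn⟩, connectedComponentIn_subset U x,
    mem_connectedComponentIn hx, isPreconnected_connectedComponentIn⟩

/-- Two frames of orthogonal idempotents locally differ by a permutation. -/
theorem FMan.IsIdempotentFrame.exists_perm_res [LocallyConnectedSpace X] {S : A.FMan} {n : ℕ}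
    (hA : A.IsLocal) {U₁ U₂ W : Opens X} {ε₁ : Fin n → A.VField U₁} {ε₂ : Fin n → A.VField U₂}
    (hε₁ : S.IsIdempotentFrame ε₁) (hε₂ : S.IsIdempotentFrame ε₂) (h₁ : W ≤ U₁) (h₂ : W ≤ U₂)
    {x : X} (hx : x ∈ W) : ∃ (V : Opens X) (h : V ≤ W), x ∈ V ∧ ∃ π : Equiv.Perm (Fin n),
      ∀ i, VField.res (h.trans h₁) (ε₁ i) = VField.res (h.trans h₂) (ε₂ (π i)) := by
  obtain ⟨V, h, hxV, hV⟩ := exists_isPreconnected_le hx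
  exact ⟨V, h, hxV, (hε₁.restrict (h.trans h₁)).exists_perm hA hV hxV (hε₂.restrict (h.trans h₂))⟩

/-- The matrix of the permutation `π`, with entries `1` at the places `(i, π i)`. -/
def permRank {n : ℕ} (π : Equiv.Perm (Fin n)) : Matrix (Fin n) (Fin n) ℕ :=
  Matrix.of fun i j => if j = π i then 1 else 0

theorem det_permRank {n : ℕ} (π : Equiv.Perm (Fin n)) :
    ((permRank π).map (Nat.cast : ℕ → ℤ)).det = 1 ∨
      ((permRank π).map (Nat.cast : ℕ → ℤ)).det = -1 := by
  have h1 : (permRank π).map (Nat.cast : ℕ → ℤ) = (π.toPEquiv.toMatrix : Matrix _ _ ℤ) := by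
    ext i j
    simp [permRank, PEquiv.toMatrix_apply, eq_comm]
  rw [h1, Matrix.det_permutation]
  rcases Int.units_eq_one_or (Equiv.Perm.sign π) with h | h <;> simp [h]

namespace CardyFibration

variable {S : A.FMan} {g : S.Metric} {B : CardyFibration.{u, w} g} {n : ℕ}

/-- The sheaves of morphisms between two families of simple labels whose supports differ by the
permutation `π` form, up to invertible sheaves, the matrix of `π`. -/
theorem IsSimple.hasRank_permRank (hA : A.IsLocal) {U₁ U₂ W : Opens X} {h₁ : W ≤ U₁} {h₂ : W ≤ U₂}
    {ε₁ : Fin n → A.VField U₁} {ε₂ : Fin n → A.VField U₂} (hε₂ : S.IsIdempotentFrame ε₂)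
    {a : Fin n → B.Lab U₁} {d : Fin n → B.Lab U₂} (ha : ∀ i, B.IsSimple (a i) (ε₁ i))
    (hd : ∀ i, B.IsSimple (d i) (ε₂ i)) {π : Equiv.Perm (Fin n)}
    (hπ : ∀ i, VField.res h₁ (ε₁ i) = VField.res h₂ (ε₂ (π i))) (i j : Fin n) :
    (B.Γ (d j) (a i) W h₂ h₁).HasRank (permRank π i j) := by
  by_cases hj : j = π i
  · subst hj
    have h3 : permRank π i (π i) = 1 := if_pos rfl
    rw [h3]
    exact B.hasRank_one (hd _) fun x hx => (hd _).exists_iso hA (ha i) h₂ h₁ (hε₂.restrict h₂)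
      rfl (hπ i) hx
  · have h3 : permRank π i j = 0 := if_neg hj
    rw [h3]
    refine B.hasRank_zero fun V h σ => (hd j).eq_zero (ha i) (h.trans h₂) (h.trans h₁) ?_ σ
    have h4 : VField.res (h.trans h₁) (ε₁ i) = VField.res (h.trans h₂) (ε₂ (π i)) :=
      congrArg (VField.res h) (hπ i)
    rw [h4]
    exact (hε₂.restrict (h.trans h₂)).mul_ne j (π i) hj

/-- Composition induces an isomorphism `⨁ j, Γ(d_j, a) ⊗ Γ(b, d_j) ≅ Γ(b, a)` if `a` and the `d_j`
are simple and, locally, the support of `a` is that of one of the `d_j` and orthogonal to those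
of the others. -/
theorem isTensorIso_of_isSimple (hA : A.IsLocal) {J : Type} [Fintype J] {U₁ U₂ U₃ W W₃ : Opens X}
    {W₁ W₂ : J → Opens X} {a : B.Lab U₁} {b : B.Lab U₂} {d : J → B.Lab U₃}
    {k₁ : ∀ j, W₁ j ≤ U₃} {k₂ : ∀ j, W₁ j ≤ U₁} {k₃ : ∀ j, W₂ j ≤ U₂} {k₄ : ∀ j, W₂ j ≤ U₃}
    {k₅ : W₃ ≤ U₂} {k₆ : W₃ ≤ U₁} {h₁ : ∀ j, W ≤ W₁ j} {h₂ : ∀ j, W ≤ W₂ j} {h₃ : W ≤ W₃}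
    (p : ∀ j, Mod.Pairing (B.Γ (d j) a (W₁ j) (k₁ j) (k₂ j)) (B.Γ b (d j) (W₂ j) (k₃ j) (k₄ j))
      (B.Γ b a W₃ k₅ k₆) W (h₁ j) (h₂ j) h₃)
    (hp : ∀ j V (h : V ≤ W)
      (τ : B.rs ((h.trans (h₁ j)).trans (k₁ j)) (d j) ⟶ B.rs ((h.trans (h₁ j)).trans (k₂ j)) a)
      (σ : B.rs ((h.trans (h₂ j)).trans (k₃ j)) b ⟶ B.rs ((h.trans (h₂ j)).trans (k₄ j)) (d j)),
        (p j).app V h τ σ = σ ≫ τ)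
    {Y : A.VField U₁} {Z : J → A.VField U₃} (ha : B.IsSimple a Y) (hd : ∀ j, B.IsSimple (d j) (Z j))
    {q₁ : W ≤ U₁} {q₃ : W ≤ U₃} {ε : Fin n → A.VField U₃} (hε : S.IsIdempotentFrame ε)
    (f : J → Fin n) (hf : Function.Injective f) (hZ : ∀ j, Z j = ε (f j))
    (H : ∀ x ∈ W, ∃ (V : Opens X) (h : V ≤ W), x ∈ V ∧ ∃ j₀,
      VField.res (h.trans q₁) Y = VField.res (h.trans q₃) (Z j₀)) :
    Mod.IsTensorIso p := by
  refine B.isTensorIso p hp fun x hx => ?_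
  obtain ⟨V, h, hxV, j₀, hj₀⟩ := H x hx
  obtain ⟨V', h', hxV', hφ⟩ := (hd j₀).exists_iso hA ha (h.trans q₃) (h.trans q₁)
    (hε.restrict (h.trans q₃)) (i := f j₀) (by rw [hZ]) (by rw [hj₀, hZ]) hxV
  refine ⟨V', h'.trans h, hxV', j₀, fun j hj V'' h'' σ => ?_, fun V'' h'' => (hd j₀).bij V'' _, hφ⟩
  refine (hd j).eq_zero ha (h''.trans ((h'.trans h).trans q₃)) (h''.trans ((h'.trans h).trans q₁))
    ?_ σ
  have h4 : VField.res (h''.trans ((h'.trans h).trans q₁)) Y =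
      VField.res (h''.trans ((h'.trans h).trans q₃)) (Z j₀) :=
    congrArg (VField.res (h''.trans h')) hj₀
  rw [h4, hZ, hZ]
  exact (hε.restrict _).mul_ne _ _ fun h => hj (hf h)

end CardyFibration

namespace SimpleLabels

variable {S : A.FMan} {g : S.Metric} {B : CardyFibration.{u, w} g} {n : ℕ}

theorem isSimple (D : SimpleLabels B n) (α : D.cover.ι) (i : Fin n) :
    B.IsSimple (D.ξ α i) (D.ε α i) := by
  obtain ⟨m, hm⟩ := D.simple α i
  exact CardyFibration.IsSimple.of_hom (D.supported α i) m hm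

theorem isTwoVectorBundle (hA : A.IsLocal) (D : SimpleLabels B n) :
    D.transition.IsTwoVectorBundle where
  isSheaf h i j := B.isSheaf_Γ _ _ inf_le_right inf_le_left
  rank {α β} h := ⟨permRank (D.perm α β), fun i j =>
    CardyFibration.IsSimple.hasRank_permRank hA (D.frame β) (D.isSimple α) (D.isSimple β)
      (D.perm_spec α β) i j, det_permRank _⟩
  iso {α β γ} h h' i k :=
    CardyFibration.isTensorIso_of_isSimple hA (k₁ := fun _ => inf_le_right)
      (k₂ := fun _ => inf_le_left) (k₃ := fun _ => inf_le_right) (k₄ := fun _ => inf_le_left)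
      (k₅ := inf_le_right) (k₆ := inf_le_left) _ (fun _ _ _ _ _ => rfl) (D.isSimple α i)
      (D.isSimple β) (q₁ := inf_le_left.trans inf_le_left) (q₃ := inf_le_left.trans inf_le_right)
      (D.frame β) id Function.injective_id (fun _ => rfl) fun x hx =>
        ⟨_, le_rfl, hx, D.perm α β i, congrArg (VField.res inf_le_left) (D.perm_spec α β i)⟩
  assoc h h' h'' i j k l V hα hβ hγ hδ x y z := (Category.assoc _ _ _).symm

theorem hasRank_transition (hA : A.IsLocal) (D : SimpleLabels B n) {α β : D.cover.ι} (h : α < β)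
    (i j : Fin n) : (D.transition.E h i j).HasRank (permRank (D.perm α β) i j) :=
  CardyFibration.IsSimple.hasRank_permRank hA (D.frame β) (D.isSimple α) (D.isSimple β)
      (D.perm_spec α β) i j

theorem isTensor_transition (hA : A.IsLocal) (D : SimpleLabels B n) {α β : D.cover.ι} (h : α < β)
    (i : Fin n) : B.IsTensor (D.transition.E h i (D.perm α β i)) (D.ξ β (D.perm α β i)) (D.ξ α i)
      inf_le_right inf_le_left :=
  ⟨⟨fun _ _ => LinearMap.id, fun _ _ _ => rfl⟩, fun V hV b =>
    CardyFibration.isTensorIso_of_isSimple hA (k₁ := fun _ => inf_le_right)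
      (k₂ := fun _ => inf_le_left) (k₃ := fun _ => le_rfl) (k₄ := fun _ => hV.trans inf_le_right)
      (k₅ := le_rfl) (k₆ := hV.trans inf_le_left) _ (fun _ _ _ _ _ => rfl) (D.isSimple α i)
      (fun _ => D.isSimple β (D.perm α β i)) (q₁ := hV.trans inf_le_left)
      (q₃ := hV.trans inf_le_right) (D.frame β) (fun _ => D.perm α β i)
      (fun _ _ _ => rfl) (fun _ => rfl) fun x hx =>
        ⟨_, le_rfl, hx, (), congrArg (VField.res hV) (D.perm_spec α β i)⟩⟩

/-- The equivalence is the matrix `T_ij = Γ(ξ'_j, ξ_i)` of the sheaves of morphisms between the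
labels of the two systems. -/
theorem transition_equivalent [LocallyConnectedSpace X] (hA : A.IsLocal) (D D' : SimpleLabels B n) :
    D.transition.Equivalent D'.transition := by
  refine ⟨fun α β i j => B.Γ (D'.ξ β j) (D.ξ α i) _ inf_le_right inf_le_left,
    fun {α α'} h β i j k => B.comp (D'.ξ β k) (D.ξ α' j) (D.ξ α i) _ _ _ _ inf_le_right
      inf_le_left inf_le_right inf_le_left inf_le_right inf_le_left inf_le_left
      (inf_le_inf_right _ inf_le_right) (inf_le_inf_right _ inf_le_left),
    fun α {β β'} h i j k => B.comp (D'.ξ β' k) (D'.ξ β j) (D.ξ α i) _ _ _ _ inf_le_right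
      inf_le_left inf_le_right inf_le_left inf_le_right inf_le_left inf_le_left
      (inf_le_inf_right _ inf_le_right) (inf_le_inf_right _ inf_le_left),
    fun α β i j => B.isSheaf_Γ _ _ inf_le_right inf_le_left, fun α β x hx => ?_,
    fun {α α'} h β i k => ?_,
    fun α {β β'} h i k => ?_,
    by intros; exact (Category.assoc _ _ _).symm, by intros; exact (Category.assoc _ _ _).symm,
    by intros; exact (Category.assoc _ _ _).symm⟩
  · obtain ⟨V, h, hxV, π, hπ⟩ := (D.frame α).exists_perm_res hA (D'.frame β) inf_le_left
      inf_le_right hx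
    exact ⟨V, h, hxV, permRank π, fun i j => CardyFibration.IsSimple.hasRank_permRank hA
      (D'.frame β) (D.isSimple α) (D'.isSimple β) hπ i j, det_permRank π⟩
  · refine CardyFibration.isTensorIso_of_isSimple hA (k₁ := fun _ => inf_le_right)
      (k₂ := fun _ => inf_le_left) (k₃ := fun _ => inf_le_right) (k₄ := fun _ => inf_le_left)
      (k₅ := inf_le_right) (k₆ := inf_le_left) _ (fun _ _ _ _ _ => rfl) (D.isSimple α i)
      (D.isSimple α') (q₁ := inf_le_left.trans inf_le_left) (q₃ := inf_le_left.trans inf_le_right)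
      (D.frame α') id Function.injective_id (fun _ => rfl) fun x hx =>
        ⟨_, le_rfl, hx, D.perm α α' i, congrArg (VField.res inf_le_left) (D.perm_spec α α' i)⟩
  · refine CardyFibration.isTensorIso_of_isSimple hA (k₁ := fun _ => inf_le_right)
      (k₂ := fun _ => inf_le_left) (k₃ := fun _ => inf_le_right) (k₄ := fun _ => inf_le_left)
      (k₅ := inf_le_right) (k₆ := inf_le_left) _ (fun _ _ _ _ _ => rfl) (D.isSimple α i)
      (D'.isSimple β) (q₁ := inf_le_left.trans inf_le_left) (q₃ := inf_le_left.trans inf_le_right)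
      (D'.frame β) id Function.injective_id (fun _ => rfl) fun x hx => ?_
    obtain ⟨V, h, hxV, π, hπ⟩ := (D.frame α).exists_perm_res hA (D'.frame β)
      (inf_le_left.trans inf_le_left) (inf_le_left.trans inf_le_right) hx
    exact ⟨V, h, hxV, π i, hπ i⟩

end SimpleLabels

end FunAlg

/-! ### Existence of simple labels -/

namespace FunAlg

variable {X : Type u} [TopologicalSpace X] {A : FunAlg X}

namespace EnrCat

variable {U : Opens X} {C D : A.EnrCat.{u, w} U} {S : A.FMan} {g : S.Metric} {n : ℕ}

/-- Composition of sections over an open set `V`, where `h : V ≤ U`. -/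
local notation:75 τ:76 " ∘[" h "] " σ:75 => Mod.Pairing.app (EnrCat.comp _ _ _ _) _ h τ σ

theorem bijective_smul_one_of_iso {a b : C.Obj} {V : Opens X} {h : V ≤ U}
    {σ : (C.Γ a b).sec V h} {τ : (C.Γ b a).sec V h} (hτσ : τ ∘[h] σ = C.one a V h)
    (hστ : σ ∘[h] τ = C.one b V h)
    (ha : Function.Bijective fun f : A.Fn V => f • C.one a V h) :
    Function.Bijective fun f : A.Fn V => f • C.one b V h := by
  have h1 : ∀ f : A.Fn V, τ ∘[h] ((f • C.one b V h) ∘[h] σ) = f • C.one a V h := fun f => by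
    rw [map_smul, LinearMap.smul_apply, C.one_comp, map_smul, hτσ]
  refine ⟨fun f f' hf => ha.injective ?_, fun z => ?_⟩
  · simp only at hf ⊢
    rw [← h1, ← h1, hf]
  · obtain ⟨f, hf⟩ := ha.surjective (τ ∘[h] (z ∘[h] σ))
    simp only at hf
    refine ⟨f, ?_⟩
    have h2 : σ ∘[h] ((τ ∘[h] (z ∘[h] σ)) ∘[h] τ) = z := by
      rw [C.assoc, C.assoc, hστ, C.comp_one, ← C.assoc, hστ, C.one_comp]
    simp only
    rw [← h2, ← hf, map_smul, LinearMap.smul_apply, C.one_comp, map_smul, hστ]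

/-- If a maximal Cardy category embeds into one which has an object with endomorphisms `𝒪` on which
`Y` acts as the identity, then it has such an object itself. -/
theorem CardyStr.IsMaximal.exists_simple {c : C.CardyStr g} (hc : c.IsMaximal) {d : D.CardyStr g}
    (J : Embedding c d) (y : D.Obj) (Y : A.VField U)
    (hy : ∀ V (h : V ≤ U), Function.Bijective fun f : A.Fn V => f • D.one y V h)
    (hY : d.iotaSec y le_rfl Y = D.one y U le_rfl) :
    ∃ a : C.Obj, c.iotaSec a le_rfl Y = C.one a U le_rfl ∧
      ∀ V (h : V ≤ U), Function.Bijective fun f : A.Fn V => f • C.one a V h := by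
  obtain ⟨a, σ, τ, hτσ, hστ⟩ := hc D d J y
  refine ⟨a, (J.bij a a U le_rfl).injective ?_, fun V h => ?_⟩
  · rw [J.map_one]
    refine (J.map_iota a U le_rfl Y).trans ?_
    change d.iotaSec (J.obj a) le_rfl Y = _
    rw [← D.comp_one _ _ U le_rfl (d.iotaSec (J.obj a) le_rfl Y), ← hστ, ← D.assoc,
      ← d.comp_iotaSec, hY, D.comp_one]
  · have h1 := bijective_smul_one_of_iso (C := D) (h := h) (σ := (D.Γ _ _).res le_rfl h σ)
      (τ := (D.Γ _ _).res le_rfl h τ) (by rw [← D.res_comp, hτσ, D.one_res])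
      (by rw [← D.res_comp, hστ, D.one_res]) (hy V h)
    have h2 : (fun f : A.Fn V => f • D.one (J.obj a) V h) =
        (J.map a a).app V h ∘ fun f : A.Fn V => f • C.one a V h := by
      funext f
      rw [Function.comp_apply, map_smul, J.map_one]
    rw [h2] at h1
    exact (Function.Bijective.of_comp_iff' (J.bij a a V h) _).1 h1

/-- If `ε i` acts as zero on all objects of a maximal Cardy category and `θ(ε i)` is a square, then
an isolated object supported on `ε i` can be adjoined, so that the category has such an object. -/
theorem CardyStr.IsMaximal.exists_simple_of_isolated {c : C.CardyStr g} (hc : c.IsMaximal)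
    (hA : A.IsLocal) {ε : Fin n → A.VField U} (hε : S.IsIdempotentFrame ε) (i : Fin n)
    {l : A.Fn U} (hl : l * l = g.θ U (ε i)) (H : ∀ a, c.iotaSec a le_rfl (ε i) = 0) :
    ∃ a : C.Obj, c.iotaSec a le_rfl (ε i) = C.one a U le_rfl ∧
      ∀ V (h : V ≤ U), Function.Bijective fun f : A.Fn V => f • C.one a V h := by
  obtain ⟨m, hm⟩ := (isUnit_of_mul_isUnit_left (hl ▸ hε.isUnit_θ g i)).exists_left_inv
  refine hc.exists_simple (isolatedEmbedding c hε i hA hl hm H) none (ε i) (fun V h => ?_) ?_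
  · have h1 : (fun f : A.Fn V => f • C.isolated.one none V h) = (id : A.Fn V → A.Fn V) :=
      funext fun f => mul_one f
    rw [h1]
    exact Function.bijective_id
  · have h1 := hε.coeff_smul_ε i le_rfl 1
    rw [one_smul] at h1
    exact h1

/-- In a maximal Cardy category, an idempotent `p` with `p Γ_aa p = 𝒪 p` on which `Y` acts as the
identity gives rise to a simple object, its image. -/
theorem CardyStr.IsMaximal.exists_simple_of_idempotent {c : C.CardyStr g} (hc : c.IsMaximal)
    (hA : A.IsLocal) {a : C.Obj} {p : (C.Γ a a).sec U le_rfl} (hp : p ∘[le_rfl] p = p)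
    {Y : A.VField U} (hY : p ∘[le_rfl] c.iotaSec a le_rfl Y = p)
    (H : ∀ (V : Opens X) (h : V ≤ U) (z : (C.Γ a a).sec V h),
        ∃! f : A.Fn V, ((C.Γ a a).res le_rfl h p ∘[h] z) ∘[h] (C.Γ a a).res le_rfl h p =
          f • (C.Γ a a).res le_rfl h p) :
    ∃ a : C.Obj, c.iotaSec a le_rfl Y = C.one a U le_rfl ∧
      ∀ V (h : V ≤ U), Function.Bijective fun f : A.Fn V => f • C.one a V h := by
  let I := IdempotentFamily.adjoin a p hp
  refine hc.exists_simple (IdempotentFamily.adjoinEmbedding c a p hp hA) none Y (fun V h => ?_)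
    (Subtype.ext ?_)
  · constructor
    · intro f f' hff
      have h1 : f • I.pr none h = f' • I.pr none h := congrArg Subtype.val hff
      obtain ⟨f₀, -, hf₀⟩ := H V h (f • I.pr none h)
      have h2 : ∀ k : A.Fn V, (I.pr none h ∘[h] (k • I.pr none h)) ∘[h] I.pr none h =
          k • I.pr none h := fun k => by
        rw [map_smul, map_smul, LinearMap.smul_apply, I.pr_pr, I.pr_pr]
      exact (hf₀ f (h2 f)).trans (hf₀ f' ((h2 f).trans h1)).symm
    · rintro ⟨z, hz₁, hz₂⟩
      obtain ⟨f, hf, -⟩ := H V h z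
      have h1 : (I.pr none h ∘[h] z) ∘[h] I.pr none h = f • I.pr none h := hf
      refine ⟨f, Subtype.ext ?_⟩
      rw [hz₁, hz₂] at h1
      exact h1.symm
  · change (C.Γ a a).res le_rfl le_rfl p ∘[le_rfl] c.iotaSec a le_rfl Y =
      (C.Γ a a).res le_rfl le_rfl p
    rw [Mod.res_id, hY]

end EnrCat

namespace CardyFibration

variable {S : A.FMan} {g : S.Metric} {B : CardyFibration.{u, w} g} {n : ℕ}

theorem IsSimple.rs {U V : Opens X} {a : B.Lab U} {Y : A.VField U} (ha : B.IsSimple a Y)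
    (h : V ≤ U) : B.IsSimple (B.rs h a) (VField.res h Y) where
  supported := by
    apply (B.conjEquiv h h le_rfl a a).injective
    rw [B.conjEquiv_ιL, B.conjEquiv_id]
    exact ha.ιL_res h
  bij W hW := ha.bij_rs h hW

/-- Near every point, some simple label is supported on `ε i`.  Over a connected neighbourhood,
`ι_a(ε i)` is either zero for all labels `a`, and an isolated object can be adjoined, or without
zeros for some label `a`, and a rank one idempotent below it has an image. -/
theorem IsMaximal.exists_isSimple [LocallyConnectedSpace X] (hA : A.IsLocal) (hB : B.IsMaximal n)
    {U₀ : Opens X} {ε : Fin n → A.VField U₀} (hε : S.IsIdempotentFrame ε) (i : Fin n) {x : X}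
    (hx : x ∈ U₀) : ∃ (V : Opens X) (h : V ≤ U₀), x ∈ V ∧
      ∃ a : B.Lab V, B.IsSimple a (VField.res h (ε i)) := by
  obtain ⟨U₁, h₁, hx₁, l, hl⟩ := IsLocal.exists_sqrt hA hx
    (((hε.isUnit_θ g i).map (ev hx)).ne_zero)
  obtain ⟨U, hU, hxU, hUc⟩ := exists_isPreconnected_le hx₁
  have hU₀ : U ≤ U₀ := hU.trans h₁
  have hεU := hε.restrict hU₀
  by_cases H : ∀ a : B.Lab U, (B.cardy U).iotaSec a le_rfl (VField.res hU₀ (ε i)) = 0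
  · obtain ⟨a, ha, hb⟩ := (hB U ⟨_, hεU⟩).exists_simple_of_isolated hA hεU i
      (l := A.res hU l) (by rw [← map_mul, hl, ← g.θ_res hU₀]; rfl) H
    exact ⟨U, hU₀, hxU, a, ha, hb⟩
  · push Not at H
    obtain ⟨a, ha⟩ := H
    have hidem := (B.cardy U).iotaSec_comp hεU le_rfl a i i
    rw [if_pos rfl] at hidem
    obtain ⟨V, hV, hxV, p, hpp, hpi, hp⟩ := (B.cardy U).exists_rankOne_idempotent hA hεU a i hxU
      fun V hV hx r s hs => by
        have := (B.cardy U).ev_coord_ne_zero_of_isPreconnected hA hUc hidem ha hx hs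
        exact (congrArg (fun e => ∃ k, ev hx (hs.coord le_rfl e k) ≠ 0)
          ((B.cardy U).res_iotaSec a le_rfl hV (VField.res hU₀ (ε i)))).mp this
    -- `p` as an endomorphism of the label `a|_V` over `V`, to which maximality over `V` applies
    let E := fun (W : Opens X) (hW : W ≤ V) => B.conjEquiv hV hV hW a a
    let p' : B.rs le_rfl (B.rs hV a) ⟶ B.rs le_rfl (B.rs hV a) := (E V le_rfl).symm p
    have hEp : E V le_rfl p' = p := (E V le_rfl).apply_symm_apply p
    have hEp' : ∀ (W : Opens X) (hW : W ≤ V), E W hW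
        (((B.enr V).Γ (B.rs hV a) (B.rs hV a)).res le_rfl hW p') =
          ((B.enr U).Γ a a).res hV hW p := fun W hW => by
      rw [← hEp]
      exact (B.res_conjEquiv hV hV le_rfl hW a a p').symm
    obtain ⟨b, hb, hb'⟩ := (hB V ⟨_, hε.restrict (hV.trans hU₀)⟩).exists_simple_of_idempotent hA
      (a := B.rs hV a) (p := p') (Y := VField.res (hV.trans hU₀) (ε i))
      ((E V le_rfl).injective (by
        refine (B.conjEquiv_comp hV hV hV le_rfl p' p').trans ?_
        exact hEp.symm ▸ hpp))
      ((E V le_rfl).injective (by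
        refine (B.conjEquiv_comp hV hV hV le_rfl (B.ιL (B.rs hV a) le_rfl _) p').trans ?_
        rw [B.conjEquiv_ιL]
        exact hEp.symm ▸ hpi))
      (fun W hW z => by
        obtain ⟨f, hf, hf'⟩ := hp W hW (E W hW z)
        have key : ∀ k : A.Fn W,
            ((((B.enr V).comp _ _ _).app W hW ((((B.enr V).comp _ _ _).app W hW
              (((B.enr V).Γ (B.rs hV a) (B.rs hV a)).res le_rfl hW p') z))
              (((B.enr V).Γ (B.rs hV a) (B.rs hV a)).res le_rfl hW p')) =
              k • ((B.enr V).Γ (B.rs hV a) (B.rs hV a)).res le_rfl hW p') ↔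
            ((((B.enr U).comp _ _ _).app W (hW.trans hV) ((((B.enr U).comp _ _ _).app W
              (hW.trans hV) (((B.enr U).Γ a a).res hV hW p) (E W hW z)))
              (((B.enr U).Γ a a).res hV hW p)) = k • ((B.enr U).Γ a a).res hV hW p) := by
          intro k
          refine (E W hW).injective.eq_iff.symm.trans
            (Iff.of_eq (congrArg₂ Eq ?_ ((map_smul (E W hW) k _).trans ?_)))
          · let P : B.rs hW (B.rs hV a) ⟶ B.rs hW (B.rs hV a) :=
              ((B.enr V).Γ (B.rs hV a) (B.rs hV a)).res le_rfl hW p'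
            let z' : B.rs hW (B.rs hV a) ⟶ B.rs hW (B.rs hV a) := z
            have h1 : B.conjEquiv hV hV hW a a (P ≫ z' ≫ P) =
                B.conjEquiv hV hV hW a a P ≫ B.conjEquiv hV hV hW a a z' ≫
                  B.conjEquiv hV hV hW a a P := by
              rw [B.conjEquiv_comp, B.conjEquiv_comp]
            have h2 : B.conjEquiv hV hV hW a a P = ((B.enr U).Γ a a).res hV hW p := hEp' W hW
            rw [h2] at h1
            exact h1
          · exact congrArg (k • ·) (hEp' W hW)
        exact ⟨f, (key f).2 hf, fun k hk => hf' k ((key k).1 hk)⟩)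
    exact ⟨V, hV.trans hU₀, hxV, b, hb, hb'⟩

/-- Every point has a semisimple neighbourhood with a complete set of simple labels. -/
theorem IsMaximal.exists_simple_labels [LocallyConnectedSpace X] (hA : A.IsLocal)
    (hS : S.IsSemisimple n) (hB : B.IsMaximal n) (x : X) :
    ∃ (V : Opens X) (ε : Fin n → A.VField V), x ∈ V ∧ S.IsIdempotentFrame ε ∧
      ∃ ξ : Fin n → B.Lab V, ∀ i, B.IsSimple (ξ i) (ε i) := by
  obtain ⟨U, hxU, ε, hε⟩ := hS x
  obtain ⟨V, hV, hxV, H⟩ := IsLocal.exists_forall_le hxU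
    (fun i V => ∃ (h : V ≤ U) (a : B.Lab V), B.IsSimple a (VField.res h (ε i)))
    (fun i V V' h ⟨hV, a, ha⟩ => ⟨h.trans hV, B.rs h a, ha.rs h⟩)
    (fun i => by
      obtain ⟨V, h, hxV, a, ha⟩ := hB.exists_isSimple hA hε i hxU
      exact ⟨V, h, hxV, h, a, ha⟩)
  choose _ ξ hξ using H
  exact ⟨V, _, hxV, hε.restrict hV, ξ, hξ⟩

end CardyFibration

end FunAlg

/-! ### Covers by connected semisimple sets -/

/-- Barycentric refinements by connected sets: an open cover of a locally connected paracompact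
Hausdorff space has a refinement by connected open sets `U x ∋ x` such that any two members which
meet are contained in a common member of the cover. -/
theorem exists_connected_barycentric_refinement {X : Type*} [TopologicalSpace X] [T2Space X]
    [ParacompactSpace X] [LocallyConnectedSpace X] (V : X → Opens X) (hV : ∀ x, x ∈ V x) :
    ∃ U : X → Opens X, (∀ x, x ∈ U x) ∧ (∀ x, IsPreconnected (U x : Set X)) ∧
      (∀ x, ∃ s, U x ≤ V s) ∧ ∀ x y z, z ∈ U x → z ∈ U y → ∃ s, U x ≤ V s ∧ U y ≤ V s := by
  obtain ⟨u, huo, huU, hulf, huV⟩ := precise_refinement (fun x => (V x : Set X))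
    (fun x => (V x).isOpen) (Set.iUnion_eq_univ_iff.2 fun x => ⟨x, hV x⟩)
  obtain ⟨v, hvU, -, hvu⟩ := exists_iUnion_eq_closure_subset huo hulf.point_finite huU
  have hlf : LocallyFinite fun s => closure (v s) := hulf.subset hvu
  let W : X → Opens X := fun x =>
    { carrier := (⋂ s ∈ {s | x ∈ closure (v s)}, u s) ∩
        (⋃ s : {s // x ∉ closure (v s)}, closure (v s.1))ᶜ
      is_open' := ((hlf.point_finite x).isOpen_biInter fun s _ => huo s).inter
        ((hlf.comp_injective Subtype.val_injective).isClosed_iUnion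
          fun s => isClosed_closure).isOpen_compl }
  have hW : ∀ x, x ∈ W x := fun x => by
    refine ⟨Set.mem_iInter₂.2 fun s hs => hvu s hs, fun hx => ?_⟩
    obtain ⟨s, hs⟩ := Set.mem_iUnion.1 hx
    exact s.2 hs
  -- a member of the closed shrinking which contains a point of `W x` contains `x`
  have hWV : ∀ x z s, z ∈ W x → z ∈ closure (v s) → W x ≤ V s := fun x z s hz hs y hy => by
    have hx : x ∈ closure (v s) := by
      by_contra hx
      exact hz.2 (Set.mem_iUnion.2 ⟨⟨s, hx⟩, hs⟩)
    exact huV s (Set.mem_iInter₂.1 hy.1 s hx)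
  have hex : ∀ z, ∃ s, z ∈ closure (v s) := fun z => by
    obtain ⟨s, hs⟩ := Set.iUnion_eq_univ_iff.1 hvU z
    exact ⟨s, subset_closure hs⟩
  let U : X → Opens X := fun x =>
    ⟨connectedComponentIn (W x) x, (W x).isOpen.connectedComponentIn⟩
  have hUW : ∀ x, U x ≤ W x := fun x => connectedComponentIn_subset _ x
  refine ⟨U, fun x => mem_connectedComponentIn (hW x), fun x =>
    isPreconnected_connectedComponentIn, fun x => ?_, fun x y z hx hy => ?_⟩
  · obtain ⟨s, hs⟩ := hex x
    exact ⟨s, (hUW x).trans (hWV x x s (hW x) hs)⟩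
  · obtain ⟨s, hs⟩ := hex z
    exact ⟨s, (hUW x).trans (hWV x z s (hUW x hx) hs), (hUW y).trans (hWV y z s (hUW y hy) hs)⟩

theorem locallyConnectedSpace_of_normedSpace (𝕜 : Type*) [RCLike 𝕜] (E : Type*)
    [NormedAddCommGroup E] [NormedSpace 𝕜 E] : LocallyConnectedSpace E := by
  let : NormedSpace ℝ E := NormedSpace.restrictScalars ℝ 𝕜 E
  exact locallyConnectedSpace_of_connected_bases (fun x r => Metric.ball x r) (fun _ r => 0 < r)
      (fun _ => Metric.nhds_basis_ball) fun x r _ => (convex_ball x r).isPreconnected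

namespace FunAlg

variable {X : Type u} [TopologicalSpace X] {A : FunAlg X}

theorem VField.eq_of_isEmpty {U : Opens X} (hU : ∀ x, x ∉ U) (D D' : A.VField U) : D = D' :=
  Subtype.ext (funext fun V => Derivation.ext fun f =>
    Fn.ext_ev fun x hx => absurd (V.2 hx) (hU x))

variable {S : A.FMan} {g : S.Metric} {B : CardyFibration.{u, w} g} {n : ℕ}

/-- The morphism `𝒪 → Γ_aa` given by `f ↦ f • 1`. -/
def EnrCat.smulOne {U : Opens X} (C : A.EnrCat.{u, w} U) (a : C.Obj) :
    (A.str U).Hom (C.Γ a a) where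
  app V h := LinearMap.toSpanSingleton (A.Fn V) _ (C.one a V h)
  nat hV h f := by
    refine (Mod.res_smul _ hV h (show A.Fn _ from f) _).trans ?_
    rw [C.one_res]
    rfl

/-- The locally constant permutations relating the idempotents are constant, as a system of simple
labels requires, on a cover by connected sets any two of which, if they meet, lie in a common
semisimple set. -/
theorem CardyFibration.IsMaximal.nonempty_simpleLabels [T2Space X] [ParacompactSpace X]
    [LocallyConnectedSpace X] (hA : A.IsLocal) (hS : S.IsSemisimple n) (hB : B.IsMaximal n) :
    Nonempty (SimpleLabels B n) := by
  choose V ε hxV hε ξ hξ using hB.exists_simple_labels hA hS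
  obtain ⟨U, hxU, hUc, hUV, hUU⟩ := exists_connected_barycentric_refinement V hxV
  choose s hs using hUV
  -- the index set is `X` itself, with an arbitrary linear order: comparability of the indices of
  -- members which meet is then automatic
  classical
  let := linearOrderOfSTO (WellOrderingRel : X → X → Prop)
  let 𝔘 : OrderedCover X :=
    { ι := X
      U := U
      covers := fun x => ⟨x, hxU x⟩
      total := fun α β _ _ _ => le_total (α := X) α β }
  have hperm : ∀ α β : X, ∃ π : Equiv.Perm (Fin n), ∀ i,
      VField.res (inf_le_left.trans (hs α) : U α ⊓ U β ≤ V (s α)) (ε (s α) i) =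
        VField.res (inf_le_right.trans (hs β) : U α ⊓ U β ≤ V (s β)) (ε (s β) (π i)) := by
    intro α β
    by_cases hne : ∃ z, z ∈ U α ∧ z ∈ U β
    -- if `U α` and `U β` meet, both frames differ by permutations from one on a common larger set;
    -- over the empty set all fields agree
    · obtain ⟨z, hzα, hzβ⟩ := hne
      obtain ⟨t, hα, hβ⟩ := hUU α β z hzα hzβ
      obtain ⟨π, hπ⟩ := ((hε (s α)).restrict (hs α)).exists_perm hA (hUc α) (hxU α)
        ((hε t).restrict hα)
      obtain ⟨π', hπ'⟩ := ((hε (s β)).restrict (hs β)).exists_perm hA (hUc β) (hxU β)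
        ((hε t).restrict hβ)
      refine ⟨π.trans π'.symm, fun i => ?_⟩
      have h1 := congrArg (VField.res (inf_le_left : U α ⊓ U β ≤ U α)) (hπ i)
      have h2 := congrArg (VField.res (inf_le_right : U α ⊓ U β ≤ U β)) (hπ' (π'.symm (π i)))
      rw [Equiv.apply_symm_apply] at h2
      exact h1.trans h2.symm
    · exact ⟨1, fun i => VField.eq_of_isEmpty (fun z hz => hne ⟨z, hz⟩) _ _⟩
  choose π hπ using hperm
  exact ⟨{
    cover := 𝔘
    ε := fun α i => VField.res (hs α) (ε (s α) i)
    frame := fun α => (hε (s α)).restrict (hs α)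
    perm := π
    perm_spec := hπ
    ξ := fun α i => B.rs (hs α) (ξ (s α) i)
    supported := fun α i => ((hξ (s α) i).rs (hs α)).supported
    simple := fun α i => ⟨(B.enr (U α)).smulOne _, ((hξ (s α) i).rs (hs α)).bij⟩ }⟩

end FunAlg

theorem mainTheorem1 {𝕜 : Type*} [RCLike 𝕜] [NormedAlgebra 𝕜 ℂ] (k : WithTop ℕ∞)
    (hk : k = ∞ ∨ k = ω) (n : ℕ) (M : Type u) [TopologicalSpace M] [T2Space M] [ParacompactSpace M]
    [ChartedSpace (EuclideanSpace 𝕜 (Fin n)) M]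
    [IsManifold 𝓘(𝕜, EuclideanSpace 𝕜 (Fin n)) k M]
    (S : (manifoldFunctions 𝕜 n k M).FMan) (hS : S.IsSemisimple n) (g : S.Metric)
    (B : FunAlg.CardyFibration.{u, w} g) (hB : B.IsMaximal n) :
    Nonempty (FunAlg.SimpleLabels B n) ∧
    (∀ D : FunAlg.SimpleLabels B n,
      D.transition.IsTwoVectorBundle ∧
      ∀ (α β : D.cover.ι) (h : α < β) (i : Fin n),
        (D.transition.E h i (D.perm α β i)).HasRank 1 ∧
        B.IsTensor (D.transition.E h i (D.perm α β i)) (D.ξ β (D.perm α β i)) (D.ξ α i)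
          inf_le_right inf_le_left ∧
        ∀ j, j ≠ D.perm α β i → (D.transition.E h i j).HasRank 0) ∧
    ∀ D D' : FunAlg.SimpleLabels B n, D.transition.Equivalent D'.transition := by
  have := locallyConnectedSpace_of_normedSpace 𝕜 (EuclideanSpace 𝕜 (Fin n))
  have := ChartedSpace.locallyConnectedSpace (EuclideanSpace 𝕜 (Fin n)) M
  have hA := FunAlg.isLocal_manifoldFunctions 𝕜 n k M
  refine ⟨hB.nonempty_simpleLabels hA hS, fun D => ⟨D.isTwoVectorBundle hA, fun α β h i =>
    ⟨?_, D.isTensor_transition hA h i, fun j hj => ?_⟩⟩, fun D D' => D.transition_equivalent hA D'⟩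
  · have h1 := D.hasRank_transition hA h i (D.perm α β i)
    rwa [FunAlg.permRank, Matrix.of_apply, if_pos rfl] at h1
  · have h1 := D.hasRank_transition hA h i j
    rwa [FunAlg.permRank, Matrix.of_apply, if_neg hj] at h1
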